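/- Let $\mathbb T=\mathbb R/2\pi\mathbb Z$ and let $\alpha,\beta\in\mathbb R$ with $\alpha\neq0$ and $\frac{3\beta}{5\alpha}\neq k_1^2+k_2^2+k_1k_2$ for all nonzero integers $k_1,k_2$. Write $\langle x\rangle=1+|x|$ and let $\widehat u(k,\tau)$ $(k\in\mathbb Z,\ \tau\in\mathbb R)$ be the space-time Fourier transform of a (complex-valued) function or distribution $u$ on $\mathbb T\times\mathbb R$, with normalization $\frac1{(2\pi)^2}\iint e^{-i(kx+\tau t)}u\,dx\,dt$. Define $$\|u\|_{X^{s,b}}=\|\langle k\rangle^s\langle\tau+\alpha k^5-\beta k^3\rangle^b\,\widehat u(k,\tau)\|_{\ell^2_kL^2_\tau},$$ $$\|u\|_{Y^s}=\|u\|_{X^{s,1/2}}+\|\langle k\rangle^s\widehat u(k,\tau)\|_{\ell^2_kL^1_\tau},\qquad \|u\|_{Z^s}=\|u\|_{X^{s,-1/2}}+\Big\|\frac{\langle k\rangle^s\widehat u(k,\tau)}{\langle\tau+\alpha k^5-\beta k^3\rangle}\Big\|_{\ell^2_kL^1_\tau},$$ and, for $N\in\{X^{s,b},Y^s,Z^s\}$,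 the restricted norm $\|u\|_{N_\delta}=\inf\{\|\tilde u\|_N:\tilde u=u\text{ on }t\in[0,\delta]\}$. Then the following hold. (1) For $-\frac12<b<b'<\frac12$ there is a constant $C=C(b,b')>0$ such that, for all $s\ge0$, all $0<\delta<1$ and all $u$, $$\|u\|_{X^{s,b}_\delta}\le C\,\delta^{b'-b}\,\|u\|_{X^{s,b'}_\delta}.$$ (2) For every $\varepsilon>0$ there is a constant $C=C(\varepsilon)>0$ such that, for all $s\ge0$, all $0<\delta<1$ and all $u$, $$\|u\|_{Z^s_\delta}\le C\,\delta^{1-\varepsilon}\,\|u\|_{Y^s_\delta}.$$ (3) For every $s\ge0$ there is a constant $C=C(\alpha,\beta,s)>0$ such that, for all $0<\delta<1$ and all functions $u_1,u_2\in X^{s,3/10}_\delta$ with $\int_{\mathbb T}u_j(x,t)\,dx=0$ for almost every $t\in(0,\delta)$, the product $u_1u_2$ is integrable on $\mathbb T\times(0,\delta)$ and $$\|\partial_x(u_1u_2)\|_{Z^s_\delta}\le C\,\|u_1\|_{X^{s,3/10}_\delta}\,\|u_2\|_{X^{s,3/10}_\delta}.$$ The constants in (1) and (2) do not depend on $\alpha$,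 $\beta$, $s$, $\delta$ or $u$. -/

import Mathlib

open MeasureTheory Set
open scoped SchwartzMap ENNReal Real

noncomputable section

namespace Kawahara

instance fact_two_pi_pos : Fact (0 < 2 * π) := ⟨Real.two_pi_pos⟩

/-- The torus `ℝ / 2πℤ`. -/
abbrev Torus := AddCircle (2 * π)

/-- The Japanese bracket `⟨x⟩ = 1 + |x|`. -/
def bracket (x : ℝ) : ℝ := 1 + |x|

/-- The modulation `τ + α k⁵ - β k³`. -/
def modul (α β : ℝ) (k : ℤ) (τ : ℝ) : ℝ := τ + α * (k : ℝ) ^ 5 - β * (k : ℝ) ^ 3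

/-- The non-resonance condition `3β/(5α) ≠ k₁² + k₂² + k₁k₂` for all nonzero integers `k₁, k₂`. -/
def NonResonant (α β : ℝ) : Prop :=
  ∀ k₁ k₂ : ℤ, k₁ ≠ 0 → k₂ ≠ 0 →
    3 * β / (5 * α) ≠ (k₁ : ℝ) ^ 2 + (k₂ : ℝ) ^ 2 + (k₁ : ℝ) * (k₂ : ℝ)

/-- Space-time distributions on `𝕋 × ℝ`, given by their spatial Fourier coefficients: `u k` is the
coefficient `u_k(t) = (1/2π) ∫ e^{-ikx} u(x,t) dx`, a tempered distribution in time. No growth in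
`k` is imposed here; finiteness of the norms below enforces it. -/
abbrev PDist := ℤ → 𝓢'(ℝ, ℂ)

/-- The distributional derivative `∂ₓ`, which multiplies the `k`-th spatial coefficient by `ik`. -/
def dx (u : PDist) : PDist := fun k => (Complex.I * (k : ℂ)) • u k

/-- `U` is the space-time Fourier transform `û(k,τ)` of `u` (with the normalization
`û(τ) = (1/2π) ∫ e^{-iτt} u(t) dt`): for every `k`, `u_k(t) = ∫ e^{iτt} U(k,τ) dτ` in the sense of
tempered distributions. -/
def IsFourier (u : PDist) (U : ℤ → ℝ → ℂ) : Prop :=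
  ∀ k : ℤ, AEStronglyMeasurable (U k) volume ∧
    ∀ φ : 𝓢(ℝ, ℂ),
      Integrable (fun τ : ℝ => U k τ * ∫ t : ℝ, Complex.exp (Complex.I * τ * t) * φ t) ∧
      u k φ = ∫ τ : ℝ, U k τ * ∫ t : ℝ, Complex.exp (Complex.I * τ * t) * φ t

/-- `‖⟨k⟩^s ⟨τ + αk⁵ - βk³⟩^b U(k,τ)‖` in `ℓ²_k L^2_τ`. -/
def wL2 (α β s b : ℝ) (U : ℤ → ℝ → ℂ) : ℝ≥0∞ :=
  (∑' k : ℤ, ∫⁻ τ : ℝ,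
    (ENNReal.ofReal (bracket k ^ s * bracket (modul α β k τ) ^ b) * ‖U k τ‖ₑ) ^ (2 : ℝ))
    ^ (1 / 2 : ℝ)

/-- `‖⟨k⟩^s ⟨τ + αk⁵ - βk³⟩^b U(k,τ)‖` in `ℓ²_k L^1_τ`. -/
def wL1 (α β s b : ℝ) (U : ℤ → ℝ → ℂ) : ℝ≥0∞ :=
  (∑' k : ℤ, (∫⁻ τ : ℝ,
    ENNReal.ofReal (bracket k ^ s * bracket (modul α β k τ) ^ b) * ‖U k τ‖ₑ) ^ (2 : ℝ))
    ^ (1 / 2 : ℝ)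

/-- The value of a functional `N` of the Fourier transform of `u`; it is `∞` if the Fourier
transform of `u` is not a function. (The Fourier transform is unique almost everywhere, so the
infimum only selects it.) -/
def viaFourier (N : (ℤ → ℝ → ℂ) → ℝ≥0∞) (u : PDist) : ℝ≥0∞ :=
  ⨅ (U : ℤ → ℝ → ℂ) (_ : IsFourier u U), N U

/-- The `X^{s,b}` norm, `∞` outside the space. -/
def normX (α β s b : ℝ) (u : PDist) : ℝ≥0∞ := viaFourier (wL2 α β s b) u

/-- The `Y^s` norm, `∞` outside the space. -/
def normY (α β s : ℝ) (u : PDist) : ℝ≥0∞ :=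
  viaFourier (fun U => wL2 α β s (1 / 2) U + wL1 α β s 0 U) u

/-- The `Z^s` norm, `∞` outside the space. -/
def normZ (α β s : ℝ) (u : PDist) : ℝ≥0∞ :=
  viaFourier (fun U => wL2 α β s (-1 / 2) U + wL1 α β s (-1) U) u

/-- `u = v` on the time interval from `0` to `δ`, as distributions. -/
def EqOnTime (δ : ℝ) (u v : PDist) : Prop :=
  ∀ (k : ℤ) (φ : 𝓢(ℝ, ℂ)), tsupport φ ⊆ Ioo 0 δ → u k φ = v k φ

/-- The restricted norm: the infimum of `N ũ` over all `ũ` that agree with `u` on `[0, δ]`. -/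
def restr (δ : ℝ) (N : PDist → ℝ≥0∞) (u : PDist) : ℝ≥0∞ :=
  ⨅ (v : PDist) (_ : EqOnTime δ v u), N v

/-- The `X^{s,b}_δ` norm. -/
def normXδ (α β s b δ : ℝ) : PDist → ℝ≥0∞ := restr δ (normX α β s b)

/-- The `Y^s_δ` norm. -/
def normYδ (α β s δ : ℝ) : PDist → ℝ≥0∞ := restr δ (normY α β s)

/-- The `Z^s_δ` norm. -/
def normZδ (α β s δ : ℝ) : PDist → ℝ≥0∞ := restr δ (normZ α β s)

/-- The measure on `𝕋 × (0, δ)`, namely `dx/(2π) ⊗ dt`. -/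
def slab (δ : ℝ) : Measure (Torus × ℝ) :=
  (AddCircle.haarAddCircle : Measure Torus).prod ((volume : Measure ℝ).restrict (Ioo 0 δ))

theorem integrable_coeff {δ : ℝ} {f : Torus × ℝ → ℂ} (hf : Integrable f (slab δ)) (k : ℤ) :
    Integrable ((Ioo 0 δ).indicator fun t => fourierCoeff (fun x : Torus => f (x, t)) k)
      (volume : Measure ℝ) := by
  rw [integrable_indicator_iff measurableSet_Ioo]
  have h : Integrable (fun p : Torus × ℝ => fourier (-k) p.1 * f p) (slab δ) := by
    refine hf.bdd_mul (c := 1) ?_ ?_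
    · exact ((fourier (-k)).continuous.comp continuous_fst).aestronglyMeasurable
    · exact Filter.Eventually.of_forall fun p =>
        ((fourier (-k)).norm_coe_le_norm p.1).trans (fourier_norm (-k)).le
  have h2 := h.integral_prod_right
  simpa [IntegrableOn, fourierCoeff] using h2

/-- The distribution on `𝕋 × ℝ` given by an integrable function on `𝕋 × (0, δ)`, extended by zero
to other times: its `k`-th spatial coefficient is `φ ↦ ∫_0^δ f_k(t) φ(t) dt`. -/
def ofFun {δ : ℝ} {f : Torus × ℝ → ℂ} (hf : Integrable f (slab δ)) : PDist := fun k =>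
  Lp.toTemperedDistribution (memLp_one_iff_integrable.2 (integrable_coeff hf k)).toLp

theorem ofFun_apply {δ : ℝ} {f : Torus × ℝ → ℂ} (hf : Integrable f (slab δ)) (k : ℤ)
    (φ : 𝓢(ℝ, ℂ)) :
    ofFun hf k φ = ∫ t in Ioo 0 δ, φ t * fourierCoeff (fun x : Torus => f (x, t)) k := by
  rw [ofFun, Lp.toTemperedDistribution_apply, ← integral_indicator measurableSet_Ioo]
  refine integral_congr_ae ?_
  filter_upwards [(memLp_one_iff_integrable.2 (integrable_coeff hf k)).coeFn_toLp] with t ht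
  rw [ht]
  by_cases h : t ∈ Ioo 0 δ <;> simp [h]

/-- `∫_𝕋 f(x,t) dx = 0` for almost every `t ∈ (0, δ)`. -/
def MeanZero (δ : ℝ) (f : Torus × ℝ → ℂ) : Prop :=
  ∀ᵐ t ∂((volume : Measure ℝ).restrict (Ioo 0 δ)), ∫ x : Torus, f (x, t) = 0

end Kawahara

end

noncomputable section

namespace Kawahara

/-! All three estimates are proved for extensions to the whole line and then passed to the infimum.

(1) An extension is multiplied by `η(t/δ)`, with `η = 1` on `[0, 1]`. In frequency this is, mode by
mode, convolution with `δκ(δ·)`, and translating `τ` by `βk³ - αk⁵` turns the modulation weight into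
a power of `⟨τ⟩`. In the variable `x = δ|τ|` the bracket is `(δ + x)/δ`: the powers of `δ` come out
as `δ^(b'-b)`, and what is left has at worst singularities `x^(-θ)` with `θ = max |b| |b'| < 1/2`,
which are square integrable near zero uniformly in `δ`. A weighted Schur test then gives
`lintegral_convolution_sq_le`.

(2) For `a > -1/2`, Cauchy–Schwarz in `τ` bounds the `Z^s` norm by the `X^{s,a}` norm
(`exists_normZδ_le`). Localisation from the exponent `1/2 - e` to `-1/2 + e` gains `δ^(1-2e)`, and
`Y^s` controls `X^{s,1/2-e}`.

(3) By the same bound it suffices to work in `X^{s,-2/5}`. If `k = k₁ + k₂`, the modulation of the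
output minus those of the inputs equals `5α k k₁ k₂ (k₁² + k₂² + k₁k₂ - 3β/(5α))`. The last factor
is the nonzero difference of an integer and a fixed number, hence bounded below by a multiple of
`k₁² + k₂²`; so one of the three modulations is large (`exists_resonance_le`). Its weight is traded
for the power `-3/10` of the resonance function. The two remaining weights of exponent `-3/10`
suffice for Cauchy–Schwarz in the time frequency, because `4 · 3/10 > 1` (`exists_two_mode_bound`).
The resonance gain also absorbs the derivative: where `|j| ≤ |m|` the squared multiplier is at most
a multiple of `|m|^(-2/5) |j|^(-3/5)`, whose sum over such `j` is bounded (`tsum_mult_sq_le`). The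
mean zero condition removes the zero frequencies.

The estimate is about an actual product of functions. Finite `X^{s,3/10}` norm puts the extensions
in `L²`; so almost every time slice is in `L²(𝕋)`, the product is integrable, and on `(0, δ)` its
coefficients are given by the convolution of the Fourier transforms of the extensions
(`product_eq`). -/

theorem lintegral_mul_sq_le {X : Type*} [MeasurableSpace X] {μ : Measure X} {f g : X → ℝ≥0∞}
    (hf : AEMeasurable f μ) (hg : AEMeasurable g μ) :
    (∫⁻ x, f x * g x ∂μ) ^ 2 ≤ (∫⁻ x, f x ^ 2 ∂μ) * ∫⁻ x, g x ^ 2 ∂μ := by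
  have h := ENNReal.lintegral_mul_le_Lp_mul_Lq μ Real.HolderConjugate.two_two hf hg
  simp only [Pi.mul_apply, ENNReal.rpow_two] at h
  calc (∫⁻ x, f x * g x ∂μ) ^ 2 ≤ ((∫⁻ x, f x ^ 2 ∂μ) ^ (1 / 2 : ℝ) *
      (∫⁻ x, g x ^ 2 ∂μ) ^ (1 / 2 : ℝ)) ^ 2 := by gcongr
    _ = _ := by
      rw [mul_pow, ← ENNReal.rpow_two, ← ENNReal.rpow_two, ← ENNReal.rpow_mul, ← ENNReal.rpow_mul]
      norm_num

theorem tsum_mul_sq_le {ι : Type*} [Countable ι] (f g : ι → ℝ≥0∞) :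
    (∑' i, f i * g i) ^ 2 ≤ (∑' i, f i ^ 2) * ∑' i, g i ^ 2 := by
  let _ : MeasurableSpace ι := ⊤
  have _ : DiscreteMeasurableSpace ι := ⟨fun _ => trivial⟩
  have h := lintegral_mul_sq_le (μ := Measure.count) (f := f) (g := g)
    (measurable_of_countable f).aemeasurable (measurable_of_countable g).aemeasurable
  simpa only [lintegral_count] using h

theorem le_of_sq_le_sq {a b : ℝ≥0∞} (h : a ^ 2 ≤ b ^ 2) : a ≤ b :=
  (ENNReal.pow_le_pow_left_iff two_ne_zero).1 h

/-- Minkowski's inequality for countable sums in `L²`. -/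
theorem lintegral_tsum_sq_le {X ι : Type*} [Countable ι] [MeasurableSpace X] {μ : Measure X}
    {f : ι → X → ℝ≥0∞} {A : ι → ℝ≥0∞} (hf : ∀ i, AEMeasurable (f i) μ)
    (h : ∀ i, ∫⁻ x, f i x ^ 2 ∂μ ≤ A i ^ 2) :
    ∫⁻ x, (∑' i, f i x) ^ 2 ∂μ ≤ (∑' i, A i) ^ 2 := by
  -- The square of the sum is a double sum, so it is enough to bound each cross term by
  -- Cauchy–Schwarz.
  have hij : ∀ i j, ∫⁻ x, f i x * f j x ∂μ ≤ A i * A j := fun i j => by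
    refine le_of_sq_le_sq ((lintegral_mul_sq_le (hf i) (hf j)).trans ?_)
    rw [mul_pow]
    exact mul_le_mul' (h i) (h j)
  calc ∫⁻ x, (∑' i, f i x) ^ 2 ∂μ = ∫⁻ x, ∑' i, ∑' j, f i x * f j x ∂μ := by
        simp_rw [sq, ENNReal.tsum_mul_left, ENNReal.tsum_mul_right]
    _ = ∑' i, ∑' j, ∫⁻ x, f i x * f j x ∂μ := by
        refine (lintegral_tsum fun i => AEMeasurable.tsum fun j => (hf i).mul (hf j)).trans ?_
        exact tsum_congr fun i => lintegral_tsum fun j => (hf i).mul (hf j)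
    _ ≤ ∑' i, ∑' j, A i * A j := ENNReal.tsum_le_tsum fun i => ENNReal.tsum_le_tsum fun j => hij i j
    _ = (∑' i, A i) ^ 2 := by simp_rw [sq, ENNReal.tsum_mul_left, ENNReal.tsum_mul_right]

/-! ### Brackets, weights and the norms mode by mode -/

theorem bracket_pos (x : ℝ) : 0 < bracket x := by unfold bracket; positivity

theorem one_le_bracket (x : ℝ) : 1 ≤ bracket x := by unfold bracket; linarith [abs_nonneg x]

theorem bracket_add_le (x y : ℝ) : bracket (x + y) ≤ bracket x * bracket y := by
  unfold bracket
  nlinarith [abs_add_le x y, abs_nonneg x, abs_nonneg y, mul_nonneg (abs_nonneg x) (abs_nonneg y)]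

theorem bracket_neg (x : ℝ) : bracket (-x) = bracket x := by simp [bracket]

@[fun_prop]
theorem continuous_bracket : Continuous bracket := by unfold bracket; fun_prop

/-- The weight `⟨x⟩ ^ b`, with values in `[0, ∞]`. -/
def weight (b x : ℝ) : ℝ≥0∞ := ENNReal.ofReal (bracket x ^ b)

theorem continuous_bracket_rpow (b : ℝ) : Continuous fun x => bracket x ^ b :=
  continuous_bracket.rpow_const fun x => Or.inl (bracket_pos x).ne'

@[fun_prop]
theorem measurable_weight (b : ℝ) : Measurable (weight b) :=
  (continuous_bracket_rpow b).measurable.ennreal_ofReal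

theorem weight_mul (a b x : ℝ) : weight a x * weight b x = weight (a + b) x := by
  rw [weight, weight, weight, ← ENNReal.ofReal_mul (Real.rpow_nonneg (bracket_pos x).le _),
    Real.rpow_add (bracket_pos x)]

theorem weight_zero (x : ℝ) : weight 0 x = 1 := by simp [weight]

theorem weight_sq (b x : ℝ) : weight b x ^ 2 = weight (2 * b) x := by
  rw [sq, weight_mul, two_mul]

theorem weight_mono {a b : ℝ} (h : a ≤ b) (x : ℝ) : weight a x ≤ weight b x :=
  ENNReal.ofReal_le_ofReal (Real.rpow_le_rpow_of_exponent_le (one_le_bracket x) h)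

theorem weight_ne_top (b x : ℝ) : weight b x ≠ ⊤ := ENNReal.ofReal_ne_top

theorem weight_ne_zero (b x : ℝ) : weight b x ≠ 0 := by
  rw [weight, Ne, ENNReal.ofReal_eq_zero, not_le]
  exact Real.rpow_pos_of_pos (bracket_pos x) b

theorem weight_neg (b x : ℝ) : weight b (-x) = weight b x := by rw [weight, bracket_neg, weight]

theorem weight_add_le {b : ℝ} (hb : 0 ≤ b) (x y : ℝ) :
    weight b (x + y) ≤ weight b x * weight b y := by
  rw [weight, weight, weight, ← ENNReal.ofReal_mul (Real.rpow_nonneg (bracket_pos x).le _),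
    ← Real.mul_rpow (bracket_pos x).le (bracket_pos y).le]
  exact ENNReal.ofReal_le_ofReal
    (Real.rpow_le_rpow (bracket_pos _).le (bracket_add_le x y) hb)

theorem lintegral_weight_lt_top {b : ℝ} (hb : b < -1) : ∫⁻ x, weight b x < ⊤ := by
  have h := finite_integral_one_add_norm (E := ℝ) (μ := volume) (r := -b) (by simp; linarith)
  simpa [weight, bracket] using h

theorem lintegral_comp_sub_right (f : ℝ → ℝ≥0∞) (a : ℝ) : ∫⁻ x, f (x - a) = ∫⁻ x, f x :=
  lintegral_sub_right_eq_self f a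

/-- Rescaling of the line. -/
theorem lintegral_ofReal_mul_comp_mul {c : ℝ} (hc : 0 < c) {f : ℝ → ℝ≥0∞} (hf : Measurable f) :
    ∫⁻ x, ENNReal.ofReal c * f (c * x) = ∫⁻ x, f x := by
  conv_rhs => rw [← Real.smul_map_volume_mul_left hc.ne', abs_of_pos hc]
  rw [lintegral_smul_measure, lintegral_map hf (measurable_const_mul c), smul_eq_mul,
    lintegral_const_mul' _ _ ENNReal.ofReal_ne_top]

/-- The spatial weight is harmless: `wL2` as a sum over modes of weighted norms on the line. -/
theorem wL2_sq (α β s b : ℝ) (U : ℤ → ℝ → ℂ) :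
    wL2 α β s b U ^ 2 =
      ∑' k : ℤ, weight s k ^ 2 * ∫⁻ τ, (weight b (modul α β k τ) * ‖U k τ‖ₑ) ^ 2 := by
  rw [wL2, ← ENNReal.rpow_two, ← ENNReal.rpow_mul]
  norm_num
  refine tsum_congr fun k => ?_
  rw [← lintegral_const_mul' _ _ (ENNReal.pow_ne_top (weight_ne_top _ _))]
  refine lintegral_congr fun τ => ?_
  rw [← mul_pow, ← mul_assoc, weight, weight,
    ENNReal.ofReal_mul (Real.rpow_nonneg (bracket_pos _).le _)]

theorem wL1_sq (α β s b : ℝ) (U : ℤ → ℝ → ℂ) :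
    wL1 α β s b U ^ 2 =
      ∑' k : ℤ, weight s k ^ 2 * (∫⁻ τ, weight b (modul α β k τ) * ‖U k τ‖ₑ) ^ 2 := by
  rw [wL1, ← ENNReal.rpow_two, ← ENNReal.rpow_mul]
  norm_num
  refine tsum_congr fun k => ?_
  rw [← mul_pow, ← lintegral_const_mul' _ _ (weight_ne_top _ _)]
  congr 1
  refine lintegral_congr fun τ => ?_
  rw [← mul_assoc, weight, weight,
    ENNReal.ofReal_mul (Real.rpow_nonneg (bracket_pos _).le _)]

theorem modul_eq_sub (α β : ℝ) (k : ℤ) (τ : ℝ) :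
    modul α β k τ = τ - (β * (k : ℝ) ^ 3 - α * (k : ℝ) ^ 5) := by unfold modul; ring

@[fun_prop]
theorem continuous_modul (α β : ℝ) (k : ℤ) : Continuous (modul α β k) := by
  unfold modul; fun_prop

/-! ### Weighted convolution estimate on the line -/

theorem peetre {x y z b c : ℝ} (hx : 0 ≤ x) (hy : 0 ≤ y) (hz : |x - y| ≤ z) (hb : |b| ≤ c) :
    (1 + x) ^ b ≤ (1 + y) ^ b * (1 + z) ^ c := by
  have hz0 : 0 ≤ z := (abs_nonneg _).trans hz
  have hyz := mul_nonneg hy hz0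
  have hxz := mul_nonneg hx hz0
  obtain ⟨h1, h2⟩ := abs_le.1 hz
  have hc : (1 + z) ^ |b| ≤ (1 + z) ^ c := Real.rpow_le_rpow_of_exponent_le (by linarith) hb
  refine le_trans ?_ (mul_le_mul_of_nonneg_left hc (by positivity))
  -- For negative exponents `x` and `y` exchange roles; the hypothesis on `|x - y|` is symmetric.
  rcases le_total 0 b with h | h
  · rw [abs_of_nonneg h, ← Real.mul_rpow (by linarith) (by linarith)]
    exact Real.rpow_le_rpow (by linarith) (by nlinarith) h
  · rw [abs_of_nonpos h, Real.rpow_neg (by linarith), ← div_eq_mul_inv,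
      le_div_iff₀ (by positivity), ← Real.mul_rpow (by linarith) (by linarith)]
    exact Real.rpow_le_rpow_of_nonpos (by linarith) (by nlinarith) h

/-- The loss in passing from `D + x` to `1 + x` under a power of absolute value at most `θ`. -/
def profile (θ D x : ℝ) : ℝ := ((1 + x) / (D + x)) ^ θ

/-- Since `D ≤ 1` the ratio `(1 + x)/(D + x)` is at least `1`, so its exponent `-b` may be raised to
`θ` whatever the sign of `b`. -/
theorem rpow_le_profile {D x b θ : ℝ} (hD : 0 < D) (hD1 : D ≤ 1) (hx : 0 ≤ x) (hb : |b| ≤ θ) :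
    (D + x) ^ b ≤ (1 + x) ^ b * profile θ D x := by
  have h1 : 0 < D + x := by linarith
  have h2 : 0 < 1 + x := by linarith
  have hr : 1 ≤ (1 + x) / (D + x) := (one_le_div h1).2 (by linarith)
  calc (D + x) ^ b = (1 + x) ^ b * ((1 + x) / (D + x)) ^ (-b) := by
        rw [Real.rpow_neg (by positivity), Real.div_rpow h2.le h1.le]
        have := (Real.rpow_pos_of_pos h2 b).ne'
        have := (Real.rpow_pos_of_pos h1 b).ne'
        field_simp
    _ ≤ _ := by
        refine mul_le_mul_of_nonneg_left ?_ (by positivity)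
        exact Real.rpow_le_rpow_of_exponent_le hr ((neg_le_abs b).trans hb)

/-- With `x = δ|τ|` the bracket is `(δ + x)/δ`, so the powers of `δ` factor out exactly. Passing
from `δ + x` to `1 + x` costs a profile at each of the two points, and Peetre's inequality compares
`1 + x` with `1 + y`. -/
theorem bracket_rpow_le {δ b b' θ τ σ : ℝ} (hδ : 0 < δ) (hδ1 : δ ≤ 1) (hb : |b| ≤ θ)
    (hb' : |b'| ≤ θ) (hbb : b ≤ b') (hθ : θ ≤ 1 / 2) :
    bracket τ ^ b ≤ δ ^ (b' - b) * (profile θ δ (δ * |τ|) * profile θ δ (δ * |σ|) *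
      (1 + δ * |τ - σ|) ^ (1 / 2 : ℝ)) * bracket σ ^ b' := by
  set x := δ * |τ| with hx
  set y := δ * |σ| with hy
  have hx0 : 0 ≤ x := by positivity
  have hy0 : 0 ≤ y := by positivity
  have hp : ∀ z, 0 ≤ z → 0 ≤ profile θ δ z := fun z hz => by unfold profile; positivity
  have e1 : bracket τ ^ b = δ ^ (-b) * (δ + x) ^ b := by
    have : δ + x = δ * bracket τ := by rw [hx, bracket]; ring
    rw [this, Real.mul_rpow hδ.le (bracket_pos _).le, ← mul_assoc, ← Real.rpow_add hδ,
      neg_add_cancel, Real.rpow_zero, one_mul]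
  have e2 : bracket σ ^ b' * (δ + y) ^ (-b') = δ ^ (-b') := by
    have : δ + y = δ * bracket σ := by rw [hy, bracket]; ring
    rw [this, Real.mul_rpow hδ.le (bracket_pos _).le, mul_left_comm, ← Real.rpow_add (bracket_pos _),
      add_neg_cancel, Real.rpow_zero, mul_one]
  have i1 := rpow_le_profile hδ hδ1 hx0 hb
  have i2 := rpow_le_profile (b := -b') (θ := θ) hδ hδ1 hy0 (by rwa [abs_neg])
  have i3 : (1 + y) ^ (-b') ≤ (1 + y) ^ (-b) :=
    Real.rpow_le_rpow_of_exponent_le (by linarith) (by linarith)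
  have i4 : (1 + x) ^ b ≤ (1 + y) ^ b * (1 + δ * |τ - σ|) ^ (1 / 2 : ℝ) := by
    refine peetre hx0 hy0 ?_ (hb.trans hθ)
    rw [hx, hy, ← mul_sub, abs_mul, abs_of_pos hδ]
    exact mul_le_mul_of_nonneg_left (abs_abs_sub_abs_le τ σ) hδ.le
  have i5 : (1 + y) ^ (-b) * (1 + y) ^ b = 1 := by
    rw [← Real.rpow_add (by linarith)]; simp
  set G := (1 + δ * |τ - σ|) ^ (1 / 2 : ℝ)
  have hG : 0 ≤ G := by positivity
  have key : (δ + x) ^ b * (δ + y) ^ (-b') ≤ profile θ δ x * profile θ δ y * G := by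
    calc (δ + x) ^ b * (δ + y) ^ (-b')
        ≤ ((1 + y) ^ b * G * profile θ δ x) * ((1 + y) ^ (-b) * profile θ δ y) := by
          refine mul_le_mul (i1.trans ?_) (i2.trans ?_) (by positivity) ?_
          · exact mul_le_mul_of_nonneg_right i4 (hp x hx0)
          · exact mul_le_mul_of_nonneg_right i3 (hp y hy0)
          · exact mul_nonneg (by positivity) (hp x hx0)
      _ = ((1 + y) ^ (-b) * (1 + y) ^ b) * (profile θ δ x * profile θ δ y * G) := by ring
      _ = _ := by rw [i5, one_mul]
  have e3 : (δ + y) ^ (-b') * (δ + y) ^ b' = 1 := by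
    rw [← Real.rpow_add (by linarith)]; simp
  calc bracket τ ^ b = δ ^ (-b) * (δ + x) ^ b := e1
    _ = δ ^ (b' - b) * ((δ + x) ^ b * (δ + y) ^ (-b')) * bracket σ ^ b' := by
        rw [show b' - b = b' + (-b) by ring, Real.rpow_add hδ]
        rw [show δ ^ b' * δ ^ (-b) * ((δ + x) ^ b * (δ + y) ^ (-b')) * bracket σ ^ b' =
          δ ^ b' * (bracket σ ^ b' * (δ + y) ^ (-b')) * (δ ^ (-b) * (δ + x) ^ b) by ring, e2,
          ← Real.rpow_add hδ]
        simp
    _ ≤ _ := by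
        have := bracket_pos σ
        gcongr

/-- The majorant does not depend on `D`: dropping `D` leaves the singularity `y^(-2θ)`, integrable
because `2θ < 1`, and for `y ≥ 1` the ratio is at most `2`. -/
theorem profile_sq_le {θ D y : ℝ} (hθ : 0 ≤ θ) (hθ' : θ < 1 / 2) (hD : 0 < D) (hy : 0 < y) :
    profile θ D y ^ 2 ≤ 2 + 2 * (Ioo (0 : ℝ) 1).indicator (fun y => y ^ (-(2 * θ))) y := by
  have h0 : 0 < (1 + y) / (D + y) := by positivity
  have e : profile θ D y ^ 2 = ((1 + y) / (D + y)) ^ (2 * θ) := by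
    rw [profile, ← Real.rpow_natCast, ← Real.rpow_mul h0.le]; norm_num [mul_comm]
  have h1 : (1 + y) / (D + y) ≤ (1 + y) / y := by gcongr; linarith
  have two : (2 : ℝ) ^ (2 * θ) ≤ 2 := by
    calc (2 : ℝ) ^ (2 * θ) ≤ 2 ^ (1 : ℝ) :=
          Real.rpow_le_rpow_of_exponent_le one_le_two (by linarith)
      _ = 2 := Real.rpow_one 2
  rw [e]
  by_cases hy1 : y < 1
  · rw [indicator_of_mem (show y ∈ Ioo (0 : ℝ) 1 from ⟨hy, hy1⟩)]
    calc ((1 + y) / (D + y)) ^ (2 * θ) ≤ (2 / y) ^ (2 * θ) := by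
          refine Real.rpow_le_rpow h0.le (h1.trans ?_) (by linarith)
          gcongr; linarith
      _ = 2 ^ (2 * θ) * y ^ (-(2 * θ)) := by
          rw [Real.div_rpow two_pos.le hy.le, Real.rpow_neg hy.le, div_eq_mul_inv]
      _ ≤ 2 * y ^ (-(2 * θ)) := by gcongr
      _ ≤ _ := by linarith
  · rw [indicator_of_notMem (fun h => hy1 h.2)]
    calc ((1 + y) / (D + y)) ^ (2 * θ) ≤ 2 ^ (2 * θ) := by
          refine Real.rpow_le_rpow h0.le (h1.trans ?_) (by linarith)
          rw [div_le_iff₀ hy]; linarith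
      _ ≤ _ := by linarith

theorem measurable_profile (θ D : ℝ) : Measurable fun y => profile θ D |y| := by
  unfold profile; fun_prop

/-- The substitution `y = δσ` turns the kernel into a translate of `⟨y⟩^(-3/2)`. The bounded part of
the profile is integrated against this kernel, while for the singular part the kernel is bounded by
`1`; neither `δ` nor `τ` survives. -/
theorem lintegral_profile_le {θ : ℝ} (hθ : 0 ≤ θ) (hθ' : θ < 1 / 2) :
    ∃ C : ℝ≥0∞, C ≠ ⊤ ∧ ∀ δ : ℝ, 0 < δ → ∀ τ : ℝ,
      ∫⁻ σ, ENNReal.ofReal (profile θ δ (δ * |σ|)) ^ 2 *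
        ENNReal.ofReal (δ * (1 + δ * |τ - σ|) ^ (-(3 / 2) : ℝ)) ≤ C := by
  set g : ℝ → ℝ≥0∞ := fun y =>
    ENNReal.ofReal ((Ioo (0 : ℝ) 1).indicator (fun y => y ^ (-(2 * θ))) y) with hg
  have hgm : Measurable g := by
    refine Measurable.ennreal_ofReal (Measurable.indicator ?_ measurableSet_Ioo); fun_prop
  have hgfin : ∫⁻ y, g y < ⊤ := by
    have h := (intervalIntegral.intervalIntegrable_rpow' (a := 0) (b := 1)
      (r := -(2 * θ)) (by linarith)).1
    have h' := ((h.mono_set Ioo_subset_Ioc_self).integrable_indicator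
      measurableSet_Ioo).lintegral_lt_top
    exact h'
  refine ⟨2 * (∫⁻ x, weight (-(3 / 2)) x) + 2 * (2 * ∫⁻ y, g y), ?_, fun δ hδ τ => ?_⟩
  · have := (lintegral_weight_lt_top (b := -(3 / 2)) (by norm_num)).ne
    finiteness
  have hm : Measurable fun y : ℝ => ENNReal.ofReal (profile θ δ |y|) ^ 2 *
      weight (-(3 / 2)) (δ * τ - y) :=
    ((measurable_profile θ δ).ennreal_ofReal.pow_const 2).mul
      ((measurable_weight _).comp (by fun_prop))
  calc ∫⁻ σ, ENNReal.ofReal (profile θ δ (δ * |σ|)) ^ 2 *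
        ENNReal.ofReal (δ * (1 + δ * |τ - σ|) ^ (-(3 / 2) : ℝ))
      = ∫⁻ σ, ENNReal.ofReal δ * (ENNReal.ofReal (profile θ δ |δ * σ|) ^ 2 *
          weight (-(3 / 2)) (δ * τ - δ * σ)) := by
        refine lintegral_congr fun σ => ?_
        rw [ENNReal.ofReal_mul hδ.le, weight, bracket, ← mul_sub, abs_mul, abs_mul, abs_of_pos hδ]
        ring
    _ = ∫⁻ y, ENNReal.ofReal (profile θ δ |y|) ^ 2 * weight (-(3 / 2)) (δ * τ - y) :=
        lintegral_ofReal_mul_comp_mul hδ hm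
    _ ≤ ∫⁻ y, (2 * weight (-(3 / 2)) (δ * τ - y) + 2 * (g y + g (-y))) := by
        refine lintegral_mono_ae ?_
        filter_upwards [compl_mem_ae_iff.2 (measure_singleton (μ := volume) (0 : ℝ))] with y hy
        have hy0 : 0 < |y| := abs_pos.2 hy
        -- `g` lives on `(0, 1)`; adding its reflection covers both signs of `y`.
        have hgy : ENNReal.ofReal ((Ioo (0 : ℝ) 1).indicator (fun y => y ^ (-(2 * θ))) |y|) ≤
            g y + g (-y) := by
          rcases abs_choice y with h | h <;> rw [h]
          · exact le_self_add
          · exact le_add_self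
        have hw : weight (-(3 / 2)) (δ * τ - y) ≤ 1 := by
          rw [← weight_zero (δ * τ - y)]; exact weight_mono (by norm_num) _
        have hprof : ENNReal.ofReal (profile θ δ |y|) ^ 2 ≤ 2 + 2 * (g y + g (-y)) := by
          rw [← ENNReal.ofReal_pow (by unfold profile; positivity)]
          refine (ENNReal.ofReal_le_ofReal (profile_sq_le hθ hθ' hδ hy0)).trans ?_
          rw [ENNReal.ofReal_add zero_le_two (mul_nonneg zero_le_two (indicator_nonneg
            (fun x hx => Real.rpow_nonneg hx.1.le _) _)), ENNReal.ofReal_mul zero_le_two]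
          norm_num
          gcongr
        calc _ ≤ (2 + 2 * (g y + g (-y))) * weight (-(3 / 2)) (δ * τ - y) := by gcongr
          _ = 2 * weight (-(3 / 2)) (δ * τ - y) +
              2 * (g y + g (-y)) * weight (-(3 / 2)) (δ * τ - y) := add_mul _ _ _
          _ ≤ _ := by
              exact add_le_add le_rfl (mul_le_of_le_one_right' hw)
    _ = _ := by
        rw [lintegral_add_left, lintegral_const_mul, lintegral_const_mul, lintegral_add_left hgm,
          lintegral_neg_eq_self g, two_mul (∫⁻ y, g y),
          lintegral_sub_left_eq_self (weight (-(3 / 2))) (δ * τ)]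
        · exact hgm.add (hgm.comp measurable_neg)
        · exact (measurable_weight _).comp (by fun_prop)
        · exact ((measurable_weight _).comp (by fun_prop)).const_mul _

/-- Convolution with a kernel of width `1 / δ` gains `δ ^ (b' - b)` between weighted `L²` spaces. -/
theorem lintegral_convolution_sq_le {θ : ℝ} (hθ : 0 ≤ θ) (hθ' : θ < 1 / 2) :
    ∃ C : ℝ≥0∞, C ≠ ⊤ ∧ ∀ b b' δ : ℝ, |b| ≤ θ → |b'| ≤ θ → b ≤ b' → 0 < δ → δ ≤ 1 →
      ∀ F : ℝ → ℝ≥0∞, Measurable F →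
      ∫⁻ τ, (weight b τ * ∫⁻ σ, ENNReal.ofReal (δ * (1 + δ * |τ - σ|) ^ (-2 : ℝ)) * F σ) ^ 2 ≤
        (C * ENNReal.ofReal (δ ^ (b' - b))) ^ 2 * ∫⁻ σ, (weight b' σ * F σ) ^ 2 := by
  obtain ⟨C, hC, hCb⟩ := lintegral_profile_le hθ hθ'
  refine ⟨C, hC, fun b b' δ hb hb' hbb hδ hδ1 F hF => ?_⟩
  set P : ℝ → ℝ≥0∞ := fun σ => ENNReal.ofReal (profile θ δ (δ * |σ|)) with hP
  set H : ℝ → ℝ≥0∞ := fun x => ENNReal.ofReal (δ * (1 + δ * |x|) ^ (-(3 / 2) : ℝ)) with hH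
  set R : ℝ → ℝ≥0∞ := fun x => ENNReal.ofReal ((δ * (1 + δ * |x|) ^ (-(3 / 2) : ℝ)) ^ (1 / 2 : ℝ))
    with hR
  have hPm : Measurable P := by
    refine Measurable.ennreal_ofReal ?_
    unfold profile; fun_prop
  have hHm : Measurable H := by refine Measurable.ennreal_ofReal ?_; fun_prop
  have hRm : Measurable R := by refine Measurable.ennreal_ofReal ?_; fun_prop
  have hRH : ∀ x, R x ^ 2 = H x := fun x => by
    rw [hR, hH]
    simp only
    rw [← ENNReal.ofReal_pow (by positivity), ← Real.rpow_natCast, ← Real.rpow_mul (by positivity)]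
    norm_num
  set G : ℝ → ℝ≥0∞ := fun σ => weight b' σ * F σ with hG
  have hGm : Measurable G := (measurable_weight b').mul hF
  set c := ENNReal.ofReal (δ ^ (b' - b)) with hc
  -- Peetre's factor uses up half a power of the decay, from `-2` to `-3/2`. The remaining kernel is
  -- split into two square roots `R`, one kept with the profile `P σ` and the other with `G σ`,
  -- ready for Cauchy–Schwarz.
  have step1 : ∀ τ, weight b τ * ∫⁻ σ, ENNReal.ofReal (δ * (1 + δ * |τ - σ|) ^ (-2 : ℝ)) * F σ ≤
      c * (P τ * ∫⁻ σ, (P σ * R (τ - σ)) * (R (τ - σ) * G σ)) := fun τ => by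
    rw [← lintegral_const_mul' _ _ (weight_ne_top b τ), ← lintegral_const_mul' _ _
      (ENNReal.ofReal_ne_top), ← lintegral_const_mul' _ _ (ENNReal.ofReal_ne_top)]
    refine lintegral_mono fun σ => ?_
    have hr : bracket τ ^ b * (δ * (1 + δ * |τ - σ|) ^ (-2 : ℝ)) ≤
        δ ^ (b' - b) * (profile θ δ (δ * |τ|) * (profile θ δ (δ * |σ|) *
          (δ * (1 + δ * |τ - σ|) ^ (-(3 / 2) : ℝ)))) * bracket σ ^ b' := by
      have h := bracket_rpow_le (τ := τ) (σ := σ) hδ hδ1 hb hb' hbb hθ'.le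
      calc _ ≤ _ := mul_le_mul_of_nonneg_right h (by positivity)
        _ = _ := by
          rw [show (-(3 / 2) : ℝ) = 1 / 2 + (-2) by norm_num, Real.rpow_add (by positivity)]
          ring
    have h0 : ∀ x, 0 ≤ x → 0 ≤ profile θ δ x := fun x hx => by unfold profile; positivity
    have h1 := h0 (δ * |τ|) (by positivity)
    have h2 := h0 (δ * |σ|) (by positivity)
    have h3 := ENNReal.ofReal_le_ofReal hr
    rw [ENNReal.ofReal_mul (Real.rpow_nonneg (bracket_pos _).le _),
      ENNReal.ofReal_mul (mul_nonneg (by positivity) (mul_nonneg h1 (mul_nonneg h2 (by positivity)))),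
      ENNReal.ofReal_mul (Real.rpow_nonneg hδ.le _), ENNReal.ofReal_mul h1, ENNReal.ofReal_mul h2] at h3
    calc _ = _ := (mul_assoc _ _ _).symm
      _ ≤ _ := mul_le_mul_left h3 (F σ)
      _ = c * (P τ * (P σ * H (τ - σ))) * weight b' σ * F σ := rfl
      _ = _ := by rw [← hRH]; ring
  have hsub : ∀ τ : ℝ, Measurable fun σ : ℝ => R (τ - σ) := fun τ => hRm.comp (by fun_prop)
  have hprod : Measurable fun p : ℝ × ℝ => P p.1 ^ 2 * (H (p.1 - p.2) * G p.2 ^ 2) := by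
    exact ((hPm.comp measurable_fst).pow_const 2).mul
      ((hHm.comp (measurable_fst.sub measurable_snd)).mul ((hGm.comp measurable_snd).pow_const 2))
  calc ∫⁻ τ, (weight b τ * ∫⁻ σ, ENNReal.ofReal (δ * (1 + δ * |τ - σ|) ^ (-2 : ℝ)) * F σ) ^ 2
      ≤ ∫⁻ τ, c ^ 2 * C * ∫⁻ σ, P τ ^ 2 * (H (τ - σ) * G σ ^ 2) := by
        refine lintegral_mono fun τ => ?_
        calc _ ≤ (c * (P τ * ∫⁻ σ, (P σ * R (τ - σ)) * (R (τ - σ) * G σ))) ^ 2 := by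
              exact pow_le_pow_left₀ zero_le (step1 τ) 2
          _ = c ^ 2 * (P τ ^ 2 * (∫⁻ σ, (P σ * R (τ - σ)) * (R (τ - σ) * G σ)) ^ 2) := by ring
          _ ≤ c ^ 2 * (P τ ^ 2 * ((∫⁻ σ, (P σ * R (τ - σ)) ^ 2) *
                ∫⁻ σ, (R (τ - σ) * G σ) ^ 2)) := by
              gcongr
              exact lintegral_mul_sq_le (hPm.mul (hsub τ)).aemeasurable
                ((hsub τ).mul hGm).aemeasurable
          _ ≤ c ^ 2 * (P τ ^ 2 * (C * ∫⁻ σ, (R (τ - σ) * G σ) ^ 2)) := by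
              gcongr
              simp_rw [mul_pow, hRH]
              exact hCb δ hδ τ
          _ = _ := by
              simp_rw [mul_pow, hRH]
              rw [lintegral_const_mul' _ _ (ENNReal.pow_ne_top ENNReal.ofReal_ne_top)]
              ring
    _ = c ^ 2 * C * ∫⁻ σ, ∫⁻ τ, P τ ^ 2 * (H (τ - σ) * G σ ^ 2) := by
        rw [lintegral_const_mul' _ _ (by finiteness),
          lintegral_lintegral_swap hprod.aemeasurable]
    -- The same profile bound, now in `τ` at fixed `σ`, as in Schur's test; the kernel is symmetric.
    _ ≤ c ^ 2 * C * ∫⁻ σ, C * G σ ^ 2 := by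
        gcongr with σ
        simp_rw [← mul_assoc]
        rw [lintegral_mul_const]
        · refine mul_le_mul_left ?_ _
          refine le_trans (le_of_eq ?_) (hCb δ hδ σ)
          refine lintegral_congr fun τ => ?_
          simp only [hH, hP, abs_sub_comm τ σ]
        · exact (hPm.pow_const 2).mul (hHm.comp (by fun_prop))
    _ = _ := by
        rw [lintegral_const_mul' _ _ hC]
        ring

/-! ### The Fourier transform in time and smooth cutoffs -/

section

open scoped FourierTransform

/-- The multiplication by `2π` on the line. -/
def twoPiEquiv : ℝ ≃L[ℝ] ℝ :=
  ContinuousLinearEquiv.unitsEquivAut ℝ (Units.mk0 (2 * π) Real.two_pi_pos.ne')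

theorem twoPiEquiv_apply (x : ℝ) : twoPiEquiv x = 2 * π * x := by
  simp [twoPiEquiv, mul_comm]

theorem twoPiEquiv_symm_apply (x : ℝ) : twoPiEquiv.symm x = x / (2 * π) := by
  rw [ContinuousLinearEquiv.symm_apply_eq, twoPiEquiv_apply]
  have := Real.pi_pos.ne'
  field_simp

/-- The integral `∫ e^{iτt} φ(t) dt`. -/
def chk (φ : ℝ → ℂ) (τ : ℝ) : ℂ := ∫ t : ℝ, Complex.exp (Complex.I * τ * t) * φ t

theorem chk_eq_fourierInv (φ : ℝ → ℂ) (τ : ℝ) : chk φ τ = 𝓕⁻ φ (τ / (2 * π)) := by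
  rw [chk, Real.fourierInv_eq']
  refine integral_congr_ae (Filter.Eventually.of_forall fun t => ?_)
  simp only [smul_eq_mul, RCLike.inner_apply, conj_trivial]
  have := Complex.ofReal_ne_zero.2 Real.pi_pos.ne'
  congr 2
  push_cast
  field_simp

/-- `chk` as a continuous operator on Schwartz functions. -/
def chkCLM : 𝓢(ℝ, ℂ) →L[ℂ] 𝓢(ℝ, ℂ) :=
  (SchwartzMap.compCLMOfContinuousLinearEquiv ℂ twoPiEquiv.symm).comp
    (FourierTransform.fourierInvCLM ℂ 𝓢(ℝ, ℂ))

theorem chkCLM_apply (φ : 𝓢(ℝ, ℂ)) (τ : ℝ) : chkCLM φ τ = chk φ τ := by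
  rw [chk_eq_fourierInv, chkCLM]
  simp [twoPiEquiv_symm_apply, SchwartzMap.fourierInv_coe]

/-- Supplies the convolution kernel in frequency that corresponds to multiplication by a given
cutoff. -/
theorem exists_chk_eq (η : 𝓢(ℝ, ℂ)) : ∃ κ : 𝓢(ℝ, ℂ), ∀ t, chk κ t = η t := by
  refine ⟨𝓕 (SchwartzMap.compCLMOfContinuousLinearEquiv ℂ twoPiEquiv η), fun t => ?_⟩
  rw [chk_eq_fourierInv, ← SchwartzMap.fourierInv_coe, FourierTransform.fourierInv_fourier_eq]
  have := Real.pi_pos.ne'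
  simp only [SchwartzMap.compCLMOfContinuousLinearEquiv_apply, Function.comp, twoPiEquiv_apply]
  congr 1
  field_simp

theorem norm_exp_I_mul (τ t : ℝ) : ‖Complex.exp (Complex.I * τ * t)‖ = 1 := by
  rw [show Complex.I * τ * t = ((τ * t : ℝ) : ℂ) * Complex.I by push_cast; ring]
  exact Complex.norm_exp_ofReal_mul_I _

theorem exists_decay (κ : 𝓢(ℝ, ℂ)) : ∃ A : ℝ, 0 ≤ A ∧ ∀ x, ‖κ x‖ ≤ A * (1 + |x|) ^ (-2 : ℝ) := by
  refine ⟨2 ^ 2 * ((Finset.Iic ((2, 0) : ℕ × ℕ)).sup fun m => SchwartzMap.seminorm ℝ m.1 m.2) κ,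
    by positivity, fun x => ?_⟩
  have h := SchwartzMap.one_add_le_sup_seminorm_apply (𝕜 := ℝ) (m := (2, 0)) (k := 2) (n := 0)
    le_rfl le_rfl κ x
  rw [norm_iteratedFDeriv_zero, Real.norm_eq_abs] at h
  rw [Real.rpow_neg (by positivity), ← div_eq_mul_inv, le_div_iff₀ (by positivity), mul_comm]
  exact_mod_cast h

/-- Multiplication by `φ ↦ η φ` on Schwartz functions. -/
def mulCLM (η : 𝓢(ℝ, ℂ)) : 𝓢(ℝ, ℂ) →L[ℂ] 𝓢(ℝ, ℂ) := SchwartzMap.smulLeftCLM ℂ η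

theorem mulCLM_apply (η φ : 𝓢(ℝ, ℂ)) (t : ℝ) : mulCLM η φ t = η t * φ t := by
  rw [mulCLM, SchwartzMap.smulLeftCLM_apply_apply η.hasTemperateGrowth, smul_eq_mul]

/-- Every bounded or square-integrable function is the Fourier transform of a distribution. -/
theorem exists_distribution {G : ℝ → ℂ} {p : ℝ≥0∞} [Fact (1 ≤ p)] (hG : MemLp G p) :
    ∃ T : 𝓢'(ℝ, ℂ), ∀ φ : 𝓢(ℝ, ℂ), T φ = ∫ τ, G τ * chk φ τ := by
  refine ⟨PointwiseConvergenceCLM.precomp ℂ chkCLM (Lp.toTemperedDistribution hG.toLp),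
    fun φ => ?_⟩
  change Lp.toTemperedDistribution hG.toLp (chkCLM φ) = _
  rw [Lp.toTemperedDistribution_apply]
  refine integral_congr_ae ?_
  filter_upwards [hG.coeFn_toLp] with τ hτ
  rw [hτ, chkCLM_apply, smul_eq_mul, mul_comm]

/-- A Schwartz function equal to `1` on `[0, 1]`. -/
theorem exists_cutoff : ∃ η : 𝓢(ℝ, ℂ), ∀ t ∈ Icc (0 : ℝ) 1, η t = 1 := by
  let f : ContDiffBump (0 : ℝ) := ⟨1, 2, one_pos, one_lt_two⟩
  have h1 : HasCompactSupport (Complex.ofRealCLM ∘ f) := f.hasCompactSupport.comp_left rfl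
  have h2 : ContDiff ℝ ((⊤ : ℕ∞) : WithTop ℕ∞) (Complex.ofRealCLM ∘ f) := Complex.ofRealCLM.contDiff.comp f.contDiff
  refine ⟨h1.toSchwartzMap h2, fun t ht => ?_⟩
  have : f t = 1 := f.one_of_mem_closedBall (by
    rw [Metric.mem_closedBall, Real.dist_eq, sub_zero, abs_of_nonneg ht.1]; exact ht.2)
  simp [this]

/-- Multiplication by `e^{iσt}η(δ⁻¹t)` in physical space is convolution in frequency. -/
theorem integral_kernel_mul_chk {κ φ : 𝓢(ℝ, ℂ)} {η : ℝ → ℂ} (hκ : ∀ t, chk κ t = η t) {δ : ℝ}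
    (hδ : 0 < δ) (σ : ℝ) :
    ∫ τ, ((δ : ℂ) * κ (δ * (τ - σ))) * chk φ τ = chk (fun t => η (t / δ) * φ t) σ := by
  have hκi : Integrable fun τ => (δ : ℂ) * κ (δ * (τ - σ)) := by
    refine Integrable.const_mul ?_ _
    exact (κ.integrable.comp_mul_left' hδ.ne').comp_sub_right σ
  -- A shift by `σ` produces the factor `e^{iσt}`, and rescaling by `δ` evaluates `chk κ` at `t /
  -- δ`.
  have inner : ∀ t : ℝ, ∫ τ : ℝ, ((δ : ℂ) * κ (δ * (τ - σ))) * Complex.exp (Complex.I * τ * t) =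
      Complex.exp (Complex.I * σ * t) * η (t / δ) := fun t => by
    rw [← hκ, chk]
    have e1 : ∫ τ : ℝ, ((δ : ℂ) * κ (δ * (τ - σ))) * Complex.exp (Complex.I * τ * t) =
        ∫ τ : ℝ, ((δ : ℂ) * κ (δ * τ)) * Complex.exp (Complex.I * (τ + σ : ℝ) * t) := by
      rw [← integral_sub_right_eq_self (fun τ : ℝ => ((δ : ℂ) * κ (δ * τ)) *
        Complex.exp (Complex.I * (τ + σ : ℝ) * t)) σ]
      simp
    have e2 := MeasureTheory.Measure.integral_comp_mul_left
      (fun x : ℝ => Complex.exp (Complex.I * (t / δ : ℝ) * x) * κ x) δ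
    rw [e1, ← integral_const_mul]
    have hδ' : (δ : ℂ) ≠ 0 := Complex.ofReal_ne_zero.2 hδ.ne'
    have e3 : ∀ τ : ℝ, ((δ : ℂ) * κ (δ * τ)) * Complex.exp (Complex.I * (τ + σ : ℝ) * t) =
        Complex.exp (Complex.I * σ * t) * δ * (Complex.exp (Complex.I * (t / δ : ℝ) * (δ * τ : ℝ)) *
          κ (δ * τ)) := fun τ => by
      have : Complex.I * (τ + σ : ℝ) * t = Complex.I * σ * t +
          Complex.I * (t / δ : ℝ) * (δ * τ : ℝ) := by
        push_cast; field_simp; ring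
      rw [this, Complex.exp_add]; ring
    simp_rw [e3]
    rw [integral_const_mul, e2, integral_const_mul, abs_of_pos (inv_pos.2 hδ), Complex.real_smul]
    push_cast
    field_simp
  calc ∫ τ, ((δ : ℂ) * κ (δ * (τ - σ))) * chk φ τ
      = ∫ τ : ℝ, ∫ t : ℝ, ((δ : ℂ) * κ (δ * (τ - σ))) * (Complex.exp (Complex.I * τ * t) * φ t) := by
        simp_rw [chk, integral_const_mul]
    _ = ∫ t : ℝ, ∫ τ : ℝ, ((δ : ℂ) * κ (δ * (τ - σ))) * (Complex.exp (Complex.I * τ * t) * φ t) := by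
        refine integral_integral_swap ?_
        have h := hκi.mul_prod (φ.integrable (μ := volume))
        have hc : Continuous fun p : ℝ × ℝ => Complex.exp (Complex.I * p.1 * p.2) := by fun_prop
        refine (h.bdd_mul (c := 1) hc.aestronglyMeasurable
          (Filter.Eventually.of_forall fun p => (norm_exp_I_mul p.1 p.2).le)).congr ?_
        refine Filter.Eventually.of_forall fun p => ?_
        simp only [Function.uncurry]
        ring
    _ = _ := by
        rw [chk]
        refine integral_congr_ae (Filter.Eventually.of_forall fun t => ?_)
        simp only
        simp_rw [← mul_assoc]
        rw [integral_mul_const, inner]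

end

/-! ### Localisation in time as convolution in frequency -/

theorem isFourier_iff {u : PDist} {U : ℤ → ℝ → ℂ} : IsFourier u U ↔ ∀ k : ℤ,
    AEStronglyMeasurable (U k) volume ∧ ∀ φ : 𝓢(ℝ, ℂ),
      Integrable (fun τ : ℝ => U k τ * chk φ τ) ∧ u k φ = ∫ τ : ℝ, U k τ * chk φ τ := Iff.rfl

theorem IsFourier.congr {u : PDist} {U V : ℤ → ℝ → ℂ} (h : IsFourier u U)
    (hUV : ∀ k, U k =ᵐ[volume] V k) : IsFourier u V := by
  rw [isFourier_iff] at h ⊢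
  intro k
  refine ⟨(h k).1.congr (hUV k), fun φ => ?_⟩
  have e : (fun τ : ℝ => U k τ * chk φ τ) =ᵐ[volume] fun τ => V k τ * chk φ τ := by
    filter_upwards [hUV k] with τ hτ
    rw [hτ]
  exact ⟨((h k).2 φ).1.congr e, ((h k).2 φ).2.trans (integral_congr_ae e)⟩

theorem wL2_congr {α β s b : ℝ} {U V : ℤ → ℝ → ℂ} (hUV : ∀ k, U k =ᵐ[volume] V k) :
    wL2 α β s b U = wL2 α β s b V := by
  unfold wL2
  congr 1
  refine tsum_congr fun k => lintegral_congr_ae ?_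
  filter_upwards [hUV k] with τ hτ
  rw [hτ]

theorem IsFourier.exists_measurable {u : PDist} {U : ℤ → ℝ → ℂ} (h : IsFourier u U) :
    ∃ V : ℤ → ℝ → ℂ, (∀ k, StronglyMeasurable (V k)) ∧ IsFourier u V ∧
      ∀ α β s b, wL2 α β s b V = wL2 α β s b U :=
  ⟨fun k => (h k).1.mk, fun k => (h k).1.stronglyMeasurable_mk, h.congr fun k => (h k).1.ae_eq_mk,
    fun _ _ _ _ => (wL2_congr fun k => (h k).1.ae_eq_mk).symm⟩

theorem mode_lt_top {α β s b : ℝ} {U : ℤ → ℝ → ℂ} (h : wL2 α β s b U < ⊤) (k : ℤ) :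
    ∫⁻ τ, (weight b (modul α β k τ) * ‖U k τ‖ₑ) ^ 2 < ⊤ := by
  have h1 : wL2 α β s b U ^ 2 < ⊤ := ENNReal.pow_lt_top h
  rw [wL2_sq] at h1
  have h2 := (ENNReal.le_tsum k).trans_lt h1
  exact (ENNReal.mul_lt_top_iff.1 h2).elim (fun h => h.2) fun h => h.elim
    (fun h => absurd h (pow_ne_zero 2 (weight_ne_zero _ _))) fun h => by simp [h]

theorem enorm_le_weight (g : 𝓢(ℝ, ℂ)) : ∃ A : ℝ≥0∞, A ≠ ⊤ ∧ ∀ τ, ‖g τ‖ₑ ≤ A * weight (-2) τ := by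
  obtain ⟨A, hA, h⟩ := exists_decay g
  refine ⟨ENNReal.ofReal A, ENNReal.ofReal_ne_top, fun τ => ?_⟩
  rw [weight, ← ENNReal.ofReal_mul hA, ← ofReal_norm]
  exact ENNReal.ofReal_le_ofReal (h τ)

theorem lintegral_weight_schwartz_lt_top (g : 𝓢(ℝ, ℂ)) {b : ℝ} (hb : b ≤ 1) (ω : ℝ) :
    ∫⁻ τ, (weight b (τ - ω) * ‖g τ‖ₑ) ^ 2 < ⊤ := by
  obtain ⟨A, hA, h⟩ := enorm_le_weight g
  have hpt : ∀ τ, (weight b (τ - ω) * ‖g τ‖ₑ) ^ 2 ≤ (weight 1 ω * A) ^ 2 * weight (-2) τ :=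
    fun τ => by
    have h1 : weight b (τ - ω) ≤ weight 1 τ * weight 1 ω := by
      refine (weight_mono hb _).trans ?_
      have := weight_add_le zero_le_one τ (-ω)
      rwa [weight_neg, ← sub_eq_add_neg] at this
    calc (weight b (τ - ω) * ‖g τ‖ₑ) ^ 2
        ≤ ((weight 1 τ * weight 1 ω) * (A * weight (-2) τ)) ^ 2 := by
          gcongr; exact h τ
      _ = (weight 1 ω * A) ^ 2 * (weight 1 τ * weight (-2) τ) ^ 2 := by ring
      _ = _ := by rw [weight_mul, weight_sq]; norm_num
  refine (lintegral_mono hpt).trans_lt ?_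
  rw [lintegral_const_mul _ (measurable_weight _)]
  exact ENNReal.mul_lt_top (by have := weight_ne_top 1 ω; finiteness)
    (lintegral_weight_lt_top (by norm_num))

theorem exists_dilate (η : 𝓢(ℝ, ℂ)) {c : ℝ} (hc : c ≠ 0) : ∃ ζ : 𝓢(ℝ, ℂ), ∀ t, ζ t = η (t / c) :=
  ⟨SchwartzMap.compCLMOfContinuousLinearEquiv ℂ
    (ContinuousLinearEquiv.unitsEquivAut ℝ (Units.mk0 c⁻¹ (inv_ne_zero hc))) η, fun t => by
    simp [div_eq_mul_inv]⟩

/-- Time localisation on the scale `δ` of a distribution with Fourier transform `U`. -/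
def localized (κ : 𝓢(ℝ, ℂ)) (δ : ℝ) (U : ℤ → ℝ → ℂ) (k : ℤ) (τ : ℝ) : ℂ :=
  ∫ σ, ((δ : ℂ) * κ (δ * (τ - σ))) * U k σ

theorem enorm_kernel_le {κ : 𝓢(ℝ, ℂ)} {A : ℝ} (hA : 0 ≤ A)
    (hκ : ∀ x, ‖κ x‖ ≤ A * (1 + |x|) ^ (-2 : ℝ)) {δ : ℝ} (hδ : 0 < δ) (x : ℝ) :
    ‖(δ : ℂ) * κ (δ * x)‖ₑ ≤ ENNReal.ofReal A * ENNReal.ofReal (δ * (1 + δ * |x|) ^ (-2 : ℝ)) := by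
  rw [← ENNReal.ofReal_mul hA, ← ofReal_norm]
  refine ENNReal.ofReal_le_ofReal ?_
  rw [norm_mul, Complex.norm_real, Real.norm_of_nonneg hδ.le]
  have := hκ (δ * x)
  rw [abs_mul, abs_of_pos hδ] at this
  nlinarith

/-- Translating both variables by `ω` turns the modulation into `τ` and leaves a kernel in `τ - σ`
unchanged, so one estimate on the line serves all `k`, `α` and `β`. The absolute value stands inside
the integral so that the bound can also justify Fubini's theorem. -/
theorem exists_localized_bound (κ : 𝓢(ℝ, ℂ)) {θ : ℝ} (hθ : 0 ≤ θ) (hθ' : θ < 1 / 2) :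
    ∃ C : ℝ, 0 < C ∧ ∀ b b' δ : ℝ, |b| ≤ θ → |b'| ≤ θ → b ≤ b' → 0 < δ → δ ≤ 1 →
      ∀ (α β : ℝ) (U : ℤ → ℝ → ℂ) (k : ℤ), StronglyMeasurable (U k) →
      ∫⁻ τ, (weight b (modul α β k τ) *
          ∫⁻ σ, ‖((δ : ℂ) * κ (δ * (τ - σ))) * U k σ‖ₑ) ^ 2 ≤
        ENNReal.ofReal (C * δ ^ (b' - b)) ^ 2 *
          ∫⁻ τ, (weight b' (modul α β k τ) * ‖U k τ‖ₑ) ^ 2 := by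
  obtain ⟨A, hA, hκ⟩ := exists_decay κ
  obtain ⟨C, hC, hCb⟩ := lintegral_convolution_sq_le hθ hθ'
  -- The summand `1` only makes the constant positive.
  refine ⟨A * C.toReal + 1, by positivity, fun b b' δ hb hb' hbb hδ hδ1 α β U k hU => ?_⟩
  set ω := β * (k : ℝ) ^ 3 - α * (k : ℝ) ^ 5 with hω
  have hmod : ∀ τ, modul α β k (τ + ω) = τ := fun τ => by rw [modul_eq_sub, hω, add_sub_cancel_right]
  have h := hCb b b' δ hb hb' hbb hδ hδ1 (fun σ => ‖U k (σ + ω)‖ₑ)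
    (hU.measurable.enorm.comp (measurable_add_const ω))
  have hker : ∀ τ, ∫⁻ σ, ‖((δ : ℂ) * κ (δ * (τ + ω - σ))) * U k σ‖ₑ ≤ ENNReal.ofReal A *
      ∫⁻ σ, ENNReal.ofReal (δ * (1 + δ * |τ - σ|) ^ (-2 : ℝ)) * ‖U k (σ + ω)‖ₑ := fun τ => by
    rw [← lintegral_add_right_eq_self _ ω, ← lintegral_const_mul' _ _ ENNReal.ofReal_ne_top]
    refine lintegral_mono fun σ => ?_
    rw [enorm_mul, ← mul_assoc, show τ + ω - (σ + ω) = τ - σ by ring]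
    exact mul_le_mul_left (enorm_kernel_le hA hκ hδ _) _
  calc _ = ∫⁻ τ, (weight b τ * ∫⁻ σ, ‖((δ : ℂ) * κ (δ * (τ + ω - σ))) * U k σ‖ₑ) ^ 2 := by
        rw [← lintegral_add_right_eq_self _ ω]
        simp_rw [hmod]
    _ ≤ ∫⁻ τ, ENNReal.ofReal A ^ 2 * (weight b τ *
          ∫⁻ σ, ENNReal.ofReal (δ * (1 + δ * |τ - σ|) ^ (-2 : ℝ)) * ‖U k (σ + ω)‖ₑ) ^ 2 := by
        refine lintegral_mono fun τ => ?_
        rw [← mul_pow, mul_left_comm]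
        exact pow_le_pow_left₀ zero_le (mul_le_mul_right (hker τ) _) 2
    _ ≤ ENNReal.ofReal A ^ 2 * ((C * ENNReal.ofReal (δ ^ (b' - b))) ^ 2 *
          ∫⁻ σ, (weight b' σ * ‖U k (σ + ω)‖ₑ) ^ 2) := by
        rw [lintegral_const_mul' _ _ (ENNReal.pow_ne_top ENNReal.ofReal_ne_top)]
        exact mul_le_mul_right h _
    _ ≤ _ := by
        rw [← mul_assoc, ← mul_pow]
        refine mul_le_mul' (pow_le_pow_left₀ zero_le ?_ 2) (le_of_eq ?_)
        · rw [← mul_assoc, ENNReal.ofReal_mul (by positivity)]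
          refine mul_le_mul_left ?_ _
          rw [← ENNReal.ofReal_toReal hC, ← ENNReal.ofReal_mul hA,
            ENNReal.toReal_ofReal ENNReal.toReal_nonneg]
          exact ENNReal.ofReal_le_ofReal (by linarith)
        · rw [← lintegral_add_right_eq_self (fun τ => (weight b' (modul α β k τ) * ‖U k τ‖ₑ) ^ 2) ω]
          simp_rw [hmod]

theorem measurable_uncurry_kernel (κ : 𝓢(ℝ, ℂ)) (δ : ℝ) {V : ℝ → ℂ} (hV : StronglyMeasurable V) :
    StronglyMeasurable fun p : ℝ × ℝ => ((δ : ℂ) * κ (δ * (p.1 - p.2))) * V p.2 := by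
  have : Continuous fun p : ℝ × ℝ => (δ : ℂ) * κ (δ * (p.1 - p.2)) :=
    continuous_const.mul (κ.continuous.comp (by fun_prop))
  exact this.stronglyMeasurable.mul (hV.comp_measurable measurable_snd)

/-- The Fourier transform of `η(t/δ) u` is the convolution `localized κ δ U`. -/
theorem IsFourier.localized {κ η : 𝓢(ℝ, ℂ)} (hκ : ∀ t, chk κ t = η t) {θ : ℝ} (hθ : 0 ≤ θ)
    (hθ' : θ < 1 / 2) {b δ : ℝ} (hb : |b| ≤ θ) (hδ : 0 < δ) (hδ1 : δ ≤ 1) {α β s : ℝ} {u : PDist}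
    {U : ℤ → ℝ → ℂ} (hU : ∀ k, StronglyMeasurable (U k)) (hu : IsFourier u U)
    (hfin : wL2 α β s b U < ⊤) {ζ : 𝓢(ℝ, ℂ)} (hζ : ∀ t, ζ t = η (t / δ)) :
    IsFourier (fun k => PointwiseConvergenceCLM.precomp ℂ (mulCLM ζ) (u k))
      (Kawahara.localized κ δ U) := by
  rw [isFourier_iff] at hu ⊢
  intro k
  have hm := measurable_uncurry_kernel κ δ (hU k)
  have hmeas : StronglyMeasurable (Kawahara.localized κ δ U k) := hm.integral_prod_right'
  refine ⟨hmeas.aestronglyMeasurable, fun φ => ?_⟩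
  obtain ⟨C, -, hC⟩ := exists_localized_bound κ hθ hθ'
  set I : ℝ → ℝ≥0∞ := fun τ => ∫⁻ σ, ‖((δ : ℂ) * κ (δ * (τ - σ))) * U k σ‖ₑ with hI
  have hIm : Measurable I := hm.measurable.enorm.lintegral_prod_right'
  have hIfin : ∫⁻ τ, (weight b (modul α β k τ) * I τ) ^ 2 < ⊤ := by
    refine (hC b b δ hb hb le_rfl hδ hδ1 α β U k (hU k)).trans_lt ?_
    exact ENNReal.mul_lt_top (by finiteness) (mode_lt_top hfin k)
  have hφ : Continuous (chk φ) := by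
    have := (chkCLM φ).continuous
    rwa [show (chkCLM φ : ℝ → ℂ) = chk φ from funext (chkCLM_apply φ)] at this
  have hφfin : ∫⁻ τ, (weight (-b) (modul α β k τ) * ‖chk φ τ‖ₑ) ^ 2 < ⊤ := by
    have := lintegral_weight_schwartz_lt_top (chkCLM φ) (b := -b)
      (by have := neg_le_abs b; linarith) (β * (k : ℝ) ^ 3 - α * (k : ℝ) ^ 5)
    simpa only [chkCLM_apply, modul_eq_sub] using this
  have hw : ∀ c, Measurable fun τ => weight c (modul α β k τ) := fun c =>
    (measurable_weight c).comp (continuous_modul α β k).measurable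
  -- `I` lies in `L²` with weight exponent `b` and `chk φ` in `L²` with the dual exponent `-b`;
  -- their product is therefore integrable, which is what Fubini's theorem needs.
  have hprod : ∫⁻ τ, I τ * ‖chk φ τ‖ₑ < ⊤ := by
    have h1 := lintegral_mul_sq_le (μ := volume) ((hw b).mul hIm).aemeasurable
      ((hw (-b)).mul hφ.measurable.enorm).aemeasurable
    have h2 := h1.trans_lt (ENNReal.mul_lt_top hIfin hφfin)
    have h3 : ∀ τ, weight b (modul α β k τ) * I τ * (weight (-b) (modul α β k τ) * ‖chk φ τ‖ₑ) =
        I τ * ‖chk φ τ‖ₑ := fun τ => by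
      rw [mul_mul_mul_comm, weight_mul, add_neg_cancel, weight_zero, one_mul]
    simp_rw [Pi.mul_apply, h3] at h2
    exact (ENNReal.pow_lt_top_iff.1 h2).resolve_right two_ne_zero
  have hint : Integrable (fun p : ℝ × ℝ => ((δ : ℂ) * κ (δ * (p.1 - p.2))) * U k p.2 * chk φ p.1)
      (volume.prod volume) := by
    refine ⟨(hm.mul (hφ.stronglyMeasurable.comp_measurable measurable_fst)).aestronglyMeasurable, ?_⟩
    rw [hasFiniteIntegral_iff_enorm, lintegral_prod _ (by
      exact (hm.mul (hφ.stronglyMeasurable.comp_measurable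
        measurable_fst)).measurable.enorm.aemeasurable)]
    refine lt_of_le_of_lt (le_of_eq ?_) hprod
    refine lintegral_congr fun τ => ?_
    simp_rw [enorm_mul (_ * _) (chk φ τ)]
    rw [lintegral_mul_const']
    exact enorm_ne_top
  have e : ∀ τ, Kawahara.localized κ δ U k τ * chk φ τ =
      ∫ σ, ((δ : ℂ) * κ (δ * (τ - σ))) * U k σ * chk φ τ := fun τ => by
    rw [Kawahara.localized, integral_mul_const]
  refine ⟨?_, ?_⟩
  · simp_rw [e]; exact hint.integral_prod_left
  · change u k (mulCLM ζ φ) = _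
    simp_rw [e]
    rw [integral_integral_swap hint, ((hu k).2 (mulCLM ζ φ)).2]
    refine integral_congr_ae (Filter.Eventually.of_forall fun σ => ?_)
    have hζφ : (mulCLM ζ φ : ℝ → ℂ) = fun t => η (t / δ) * φ t :=
      funext fun t => by rw [mulCLM_apply, hζ]
    simp only
    rw [hζφ, ← integral_kernel_mul_chk hκ hδ σ, ← integral_const_mul]
    refine integral_congr_ae (Filter.Eventually.of_forall fun τ => ?_)
    simp only
    ring

/-! ### Restricted norms, time localisation and the passage from `Y` to `Z` -/

theorem viaFourier_le {N : (ℤ → ℝ → ℂ) → ℝ≥0∞} {u : PDist} {U : ℤ → ℝ → ℂ} (h : IsFourier u U) :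
    viaFourier N u ≤ N U := iInf₂_le U h

theorem restr_le {δ : ℝ} {N : PDist → ℝ≥0∞} {u v : PDist} (h : EqOnTime δ v u) :
    restr δ N u ≤ N v := iInf₂_le v h

theorem normXδ_le {α β s b δ : ℝ} {u v : PDist} {V : ℤ → ℝ → ℂ} (h : EqOnTime δ v u)
    (hV : IsFourier v V) : normXδ α β s b δ u ≤ wL2 α β s b V :=
  (restr_le h).trans (viaFourier_le hV)

theorem exists_of_normXδ_lt {α β s b δ : ℝ} {u : PDist} {x : ℝ≥0∞}
    (h : normXδ α β s b δ u < x) : ∃ (v : PDist) (V : ℤ → ℝ → ℂ), EqOnTime δ v u ∧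
      IsFourier v V ∧ (∀ k, StronglyMeasurable (V k)) ∧ wL2 α β s b V < x := by
  unfold normXδ restr normX viaFourier at h
  simp only [iInf_lt_iff] at h
  obtain ⟨v, hv, V, hV, hlt⟩ := h
  obtain ⟨V', hm, hF, he⟩ := hV.exists_measurable
  exact ⟨v, V', hv, hF, hm, (he _ _ _ _).trans_lt hlt⟩

theorem exists_time_localisation {b b' : ℝ} (hb : -1 / 2 < b) (hbb : b ≤ b') (hb' : b' < 1 / 2) :
    ∃ C : ℝ, 0 < C ∧ ∀ α β s δ : ℝ, 0 < δ → δ ≤ 1 → ∀ u : PDist,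
      normXδ α β s b δ u ≤ ENNReal.ofReal (C * δ ^ (b' - b)) * normXδ α β s b' δ u := by
  obtain ⟨η, hη⟩ := exists_cutoff
  obtain ⟨κ, hκ⟩ := exists_chk_eq η
  set θ := max |b| |b'| with hθdef
  have hθ : 0 ≤ θ := (abs_nonneg b).trans (le_max_left _ _)
  have hθ' : θ < 1 / 2 := max_lt (abs_lt.2 ⟨by linarith, by linarith⟩)
    (abs_lt.2 ⟨by linarith, by linarith⟩)
  obtain ⟨C, hC0, hC⟩ := exists_localized_bound κ hθ hθ'
  refine ⟨C, hC0, fun α β s δ hδ hδ1 u => ?_⟩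
  have hc0 : ENNReal.ofReal (C * δ ^ (b' - b)) ≠ 0 := by
    rw [Ne, ENNReal.ofReal_eq_zero, not_le]; positivity
  rcases eq_or_ne (normXδ α β s b' δ u) ⊤ with htop | htop
  · rw [htop, ENNReal.mul_top hc0]; exact le_top
  -- With the constant moved to the left, it is enough to stay below every `x` above the infimum,
  -- and each such `x` is beaten by some extension.
  rw [mul_comm, ← ENNReal.div_le_iff_le_mul (Or.inl hc0) (Or.inl ENNReal.ofReal_ne_top)]
  refine le_of_forall_gt fun x hx => ?_
  obtain ⟨v, V, hvu, hV, hVm, hlt⟩ := exists_of_normXδ_lt hx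
  obtain ⟨ζ, hζ⟩ := exists_dilate η hδ.ne'
  have hF := hV.localized hκ hθ hθ' (le_max_right _ _) hδ hδ1 hVm (hlt.trans_le le_top) hζ
  have heq : EqOnTime δ (fun k => PointwiseConvergenceCLM.precomp ℂ (mulCLM ζ) (v k)) u := by
    intro k φ hφ
    rw [← hvu k φ hφ]
    change v k (mulCLM ζ φ) = v k φ
    congr 1
    ext t
    rw [mulCLM_apply, hζ]
    by_cases ht : t ∈ tsupport φ
    · have := hφ ht
      rw [hη _ ⟨by have := this.1; positivity, (div_le_one hδ).2 this.2.le⟩, one_mul]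
    · rw [image_eq_zero_of_notMem_tsupport ht, mul_zero]
  refine lt_of_le_of_lt ?_ hlt
  rw [ENNReal.div_le_iff_le_mul (Or.inl hc0) (Or.inl ENNReal.ofReal_ne_top), mul_comm]
  refine (normXδ_le heq hF).trans (le_of_sq_le_sq ?_)
  rw [mul_pow, wL2_sq, wL2_sq, ← ENNReal.tsum_mul_left]
  refine ENNReal.tsum_le_tsum fun k => ?_
  rw [mul_left_comm]
  refine mul_le_mul_right (le_trans (lintegral_mono fun τ => ?_)
    (hC b b' δ (le_max_left _ _) (le_max_right _ _) hbb hδ hδ1 α β V k (hVm k))) _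
  exact pow_le_pow_left₀ zero_le (mul_le_mul_right (enorm_integral_le_lintegral_enorm _) _) 2

theorem wL2_mono {α β s b b' : ℝ} (h : b ≤ b') (U : ℤ → ℝ → ℂ) :
    wL2 α β s b U ≤ wL2 α β s b' U := by
  refine le_of_sq_le_sq ?_
  rw [wL2_sq, wL2_sq]
  gcongr
  exact weight_mono h _

/-- Cauchy–Schwarz with `⟨·⟩^(-1) = ⟨·⟩^(-1-a) ⟨·⟩^a`: the first factor is square integrable because
`2(-1 - a) < -1`, and by translation its norm does not depend on `k`. -/
theorem exists_wL1_le {a : ℝ} (ha : -1 / 2 < a) : ∃ K : ℝ, 0 ≤ K ∧ ∀ (α β s : ℝ)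
    (U : ℤ → ℝ → ℂ), (∀ k, AEStronglyMeasurable (U k) volume) →
      wL1 α β s (-1) U ≤ ENNReal.ofReal K * wL2 α β s a U := by
  set J := ∫⁻ x, weight (2 * (-1 - a)) x with hJ
  have hJt : J ≠ ⊤ := (lintegral_weight_lt_top (by linarith)).ne
  refine ⟨√J.toReal, Real.sqrt_nonneg _, fun α β s U hU => le_of_sq_le_sq ?_⟩
  rw [mul_pow, ← ENNReal.ofReal_pow (Real.sqrt_nonneg _), Real.sq_sqrt ENNReal.toReal_nonneg,
    ENNReal.ofReal_toReal hJt, wL1_sq, wL2_sq, ← ENNReal.tsum_mul_left]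
  refine ENNReal.tsum_le_tsum fun k => ?_
  rw [mul_left_comm]
  refine mul_le_mul_right ?_ _
  have hw : ∀ c, Measurable fun τ => weight c (modul α β k τ) := fun c =>
    (measurable_weight c).comp (continuous_modul α β k).measurable
  have h := lintegral_mul_sq_le (μ := volume) (hw (-1 - a)).aemeasurable
    ((hw a).aemeasurable.mul (hU k).enorm)
  have e : ∀ τ, weight (-1) (modul α β k τ) * ‖U k τ‖ₑ =
      weight (-1 - a) (modul α β k τ) * (weight a (modul α β k τ) * ‖U k τ‖ₑ) := fun τ => by
    rw [← mul_assoc, weight_mul, sub_add_cancel]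
  simp_rw [e]
  refine h.trans (le_of_eq ?_)
  congr 1
  simp_rw [weight_sq, modul_eq_sub]
  exact lintegral_comp_sub_right _ _

/-- The `Z` norm of a distribution is controlled by a slightly stronger `X` norm. -/
theorem exists_normZδ_le {a : ℝ} (ha : -1 / 2 < a) : ∃ K : ℝ, 0 < K ∧ ∀ (α β s δ : ℝ) (u : PDist),
    normZδ α β s δ u ≤ ENNReal.ofReal K * normXδ α β s a δ u := by
  obtain ⟨K, hK, h⟩ := exists_wL1_le ha
  refine ⟨1 + K, by linarith, fun α β s δ u => ?_⟩
  have h0 : ENNReal.ofReal (1 + K) ≠ 0 := by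
    rw [Ne, ENNReal.ofReal_eq_zero, not_le]; linarith
  rw [mul_comm, ← ENNReal.div_le_iff_le_mul (Or.inl h0) (Or.inl ENNReal.ofReal_ne_top)]
  refine le_of_forall_gt fun x hx => ?_
  obtain ⟨v, V, hvu, hV, -, hlt⟩ := exists_of_normXδ_lt hx
  refine lt_of_le_of_lt ?_ hlt
  rw [ENNReal.div_le_iff_le_mul (Or.inl h0) (Or.inl ENNReal.ofReal_ne_top), mul_comm]
  refine (restr_le hvu).trans ((viaFourier_le hV).trans ?_)
  rw [ENNReal.ofReal_add zero_le_one hK, ENNReal.ofReal_one, add_mul, one_mul]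
  exact add_le_add (wL2_mono (by linarith) V) (h α β s V fun k => (hV k).1)

theorem normXδ_le_normYδ {a : ℝ} (ha : a ≤ 1 / 2) (α β s δ : ℝ) (u : PDist) :
    normXδ α β s a δ u ≤ normYδ α β s δ u := by
  refine iInf₂_mono fun v _ => iInf₂_mono fun V _ => ?_
  exact (wL2_mono ha V).trans le_self_add

theorem exists_normZδ_le_normYδ {ε : ℝ} (hε : 0 < ε) : ∃ C : ℝ, 0 < C ∧ ∀ α β s δ : ℝ,
    0 < δ → δ < 1 → ∀ u : PDist,
      normZδ α β s δ u ≤ ENNReal.ofReal (C * δ ^ (1 - ε)) * normYδ α β s δ u := by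
  -- The exponents `-1/2 + e` and `1/2 - e` differ by `1 - 2e ≥ 1 - ε`; the cap `1/2` keeps `e ≤
  -- 1/4`, so that they are in the right order.
  set e := min ε (1 / 2) / 2 with he
  have he0 : 0 < e := by have : 0 < min ε (1 / 2) := lt_min hε (by norm_num); linarith
  have he1 : e ≤ 1 / 4 := by have := min_le_right ε (1 / 2); linarith
  have he2 : 2 * e ≤ ε := by have := min_le_left ε (1 / 2); linarith
  obtain ⟨K, hK, hKb⟩ := exists_normZδ_le (a := -1 / 2 + e) (by linarith)
  obtain ⟨C, hC, hCb⟩ := exists_time_localisation (b := -1 / 2 + e) (b' := 1 / 2 - e)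
    (by linarith) (by linarith) (by linarith)
  refine ⟨K * C, by positivity, fun α β s δ hδ hδ1 u => ?_⟩
  calc normZδ α β s δ u ≤ ENNReal.ofReal K * (ENNReal.ofReal (C * δ ^ (1 / 2 - e - (-1 / 2 + e))) *
        normYδ α β s δ u) := by
        refine (hKb α β s δ u).trans (mul_le_mul_right ?_ _)
        exact (hCb α β s δ hδ hδ1.le u).trans
          (mul_le_mul_right (normXδ_le_normYδ (by linarith) α β s δ u) _)
    _ ≤ _ := by
        rw [← mul_assoc, ← ENNReal.ofReal_mul hK.le, ← mul_assoc]
        refine mul_le_mul_left (ENNReal.ofReal_le_ofReal ?_) _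
        refine mul_le_mul_of_nonneg_left ?_ (by positivity)
        exact Real.rpow_le_rpow_of_exponent_ge hδ hδ1.le (by linarith)

/-! ### Plancherel's theorem on the line -/

section

open scoped FourierTransform

theorem eLpNorm_two_sq {X E : Type*} [MeasurableSpace X] [NormedAddCommGroup E] (f : X → E)
    (μ : Measure X) : eLpNorm f 2 μ ^ 2 = ∫⁻ x, ‖f x‖ₑ ^ 2 ∂μ := by
  rw [eLpNorm_eq_lintegral_rpow_enorm_toReal two_ne_zero ENNReal.ofNat_ne_top, ← ENNReal.rpow_two,
    ← ENNReal.rpow_mul]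
  norm_num

theorem memLp_two_iff {X E : Type*} [MeasurableSpace X] [NormedAddCommGroup E] {f : X → E}
    {μ : Measure X} (hf : AEStronglyMeasurable f μ) :
    MemLp f 2 μ ↔ ∫⁻ x, ‖f x‖ₑ ^ 2 ∂μ < ⊤ := by
  rw [← eLpNorm_two_sq, MemLp, and_iff_right hf, ENNReal.pow_lt_top_iff]
  simp

theorem MemLp.lintegral_sq_lt_top {X E : Type*} [MeasurableSpace X] [NormedAddCommGroup E]
    {f : X → E} {μ : Measure X} (hf : MemLp f 2 μ) : ∫⁻ x, ‖f x‖ₑ ^ 2 ∂μ < ⊤ :=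
  (memLp_two_iff hf.1).1 hf

theorem continuous_fourierInv {ψ : ℝ → ℂ} (hψ : Integrable ψ) : Continuous (𝓕⁻ ψ) := by
  have h := VectorFourier.fourierIntegral_continuous (L := -innerₗ ℝ) Real.continuous_fourierChar
    (continuous_inner (𝕜 := ℝ) (E := ℝ)).neg hψ
  exact h

theorem integral_fourierInv_mul {f g : ℝ → ℂ} (hf : Integrable f) (hg : Integrable g) :
    ∫ ξ, 𝓕⁻ f ξ * g ξ = ∫ x, f x * 𝓕⁻ g x := by
  have h := VectorFourier.integral_fourierIntegral_smul_eq_flip (L := -innerₗ ℝ)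
    Real.continuous_fourierChar
    (continuous_inner (𝕜 := ℝ) (E := ℝ)).neg hf hg
  have e : (-innerₗ ℝ : ℝ →ₗ[ℝ] ℝ →ₗ[ℝ] ℝ).flip = -innerₗ ℝ := by
    ext; simp
  rw [e] at h
  exact h

/-- The `L²` and the pointwise inverse Fourier transforms agree on `L¹ ∩ L²`. -/
theorem fourierInv_toLp_ae_eq {ψ : ℝ → ℂ} (h2 : MemLp ψ 2) (h1 : Integrable ψ) :
    (𝓕⁻ h2.toLp : Lp ℂ 2 (volume : Measure ℝ)) =ᵐ[volume] 𝓕⁻ ψ := by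
  refine ae_eq_of_integral_contDiff_smul_eq ((Lp.memLp _).locallyIntegrable one_le_two)
    (continuous_fourierInv h1).locallyIntegrable fun g hg hgc => ?_
  have hg₁ : HasCompactSupport (Complex.ofRealCLM ∘ g) := hgc.comp_left rfl
  have hg₂ : ContDiff ℝ ((⊤ : ℕ∞) : WithTop ℕ∞) (Complex.ofRealCLM ∘ g) :=
    Complex.ofRealCLM.contDiff.comp hg
  set χ := hg₁.toSchwartzMap hg₂ with hχ
  have hχa : ∀ x, χ x = (g x : ℂ) := fun x => by simp [hχ]
  have e := congrArg (fun T : 𝓢'(ℝ, ℂ) => T χ) (Lp.fourierInv_toTemperedDistribution_eq h2.toLp)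
  simp only [TemperedDistribution.fourierInv_apply, Lp.toTemperedDistribution_apply,
    smul_eq_mul] at e
  calc ∫ x, g x • (𝓕⁻ h2.toLp : Lp ℂ 2 (volume : Measure ℝ)) x
      = ∫ x, χ x * (𝓕⁻ h2.toLp : Lp ℂ 2 (volume : Measure ℝ)) x := by simp [hχa]
    _ = ∫ x, (𝓕⁻ χ) x * h2.toLp ψ x := e.symm
    _ = ∫ x, 𝓕⁻ (χ : ℝ → ℂ) x * ψ x := by
        refine integral_congr_ae ?_
        filter_upwards [h2.coeFn_toLp] with x hx
        rw [hx, SchwartzMap.fourierInv_coe]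
    _ = ∫ x, χ x * 𝓕⁻ ψ x := integral_fourierInv_mul χ.integrable h1
    _ = _ := by simp [hχa]

/-- The pairing of `L²` functions on the line, without conjugation. -/
def pairing : Lp ℂ 2 (volume : Measure ℝ) →L[ℂ] Lp ℂ 2 (volume : Measure ℝ) →L[ℂ] ℂ :=
  (ContinuousLinearMap.mul ℂ ℂ).lpPairing volume 2 2

theorem pairing_apply (f g : Lp ℂ 2 (volume : Measure ℝ)) : pairing f g = ∫ x, f x * g x := by
  rw [pairing, ContinuousLinearMap.lpPairing_eq_integral]
  simp

/-- For Schwartz `g` this is the definition of the inverse transform of a tempered distribution;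
both sides are continuous in `g`, and Schwartz functions are dense. -/
theorem pairing_fourierInv (f g : Lp ℂ 2 (volume : Measure ℝ)) :
    pairing (𝓕⁻ f) g = pairing f (𝓕⁻ g) := by
  refine DenseRange.induction_on
    (p := fun g : Lp ℂ 2 (volume : Measure ℝ) => pairing (𝓕⁻ f) g = pairing f (𝓕⁻ g))
    (SchwartzMap.denseRange_toLpCLM (p := 2) ENNReal.ofNat_ne_top) g
    ?_ fun χ => ?_
  · refine isClosed_eq (pairing (𝓕⁻ f)).continuous ((pairing f).continuous.comp ?_)
    exact (Lp.fourierTransformₗᵢ ℝ ℂ).symm.continuous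
  · have e := congrArg (fun T : 𝓢'(ℝ, ℂ) => T χ) (Lp.fourierInv_toTemperedDistribution_eq f)
    simp only [TemperedDistribution.fourierInv_apply, Lp.toTemperedDistribution_apply,
      smul_eq_mul] at e
    rw [SchwartzMap.toLpCLM_apply, SchwartzMap.toLp_fourierInv_eq, pairing_apply, pairing_apply]
    calc _ = ∫ x, χ x * (𝓕⁻ f : Lp ℂ 2 (volume : Measure ℝ)) x := by
          refine integral_congr_ae ?_
          filter_upwards [χ.coeFn_toLp 2] with x hx
          rw [hx, mul_comm]
      _ = _ := e.symm
      _ = _ := by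
          refine integral_congr_ae ?_
          filter_upwards [(𝓕⁻ χ).coeFn_toLp 2] with x hx
          rw [hx, mul_comm]

theorem MemLp.comp_const_mul {f : ℝ → ℂ} (hf : MemLp f 2) {c : ℝ} (hc : c ≠ 0) :
    MemLp (fun x => f (c * x)) 2 := by
  refine MemLp.comp_of_map (f := fun x => c * x) ?_ (measurable_const_mul c).aemeasurable
  rw [Real.map_volume_mul_left hc]
  exact hf.smul_measure ENNReal.ofReal_ne_top

/-- The physical side of a square-integrable Fourier transform. -/
theorem exists_inverse_transform : ∃ C : ℝ≥0∞, C ≠ ⊤ ∧ ∀ V : ℝ → ℂ, MemLp V 2 →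
    ∃ v : ℝ → ℂ, MemLp v 2 ∧ StronglyMeasurable v ∧ ∫⁻ t, ‖v t‖ₑ ^ 2 ≤ C * ∫⁻ τ, ‖V τ‖ₑ ^ 2 ∧
      ∀ ψ : ℝ → ℂ, MemLp ψ 2 → Integrable ψ → ∫ t, v t * ψ t = ∫ τ, V τ * chk ψ τ := by
  have h2π : (2 * π : ℝ) ≠ 0 := Real.two_pi_pos.ne'
  refine ⟨‖((2 * π : ℝ) : ℂ)‖ₑ ^ 2 * ENNReal.ofReal |(2 * π)⁻¹|, by finiteness, fun V hV => ?_⟩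
  -- The dilation by `2π` and the factor `2π` convert `e^{iτt}` to the normalisation `e^{2πiξt}`.
  have hV' : MemLp (fun ξ => ((2 * π : ℝ) : ℂ) * V (2 * π * ξ)) 2 :=
    (MemLp.comp_const_mul hV h2π).const_mul _
  set f := (𝓕⁻ hV'.toLp : Lp ℂ 2 (volume : Measure ℝ)) with hf
  refine ⟨f, Lp.memLp f, Lp.stronglyMeasurable f, le_of_eq ?_, fun ψ hψ2 hψ1 => ?_⟩
  · have hn : ‖f‖ = ‖hV'.toLp‖ := (Lp.fourierTransformₗᵢ ℝ ℂ).symm.norm_map _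
    have hn' : eLpNorm f 2 volume = eLpNorm hV'.toLp 2 volume := by
      rw [← Lp.enorm_def, ← Lp.enorm_def, ← ofReal_norm, ← ofReal_norm, hn]
    rw [← eLpNorm_two_sq, hn', eLpNorm_congr_ae hV'.coeFn_toLp, eLpNorm_two_sq]
    simp_rw [enorm_mul, mul_pow]
    rw [lintegral_const_mul' _ _ (by finiteness), mul_assoc]
    congr 1
    have h := lintegral_map' (μ := volume) (f := fun τ => ‖V τ‖ₑ ^ 2) (g := fun x : ℝ => 2 * π * x)
      (by
        rw [Real.map_volume_mul_left h2π]
        exact (hV.1.enorm.pow_const 2).smul_measure _) (measurable_const_mul _).aemeasurable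
    rw [Real.map_volume_mul_left h2π, lintegral_smul_measure, smul_eq_mul] at h
    exact h.symm
  · have e1 : ∫ t, f t * ψ t = pairing f hψ2.toLp := by
      rw [pairing_apply]
      refine integral_congr_ae ?_
      filter_upwards [hψ2.coeFn_toLp] with t ht
      rw [ht]
    rw [e1, hf, pairing_fourierInv, pairing_apply]
    calc _ = ∫ ξ, (2 * π : ℝ) • (V (2 * π * ξ) * chk ψ (2 * π * ξ)) := by
          refine integral_congr_ae ?_
          filter_upwards [hV'.coeFn_toLp, fourierInv_toLp_ae_eq hψ2 hψ1] with ξ h1 h2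
          rw [h1, h2, chk_eq_fourierInv, mul_div_cancel_left₀ _ h2π, Complex.real_smul, mul_assoc]
      _ = _ := by
          rw [integral_smul, Measure.integral_comp_mul_left (fun τ => V τ * chk ψ τ),
            abs_of_pos (inv_pos.2 Real.two_pi_pos), smul_smul, mul_inv_cancel₀ h2π, one_smul]

end

/-! ### Fourier series on the torus -/

open AddCircle in
-- Trigonometric polynomials are dense in the continuous functions, so `h` annihilates all of these.
-- Thickened indicators then show that `h` has integral zero over every closed set.
theorem ae_eq_zero_of_fourierCoeff_eq_zero {h : Torus → ℂ} (hh : Integrable h haarAddCircle)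
    (h0 : ∀ k, fourierCoeff h k = 0) : h =ᵐ[haarAddCircle] 0 := by
  have hC : ∀ φ : C(Torus, ℂ), Integrable (fun x => φ x * h x) haarAddCircle := fun φ =>
    hh.bdd_mul φ.continuous.aestronglyMeasurable
      (Filter.Eventually.of_forall fun x => φ.norm_coe_le_norm x)
  let L : C(Torus, ℂ) →ₗ[ℂ] ℂ :=
    { toFun := fun φ => ∫ x, φ x * h x ∂haarAddCircle
      map_add' := fun φ ψ => by
        rw [← integral_add (hC φ) (hC ψ)]
        simp [add_mul]
      map_smul' := fun c φ => by
        simp only [RingHom.id_apply, smul_eq_mul]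
        rw [← integral_const_mul]
        simp [mul_assoc] }
  let Lc : C(Torus, ℂ) →L[ℂ] ℂ := L.mkContinuous (∫ x, ‖h x‖ ∂haarAddCircle) fun φ => by
    change ‖∫ x, φ x * h x ∂haarAddCircle‖ ≤ _
    refine (norm_integral_le_integral_norm _).trans ?_
    rw [mul_comm _ ‖φ‖, ← integral_const_mul]
    refine integral_mono (hC φ).norm (hh.norm.const_mul _) fun x => ?_
    simp only [norm_mul]
    exact mul_le_mul_of_nonneg_right (φ.norm_coe_le_norm x) (norm_nonneg _)
  have hker : (Submodule.span ℂ (range (@fourier (2 * π)))).topologicalClosure ≤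
      LinearMap.ker (Lc : C(Torus, ℂ) →ₗ[ℂ] ℂ) := by
    refine Submodule.topologicalClosure_minimal _ (Submodule.span_le.2 ?_) Lc.isClosed_ker
    rintro _ ⟨n, rfl⟩
    have := h0 (-n)
    rw [fourierCoeff, neg_neg] at this
    exact this
  rw [span_fourier_closure_eq_top, top_le_iff] at hker
  have hzero : ∀ φ : C(Torus, ℂ), ∫ x, φ x * h x ∂haarAddCircle = 0 := fun φ => by
    have : φ ∈ LinearMap.ker (Lc : C(Torus, ℂ) →ₗ[ℂ] ℂ) := hker ▸ Submodule.mem_top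
    exact this
  refine ae_eq_zero_of_forall_setIntegral_isClosed_eq_zero hh fun s hs => ?_
  let χ : ℕ → C(Torus, ℂ) := fun n =>
    ⟨fun x => ((thickenedIndicator (δ := 1 / ((n : ℝ) + 1)) (by positivity) s x : ℝ) : ℂ), by
      have := (thickenedIndicator (δ := 1 / ((n : ℝ) + 1)) (by positivity) s).continuous
      fun_prop⟩
  have hlim : ∀ x, Filter.Tendsto (fun n => χ n x * h x) Filter.atTop
      (nhds (s.indicator h x)) := fun x => by
    have h1 := tendsto_pi_nhds.1 (thickenedIndicator_tendsto_indicator_closure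
      (fun n : ℕ => (by positivity : (0 : ℝ) < 1 / ((n : ℝ) + 1)))
      tendsto_one_div_add_atTop_nhds_zero_nat s) x
    rw [hs.closure_eq] at h1
    have h2 : Filter.Tendsto (fun n => χ n x) Filter.atTop
        (nhds (((s.indicator (fun _ => (1 : NNReal)) x : NNReal) : ℝ) : ℂ)) :=
      (Complex.continuous_ofReal.tendsto _).comp ((NNReal.continuous_coe.tendsto _).comp h1)
    have h3 := h2.mul_const (h x)
    convert! h3 using 2
    by_cases hx : x ∈ s <;> simp [hx]
  have hd := tendsto_integral_of_dominated_convergence (μ := haarAddCircle) (fun x => ‖h x‖)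
    (F := fun n x => χ n x * h x) (f := s.indicator h) (fun n => (hC (χ n)).1) hh.norm
    (fun n => Filter.Eventually.of_forall fun x => by
      rw [norm_mul]
      refine mul_le_of_le_one_left (norm_nonneg _) ?_
      change ‖((thickenedIndicator _ s x : ℝ) : ℂ)‖ ≤ 1
      rw [Complex.norm_real, Real.norm_of_nonneg (NNReal.coe_nonneg _)]
      exact_mod_cast thickenedIndicator_le_one _ s x)
    (Filter.Eventually.of_forall hlim)
  simp_rw [hzero] at hd
  rw [← integral_indicator hs.measurableSet]
  exact tendsto_nhds_unique hd tendsto_const_nhds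

open AddCircle in
/-- An integrable function on the torus with square-summable coefficients is square-integrable. -/
theorem memLp_two_of_fourierCoeff {f : Torus → ℂ} (hf : Integrable f haarAddCircle)
    (hs : ∑' k, ‖fourierCoeff f k‖ₑ ^ 2 < ⊤) :
    MemLp f 2 haarAddCircle ∧
      ∫⁻ x, ‖f x‖ₑ ^ 2 ∂haarAddCircle = ∑' k, ‖fourierCoeff f k‖ₑ ^ 2 := by
  have hsum : Summable fun k => ‖fourierCoeff f k‖ ^ 2 := by
    have h := ENNReal.summable_toReal hs.ne
    simpa using h
  have hmem : Memℓp (fourierCoeff f) 2 := memℓp_gen (by simpa using hsum)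
  -- Riesz–Fischer produces a square-integrable `g` with the coefficients of `f`; uniqueness for
  -- integrable functions gives `f = g`.
  set g : Lp ℂ 2 (@haarAddCircle (2 * π) _) := fourierBasis.repr.symm ⟨fourierCoeff f, hmem⟩ with hg
  have hgc : ∀ k, fourierCoeff g k = fourierCoeff f k := fun k => by
    rw [← fourierBasis_repr, hg, LinearIsometryEquiv.apply_symm_apply]
  have hgi : Integrable g haarAddCircle := (Lp.memLp g).integrable one_le_two
  have hfg : f =ᵐ[haarAddCircle] g := by
    have h := ae_eq_zero_of_fourierCoeff_eq_zero (hf.sub hgi) fun k => by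
      rw [fourierCoeff]
      simp only [Pi.sub_apply, smul_sub]
      rw [integral_sub (hf.fourier_smul (-k)) (hgi.fourier_smul (-k))]
      exact sub_eq_zero.2 (hgc k).symm
    filter_upwards [h] with x hx
    exact sub_eq_zero.1 hx
  refine ⟨(memLp_congr_ae hfg).2 (Lp.memLp g), ?_⟩
  have hp := hasSum_sq_fourierCoeff g
  simp_rw [hgc] at hp
  have e1 : ∫⁻ x, ‖f x‖ₑ ^ 2 ∂haarAddCircle = ∫⁻ x, ‖g x‖ₑ ^ 2 ∂haarAddCircle := by
    refine lintegral_congr_ae ?_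
    filter_upwards [hfg] with x hx
    rw [hx]
  have e2 : ∫⁻ x, ‖g x‖ₑ ^ 2 ∂haarAddCircle =
      ENNReal.ofReal (∫ x, ‖g x‖ ^ 2 ∂haarAddCircle) := by
    rw [ofReal_integral_eq_lintegral_ofReal ((Lp.memLp g).integrable_norm_pow two_ne_zero)
      (Filter.Eventually.of_forall fun x => by positivity)]
    refine lintegral_congr fun x => ?_
    rw [ENNReal.ofReal_pow (norm_nonneg _), ofReal_norm]
  rw [e1, e2, ← hp.tsum_eq, ENNReal.ofReal_tsum_of_nonneg (fun k => by positivity) hsum]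
  refine tsum_congr fun k => ?_
  rw [ENNReal.ofReal_pow (norm_nonneg _), ofReal_norm]

open AddCircle in
/-- The coefficients of a product of square-integrable functions on the torus. -/
theorem fourierCoeff_mul {f g : Torus → ℂ} (hf : MemLp f 2 haarAddCircle)
    (hg : MemLp g 2 haarAddCircle) (k : ℤ) :
    fourierCoeff (fun x => f x * g x) k = ∑' j, fourierCoeff f j * fourierCoeff g (k - j) := by
  have hx : MemLp (fun x => fourier k x * (starRingEnd ℂ) (g x)) 2 haarAddCircle := by
    refine MemLp.of_le hg ?_ (Filter.Eventually.of_forall fun x => ?_)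
    · exact (fourier k).continuous.aestronglyMeasurable.mul
        (Complex.continuous_conj.comp_aestronglyMeasurable hg.1)
    · rw [norm_mul, RCLike.norm_conj]
      exact mul_le_of_le_one_left (norm_nonneg _)
        (((fourier k).norm_coe_le_norm x).trans (fourier_norm k).le)
  -- Parseval's identity for `e^{ikx}` times the conjugate of `g`, paired with `f`; the inner
  -- product conjugates its first argument, so `g` itself appears.
  have h := fourierBasis.hasSum_inner_mul_inner hx.toLp hf.toLp
  have e0 : inner ℂ hx.toLp hf.toLp = fourierCoeff (fun x => f x * g x) k := by
    rw [L2.inner_def, fourierCoeff]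
    refine integral_congr_ae ?_
    filter_upwards [hx.coeFn_toLp, hf.coeFn_toLp] with x h1 h2
    rw [h1, h2, RCLike.inner_apply, map_mul, ← fourier_neg, Complex.conj_conj, smul_eq_mul]
    ring
  have e1 : ∀ j, inner ℂ (fourierBasis j) hf.toLp = fourierCoeff f j := fun j => by
    rw [← fourierBasis.repr_apply_apply, fourierBasis_repr, fourierCoeff_congr_ae hf.coeFn_toLp]
  have e2 : ∀ j, inner ℂ hx.toLp (fourierBasis j) = fourierCoeff g (k - j) := fun j => by
    rw [L2.inner_def, fourierCoeff, coe_fourierBasis]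
    refine integral_congr_ae ?_
    filter_upwards [hx.coeFn_toLp, coeFn_fourierLp 2 j] with x h1 h2
    rw [h1, h2, RCLike.inner_apply, map_mul, ← fourier_neg, Complex.conj_conj, smul_eq_mul,
      ← mul_assoc, ← fourier_add]
    congr 3
    ring
  rw [e0] at h
  simp_rw [e1, e2, mul_comm] at h
  exact h.tsum_eq.symm

/-! ### Products of functions and convolutions of Fourier transforms -/

theorem chk_modulate (φ : ℝ → ℂ) (σ τ : ℝ) :
    chk (fun t => Complex.exp (Complex.I * σ * t) * φ t) τ = chk φ (τ + σ) := by
  unfold chk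
  refine integral_congr_ae (Filter.Eventually.of_forall fun t => ?_)
  simp only
  rw [← mul_assoc, ← Complex.exp_add]
  congr 2
  push_cast
  ring

theorem continuous_chk (φ : 𝓢(ℝ, ℂ)) : Continuous (chk φ) := by
  have := (chkCLM φ).continuous
  rwa [show (chkCLM φ : ℝ → ℂ) = chk φ from funext (chkCLM_apply φ)] at this

theorem integrable_chk (φ : 𝓢(ℝ, ℂ)) : Integrable (chk φ) := by
  have := (chkCLM φ).integrable (μ := volume)
  rwa [show (chkCLM φ : ℝ → ℂ) = chk φ from funext (chkCLM_apply φ)] at this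

theorem lintegral_convolution_sq_le_mul {F G : ℝ → ℝ≥0∞} (hF : Measurable F) (hG : Measurable G)
    (τ : ℝ) : (∫⁻ σ, F σ * G (τ - σ)) ^ 2 ≤ (∫⁻ σ, F σ ^ 2) * ∫⁻ σ, G σ ^ 2 := by
  refine (lintegral_mul_sq_le hF.aemeasurable (hG.comp (measurable_const_sub τ)).aemeasurable).trans
    (le_of_eq ?_)
  congr 1
  exact lintegral_sub_left_eq_self (fun σ => G σ ^ 2) τ

theorem stronglyMeasurable_convolution_integrand {V₁ V₂ : ℝ → ℂ} (h₁ : StronglyMeasurable V₁)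
    (h₂ : StronglyMeasurable V₂) :
    StronglyMeasurable fun p : ℝ × ℝ => V₁ p.2 * V₂ (p.1 - p.2) :=
  (h₁.comp_measurable measurable_snd).mul
    (h₂.comp_measurable (measurable_fst.sub measurable_snd))

theorem memLp_two_bdd_mul {f g : ℝ → ℂ} (hf : MemLp f 2) (hg : AEStronglyMeasurable g volume)
    {c : ℝ} (hc : ∀ t, ‖g t‖ ≤ c) : MemLp (fun t => g t * f t) 2 := by
  refine MemLp.of_le_mul (c := c) hf (hg.mul hf.1) (Filter.Eventually.of_forall fun t => ?_)
  rw [norm_mul]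
  exact mul_le_mul_of_nonneg_right (hc t) (norm_nonneg _)

/-- The Fourier transform of a product of two square-integrable functions is the convolution of
their Fourier transforms. -/
theorem integral_mul_mul_eq {V₁ V₂ v₁ v₂ : ℝ → ℂ} (hV₁ : StronglyMeasurable V₁)
    (hV₂ : StronglyMeasurable V₂) (h₁ : MemLp V₁ 2) (h₂ : MemLp V₂ 2) (hv₂ : MemLp v₂ 2)
    (e₁ : ∀ ψ : ℝ → ℂ, MemLp ψ 2 → Integrable ψ → ∫ t, v₁ t * ψ t = ∫ τ, V₁ τ * chk ψ τ)
    (e₂ : ∀ ψ : ℝ → ℂ, MemLp ψ 2 → Integrable ψ → ∫ t, v₂ t * ψ t = ∫ τ, V₂ τ * chk ψ τ)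
    (φ : 𝓢(ℝ, ℂ)) :
    ∫ t, φ t * (v₁ t * v₂ t) = ∫ τ, (∫ σ, V₁ σ * V₂ (τ - σ)) * chk φ τ := by
  have hφ2 : MemLp φ 2 volume := φ.memLp 2
  have hψ1 : Integrable fun t => v₂ t * φ t := hv₂.integrable_mul hφ2
  have hψ2 : MemLp (fun t => v₂ t * φ t) 2 := by
    have := memLp_two_bdd_mul hv₂ φ.continuous.aestronglyMeasurable
      (fun t => φ.norm_le_seminorm ℝ t)
    simpa only [mul_comm] using this
  -- Modulating the test function by `e^{iσt}` translates `chk φ`, so `e₂` computes the transform of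
  -- `v₂ φ`.
  have hchk : ∀ σ, chk (fun t => v₂ t * φ t) σ = ∫ τ, V₂ τ * chk φ (τ + σ) := fun σ => by
    have hc : Continuous fun t : ℝ => Complex.exp (Complex.I * σ * t) := by fun_prop
    have h := e₂ (fun t => Complex.exp (Complex.I * σ * t) * φ t)
      (memLp_two_bdd_mul hφ2 hc.aestronglyMeasurable (fun t => (norm_exp_I_mul σ t).le))
      ((φ.integrable (μ := volume)).bdd_mul hc.aestronglyMeasurable
        (Filter.Eventually.of_forall fun t => (norm_exp_I_mul σ t).le))
    simp_rw [chk_modulate] at h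
    rw [← h, chk]
    exact integral_congr_ae (Filter.Eventually.of_forall fun t => mul_left_comm _ _ _)
  have hm := stronglyMeasurable_convolution_integrand hV₁ hV₂
  have hcm : StronglyMeasurable fun p : ℝ × ℝ => chk φ p.1 :=
    (continuous_chk φ).stronglyMeasurable.comp_measurable measurable_fst
  have hint : Integrable (fun p : ℝ × ℝ => V₁ p.2 * V₂ (p.1 - p.2) * chk φ p.1)
      (volume.prod volume) := by
    refine ⟨(hm.mul hcm).aestronglyMeasurable, ?_⟩
    rw [hasFiniteIntegral_iff_enorm, lintegral_prod _ (by exact (hm.mul hcm).measurable.enorm.aemeasurable)]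
    set N := (∫⁻ σ, ‖V₁ σ‖ₑ ^ 2) * ∫⁻ σ, ‖V₂ σ‖ₑ ^ 2 with hN
    have hNt : N < ⊤ := ENNReal.mul_lt_top (MemLp.lintegral_sq_lt_top h₁)
      (MemLp.lintegral_sq_lt_top h₂)
    -- Young's inequality in its `L² * L² → L^∞` form; the crude `1 + N` replaces the square root of
    -- `N`.
    have hb : ∀ τ, ∫⁻ σ, ‖V₁ σ‖ₑ * ‖V₂ (τ - σ)‖ₑ ≤ 1 + N := fun τ => by
      have h := lintegral_convolution_sq_le_mul hV₁.measurable.enorm hV₂.measurable.enorm τ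
      refine le_of_sq_le_sq (h.trans ?_)
      calc N = N * 1 := (mul_one N).symm
        _ ≤ (1 + N) * (1 + N) := mul_le_mul' le_add_self le_self_add
        _ = _ := (sq _).symm
    calc _ ≤ ∫⁻ τ, (1 + N) * ‖chk φ τ‖ₑ := by
          refine lintegral_mono fun τ => ?_
          simp_rw [enorm_mul]
          rw [lintegral_mul_const' _ _ enorm_ne_top]
          exact mul_le_mul_left (hb τ) _
      _ < ⊤ := by
          rw [lintegral_const_mul' _ _ (by finiteness)]
          exact ENNReal.mul_lt_top (by finiteness) (integrable_chk φ).2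
  calc ∫ t, φ t * (v₁ t * v₂ t) = ∫ t, v₁ t * (v₂ t * φ t) :=
        integral_congr_ae (Filter.Eventually.of_forall fun t => by simp only; ring)
    _ = ∫ σ, V₁ σ * ∫ τ, V₂ τ * chk φ (τ + σ) := by
        rw [e₁ _ hψ2 hψ1]
        simp_rw [hchk]
    _ = ∫ σ, ∫ τ, V₁ σ * V₂ (τ - σ) * chk φ τ := by
        refine integral_congr_ae (Filter.Eventually.of_forall fun σ => ?_)
        simp only
        rw [← integral_const_mul, ← integral_sub_right_eq_self _ σ]
        exact integral_congr_ae (Filter.Eventually.of_forall fun τ => by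
          simp only [sub_add_cancel]; ring)
    _ = ∫ τ, ∫ σ, V₁ σ * V₂ (τ - σ) * chk φ τ := (integral_integral_swap hint).symm
    _ = _ := by simp_rw [integral_mul_const]

/-- The Fourier transform of a product of functions on space-time. -/
def conv (V₁ V₂ : ℤ → ℝ → ℂ) (k : ℤ) (τ : ℝ) : ℂ := ∑' j : ℤ, ∫ σ, V₁ j σ * V₂ (k - j) (τ - σ)

/-- The convolution of the absolute values. -/
def absConv (V₁ V₂ : ℤ → ℝ → ℂ) (k : ℤ) (τ : ℝ) : ℝ≥0∞ :=
  ∑' j : ℤ, ∫⁻ σ, ‖V₁ j σ‖ₑ * ‖V₂ (k - j) (τ - σ)‖ₑ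

theorem enorm_conv_le (V₁ V₂ : ℤ → ℝ → ℂ) (k : ℤ) (τ : ℝ) :
    ‖conv V₁ V₂ k τ‖ₑ ≤ absConv V₁ V₂ k τ := by
  refine (enorm_tsum_le_tsum_enorm).trans (ENNReal.tsum_le_tsum fun j => ?_)
  refine (enorm_integral_le_lintegral_enorm _).trans (le_of_eq ?_)
  simp_rw [enorm_mul]

/-- The total energy of a family of modes. -/
def energy (V : ℤ → ℝ → ℂ) : ℝ≥0∞ := ∑' k, ∫⁻ τ, ‖V k τ‖ₑ ^ 2

theorem tsum_mul_reflect_sq_le (a b : ℤ → ℝ≥0∞) (k : ℤ) :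
    (∑' j, a j * b (k - j)) ^ 2 ≤ (∑' j, a j ^ 2) * ∑' j, b j ^ 2 := by
  refine (tsum_mul_sq_le a fun j => b (k - j)).trans (le_of_eq ?_)
  congr 1
  exact (Equiv.subLeft k).tsum_eq (fun j => b j ^ 2)

theorem rpow_half_sq (x : ℝ≥0∞) : (x ^ (1 / 2 : ℝ)) ^ 2 = x := by
  rw [← ENNReal.rpow_two, ← ENNReal.rpow_mul]; norm_num

/-- Cauchy–Schwarz in `σ`, then in `j`. Finite energy thus makes the convolution bounded at every
point, so each of its modes is the transform of a tempered distribution. -/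
theorem absConv_sq_le {V₁ V₂ : ℤ → ℝ → ℂ} (h₁ : ∀ k, StronglyMeasurable (V₁ k))
    (h₂ : ∀ k, StronglyMeasurable (V₂ k)) (k : ℤ) (τ : ℝ) :
    absConv V₁ V₂ k τ ^ 2 ≤ energy V₁ * energy V₂ := by
  set a : ℤ → ℝ≥0∞ := fun j => (∫⁻ σ, ‖V₁ j σ‖ₑ ^ 2) ^ (1 / 2 : ℝ) with ha
  set b : ℤ → ℝ≥0∞ := fun j => (∫⁻ σ, ‖V₂ j σ‖ₑ ^ 2) ^ (1 / 2 : ℝ) with hb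
  calc absConv V₁ V₂ k τ ^ 2 ≤ (∑' j, a j * b (k - j)) ^ 2 := by
        refine pow_le_pow_left₀ zero_le (ENNReal.tsum_le_tsum fun j => le_of_sq_le_sq ?_) 2
        rw [mul_pow, ha, hb, rpow_half_sq, rpow_half_sq]
        exact lintegral_convolution_sq_le_mul (h₁ j).measurable.enorm (h₂ _).measurable.enorm τ
    _ ≤ _ := by
        refine (tsum_mul_reflect_sq_le a b k).trans (le_of_eq ?_)
        simp_rw [ha, hb, rpow_half_sq]
        rfl

theorem measurable_conv {V₁ V₂ : ℤ → ℝ → ℂ} (h₁ : ∀ k, StronglyMeasurable (V₁ k))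
    (h₂ : ∀ k, StronglyMeasurable (V₂ k)) (k : ℤ) : Measurable (conv V₁ V₂ k) :=
  Measurable.tsum fun j =>
    (stronglyMeasurable_convolution_integrand (h₁ j) (h₂ (k - j))).integral_prod_right'.measurable

theorem measurable_lintegral_convolution {V₁ V₂ : ℝ → ℂ} (h₁ : StronglyMeasurable V₁)
    (h₂ : StronglyMeasurable V₂) : Measurable fun τ => ∫⁻ σ, ‖V₁ σ‖ₑ * ‖V₂ (τ - σ)‖ₑ := by
  have := (stronglyMeasurable_convolution_integrand h₁ h₂).measurable.enorm.lintegral_prod_right'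
    (ν := volume)
  simpa only [enorm_mul] using this

theorem exists_absConv_le {V₁ V₂ : ℤ → ℝ → ℂ} (h₁ : ∀ k, StronglyMeasurable (V₁ k))
    (h₂ : ∀ k, StronglyMeasurable (V₂ k)) (f₁ : energy V₁ < ⊤) (f₂ : energy V₂ < ⊤) :
    ∃ M : ℝ≥0∞, M ≠ ⊤ ∧ ∀ k τ, absConv V₁ V₂ k τ ≤ M := by
  refine ⟨(energy V₁ * energy V₂) ^ (1 / 2 : ℝ), by finiteness, fun k τ => le_of_sq_le_sq ?_⟩
  rw [rpow_half_sq]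
  exact absConv_sq_le h₁ h₂ k τ

theorem memLp_top_conv {V₁ V₂ : ℤ → ℝ → ℂ} (h₁ : ∀ k, StronglyMeasurable (V₁ k))
    (h₂ : ∀ k, StronglyMeasurable (V₂ k)) (f₁ : energy V₁ < ⊤) (f₂ : energy V₂ < ⊤) (k : ℤ) :
    MemLp (conv V₁ V₂ k) ⊤ := by
  obtain ⟨M, hM, h⟩ := exists_absConv_le h₁ h₂ f₁ f₂
  refine memLp_top_of_bound (measurable_conv h₁ h₂ k).aestronglyMeasurable M.toReal
    (Filter.Eventually.of_forall fun τ => ?_)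
  have := (enorm_conv_le V₁ V₂ k τ).trans (h k τ)
  rw [← toReal_enorm]
  exact ENNReal.toReal_mono hM this

/-- A coefficient of an integrable function on the slab agrees on `(0, δ)` with the inverse
transform of any extension. -/
theorem fourierCoeff_ae_eq {δ : ℝ} {u : Torus × ℝ → ℂ} (h : Integrable u (slab δ)) {v : PDist}
    (hv : EqOnTime δ v (ofFun h)) {V : ℤ → ℝ → ℂ} (hV : IsFourier v V) {k : ℤ} {w : ℝ → ℂ}
    (hw : MemLp w 2)
    (e : ∀ ψ : ℝ → ℂ, MemLp ψ 2 → Integrable ψ → ∫ t, w t * ψ t = ∫ τ, V k τ * chk ψ τ) :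
    ∀ᵐ t ∂((volume : Measure ℝ).restrict (Ioo 0 δ)),
      fourierCoeff (fun x : Torus => u (x, t)) k = w t := by
  set F : ℝ → ℂ := (Ioo 0 δ).indicator fun t => fourierCoeff (fun x : Torus => u (x, t)) k with hF
  have hFi : Integrable F := integrable_coeff h k
  have key : ∀ᵐ t, t ∈ Ioo 0 δ → F t - w t = 0 := by
    refine isOpen_Ioo.ae_eq_zero_of_integral_contDiff_smul_eq_zero
      ((hFi.locallyIntegrable.sub (hw.locallyIntegrable one_le_two)).locallyIntegrableOn _)
      fun g hg hgc hgs => ?_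
    have hg₁ : HasCompactSupport (Complex.ofRealCLM ∘ g) := hgc.comp_left rfl
    have hg₂ : ContDiff ℝ ((⊤ : ℕ∞) : WithTop ℕ∞) (Complex.ofRealCLM ∘ g) :=
      Complex.ofRealCLM.contDiff.comp hg
    set χ := hg₁.toSchwartzMap hg₂ with hχ
    have hχa : ∀ x, χ x = (g x : ℂ) := fun x => by simp [hχ]
    have hχs : tsupport χ ⊆ Ioo 0 δ := by
      refine Subset.trans (closure_mono fun x hx => ?_) hgs
      rw [Function.mem_support, hχa] at hx
      exact fun h0 => hx (by rw [h0, Complex.ofReal_zero])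
    have i1 : Integrable fun t => F t * χ t := by
      simpa only [mul_comm] using hFi.bdd_mul χ.continuous.aestronglyMeasurable
        (Filter.Eventually.of_forall fun t => χ.norm_le_seminorm ℝ t)
    have i2 : Integrable fun t => w t * χ t := hw.integrable_mul (χ.memLp 2)
    have e1 : ∫ t, F t * χ t = ofFun h k χ := by
      rw [ofFun_apply, ← integral_indicator measurableSet_Ioo]
      refine integral_congr_ae (Filter.Eventually.of_forall fun t => ?_)
      by_cases ht : t ∈ Ioo 0 δ <;> simp [hF, ht, mul_comm]
    have e2 : ∫ t, w t * χ t = v k χ := by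
      rw [e χ (χ.memLp 2) χ.integrable, ((isFourier_iff.1 hV k).2 χ).2]
    calc ∫ t, g t • (F t - w t) = ∫ t, (F t * χ t - w t * χ t) := by
          refine integral_congr_ae (Filter.Eventually.of_forall fun t => ?_)
          simp only [hχa, Complex.real_smul]
          ring
      _ = 0 := by rw [integral_sub i1 i2, e1, e2, hv k χ hχs, sub_self]
  rw [ae_restrict_iff' measurableSet_Ioo]
  filter_upwards [key] with t ht hts
  have := ht hts
  rwa [hF, indicator_of_mem hts, sub_eq_zero] at this

/-- The inverse transforms `w k` have finite total energy, so almost every time slice of `u` has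
square-summable coefficients and lies in `L²(𝕋)`. Integrating Parseval's identity in time upgrades
`u` from integrable to square integrable on the slab. -/
theorem exists_slab_modes {δ : ℝ} {u : Torus × ℝ → ℂ} (h : Integrable u (slab δ)) {v : PDist}
    (hv : EqOnTime δ v (ofFun h)) {V : ℤ → ℝ → ℂ} (hV : IsFourier v V) (hE : energy V < ⊤) :
    ∃ w : ℤ → ℝ → ℂ, (∀ k, MemLp (w k) 2 ∧ StronglyMeasurable (w k)) ∧ energy w < ⊤ ∧
      (∀ k (ψ : ℝ → ℂ), MemLp ψ 2 → Integrable ψ → ∫ t, w k t * ψ t = ∫ τ, V k τ * chk ψ τ) ∧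
      MemLp u 2 (slab δ) ∧
      ∀ᵐ t ∂((volume : Measure ℝ).restrict (Ioo 0 δ)),
        MemLp (fun x => u (x, t)) 2 AddCircle.haarAddCircle ∧
        ∀ k, fourierCoeff (fun x : Torus => u (x, t)) k = w k t := by
  obtain ⟨C, hC, hex⟩ := exists_inverse_transform
  have hV2 : ∀ k, MemLp (V k) 2 := fun k =>
    (memLp_two_iff (hV k).1).2 ((ENNReal.le_tsum k).trans_lt hE)
  choose w hw2 hwm hwn hwe using fun k => hex (V k) (hV2 k)
  have hwE : energy w < ⊤ := by
    refine (ENNReal.tsum_le_tsum hwn).trans_lt ?_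
    rw [ENNReal.tsum_mul_left]
    exact ENNReal.mul_lt_top hC.lt_top hE
  have hfin : ∀ᵐ t ∂((volume : Measure ℝ).restrict (Ioo 0 δ)), ∑' k, ‖w k t‖ₑ ^ 2 < ⊤ := by
    refine ae_restrict_of_ae (ae_lt_top (Measurable.tsum fun k =>
      (hwm k).measurable.enorm.pow_const 2) ?_)
    rw [lintegral_tsum fun k => ((hwm k).measurable.enorm.pow_const 2).aemeasurable]
    exact hwE.ne
  have hcoef : ∀ᵐ t ∂((volume : Measure ℝ).restrict (Ioo 0 δ)),
      ∀ k, fourierCoeff (fun x : Torus => u (x, t)) k = w k t :=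
    ae_all_iff.2 fun k => fourierCoeff_ae_eq h hv hV (hw2 k) (hwe k)
  have hslice : ∀ᵐ t ∂((volume : Measure ℝ).restrict (Ioo 0 δ)),
      MemLp (fun x => u (x, t)) 2 AddCircle.haarAddCircle ∧
      ∫⁻ x, ‖u (x, t)‖ₑ ^ 2 ∂AddCircle.haarAddCircle = ∑' k, ‖w k t‖ₑ ^ 2 := by
    have hi : ∀ᵐ t ∂((volume : Measure ℝ).restrict (Ioo 0 δ)),
        Integrable (fun x => u (x, t)) AddCircle.haarAddCircle := h.prod_left_ae
    filter_upwards [hfin, hcoef, hi] with t h1 h2 h3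
    have := memLp_two_of_fourierCoeff h3 (by simpa only [h2] using h1)
    simpa only [h2] using this
  refine ⟨w, fun k => ⟨hw2 k, hwm k⟩, hwE, hwe, ?_, ?_⟩
  · rw [memLp_two_iff h.1, slab, lintegral_prod_symm _ (h.1.enorm.pow_const 2)]
    calc _ = ∫⁻ t in Ioo 0 δ, ∑' k, ‖w k t‖ₑ ^ 2 :=
          lintegral_congr_ae (hslice.mono fun t ht => ht.2)
      _ ≤ ∫⁻ t, ∑' k, ‖w k t‖ₑ ^ 2 := setLIntegral_le_lintegral _ _
      _ = energy w := lintegral_tsum fun k => ((hwm k).measurable.enorm.pow_const 2).aemeasurable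
      _ < ⊤ := hwE
  · filter_upwards [hslice, hcoef] with t h1 h2 using ⟨h1.1, h2⟩

/-- On `(0, δ)` the product of two functions has the convolution of the Fourier transforms of
extensions as the Fourier transform of an extension. -/
theorem product_eq {δ : ℝ} {u₁ u₂ : Torus × ℝ → ℂ} (h₁ : Integrable u₁ (slab δ))
    (h₂ : Integrable u₂ (slab δ)) {v₁ v₂ : PDist} (hv₁ : EqOnTime δ v₁ (ofFun h₁))
    (hv₂ : EqOnTime δ v₂ (ofFun h₂)) {V₁ V₂ : ℤ → ℝ → ℂ} (hV₁ : IsFourier v₁ V₁)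
    (hV₂ : IsFourier v₂ V₂) (m₁ : ∀ k, StronglyMeasurable (V₁ k))
    (m₂ : ∀ k, StronglyMeasurable (V₂ k)) (E₁ : energy V₁ < ⊤) (E₂ : energy V₂ < ⊤) :
    ∃ h : Integrable (fun p => u₁ p * u₂ p) (slab δ), ∀ (k : ℤ) (φ : 𝓢(ℝ, ℂ)),
      tsupport φ ⊆ Ioo 0 δ → ofFun h k φ = ∫ τ, conv V₁ V₂ k τ * chk φ τ := by
  obtain ⟨w₁, hw₁, hwE₁, e₁, hL₁, hs₁⟩ := exists_slab_modes h₁ hv₁ hV₁ E₁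
  obtain ⟨w₂, hw₂, hwE₂, e₂, hL₂, hs₂⟩ := exists_slab_modes h₂ hv₂ hV₂ E₂
  refine ⟨hL₁.integrable_mul hL₂, fun k φ hφ => ?_⟩
  have hφ0 : ∀ t, t ∉ Ioo 0 δ → φ t = 0 := fun t ht =>
    image_eq_zero_of_notMem_tsupport fun h => ht (hφ h)
  rw [ofFun_apply]
  have step1 : ∫ t in Ioo 0 δ, φ t * fourierCoeff (fun x : Torus => u₁ (x, t) * u₂ (x, t)) k =
      ∫ t, ∑' j, φ t * (w₁ j t * w₂ (k - j) t) := by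
    rw [← setIntegral_eq_integral_of_forall_compl_eq_zero (s := Ioo 0 δ)
      (f := fun t => ∑' j, φ t * (w₁ j t * w₂ (k - j) t)) fun t ht => by simp [hφ0 t ht]]
    refine integral_congr_ae ?_
    filter_upwards [hs₁, hs₂] with t ht₁ ht₂
    rw [fourierCoeff_mul ht₁.1 ht₂.1, tsum_mul_left]
    simp_rw [ht₁.2, ht₂.2]
  -- Absolute convergence comes from Cauchy–Schwarz in time and then over the modes.
  have step2 : ∫ t, ∑' j, φ t * (w₁ j t * w₂ (k - j) t) =
      ∑' j, ∫ t, φ t * (w₁ j t * w₂ (k - j) t) := by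
    refine integral_tsum (fun j => (φ.continuous.stronglyMeasurable.mul
      ((hw₁ j).2.mul (hw₂ (k - j)).2)).aestronglyMeasurable) (ne_of_lt ?_)
    obtain ⟨c, hc⟩ : ∃ c : ℝ, ∀ t, ‖φ t‖ ≤ c := ⟨_, φ.norm_le_seminorm ℝ⟩
    have hb : ∀ j, ∫⁻ t, ‖φ t * (w₁ j t * w₂ (k - j) t)‖ₑ ≤ ENNReal.ofReal c *
        ((∫⁻ t, ‖w₁ j t‖ₑ ^ 2) ^ (1 / 2 : ℝ) * (∫⁻ t, ‖w₂ (k - j) t‖ₑ ^ 2) ^ (1 / 2 : ℝ)) := by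
      intro j
      calc _ ≤ ∫⁻ t, ENNReal.ofReal c * (‖w₁ j t‖ₑ * ‖w₂ (k - j) t‖ₑ) := by
            refine lintegral_mono fun t => ?_
            rw [enorm_mul, enorm_mul]
            refine mul_le_mul_left ?_ _
            rw [← ofReal_norm]
            exact ENNReal.ofReal_le_ofReal (hc t)
        _ ≤ _ := by
            rw [lintegral_const_mul' _ _ ENNReal.ofReal_ne_top]
            refine mul_le_mul_right (le_of_sq_le_sq ?_) _
            rw [mul_pow, rpow_half_sq, rpow_half_sq]
            exact lintegral_mul_sq_le (hw₁ j).2.measurable.enorm.aemeasurable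
              (hw₂ (k - j)).2.measurable.enorm.aemeasurable
    refine (ENNReal.tsum_le_tsum hb).trans_lt ?_
    rw [ENNReal.tsum_mul_left]
    refine ENNReal.mul_lt_top ENNReal.ofReal_lt_top ?_
    have h := tsum_mul_reflect_sq_le (fun j => (∫⁻ t, ‖w₁ j t‖ₑ ^ 2) ^ (1 / 2 : ℝ))
      (fun j => (∫⁻ t, ‖w₂ j t‖ₑ ^ 2) ^ (1 / 2 : ℝ)) k
    simp_rw [rpow_half_sq] at h
    exact (ENNReal.pow_lt_top_iff.1 (h.trans_lt (ENNReal.mul_lt_top hwE₁ hwE₂))).resolve_right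
      two_ne_zero
  have hV₁2 : ∀ j, MemLp (V₁ j) 2 := fun j =>
    (memLp_two_iff (hV₁ j).1).2 ((ENNReal.le_tsum j).trans_lt E₁)
  have hV₂2 : ∀ j, MemLp (V₂ j) 2 := fun j =>
    (memLp_two_iff (hV₂ j).1).2 ((ENNReal.le_tsum j).trans_lt E₂)
  have step3 : ∀ j, ∫ t, φ t * (w₁ j t * w₂ (k - j) t) =
      ∫ τ, (∫ σ, V₁ j σ * V₂ (k - j) (τ - σ)) * chk φ τ := fun j =>
    integral_mul_mul_eq (m₁ j) (m₂ (k - j)) (hV₁2 j) (hV₂2 (k - j)) (hw₂ (k - j)).1 (e₁ j)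
      (e₂ (k - j)) φ
  -- Here the interchange rests on the boundedness of `absConv` and the integrability of `chk φ`.
  have step4 : ∑' j, ∫ τ, (∫ σ, V₁ j σ * V₂ (k - j) (τ - σ)) * chk φ τ =
      ∫ τ, ∑' j, (∫ σ, V₁ j σ * V₂ (k - j) (τ - σ)) * chk φ τ := by
    refine (integral_tsum (fun j => ?_) (ne_of_lt ?_)).symm
    · exact ((stronglyMeasurable_convolution_integrand (m₁ j)
        (m₂ (k - j))).integral_prod_right'.mul
          (continuous_chk φ).stronglyMeasurable).aestronglyMeasurable
    obtain ⟨M, hM, hMb⟩ := exists_absConv_le m₁ m₂ E₁ E₂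
    have hmeas : ∀ j, Measurable fun τ =>
        (∫⁻ σ, ‖V₁ j σ‖ₑ * ‖V₂ (k - j) (τ - σ)‖ₑ) * ‖chk φ τ‖ₑ := fun j =>
      (measurable_lintegral_convolution (m₁ j) (m₂ (k - j))).mul
        (continuous_chk φ).measurable.enorm
    calc _ ≤ ∑' j, ∫⁻ τ, (∫⁻ σ, ‖V₁ j σ‖ₑ * ‖V₂ (k - j) (τ - σ)‖ₑ) * ‖chk φ τ‖ₑ := by
          refine ENNReal.tsum_le_tsum fun j => lintegral_mono fun τ => ?_
          rw [enorm_mul]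
          refine mul_le_mul_left ((enorm_integral_le_lintegral_enorm _).trans (le_of_eq ?_)) _
          simp_rw [enorm_mul]
      _ = ∫⁻ τ, absConv V₁ V₂ k τ * ‖chk φ τ‖ₑ := by
          rw [← lintegral_tsum fun j => (hmeas j).aemeasurable]
          simp_rw [ENNReal.tsum_mul_right]
          rfl
      _ ≤ ∫⁻ τ, M * ‖chk φ τ‖ₑ := lintegral_mono fun τ => mul_le_mul_left (hMb k τ) _
      _ < ⊤ := by
          rw [lintegral_const_mul' _ _ hM]
          exact ENNReal.mul_lt_top hM.lt_top (integrable_chk φ).2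
  rw [step1, step2]
  simp_rw [step3]
  rw [step4]
  simp_rw [tsum_mul_right]
  rfl

/-! ### The resonance function and its lower bound -/

theorem exists_le_abs_sub {γ : ℝ} : ∃ c : ℝ, 0 < c ∧ ∀ n : ℤ, (n : ℝ) ≠ γ → c ≤ |(n : ℝ) - γ| := by
  -- If `γ` is an integer, all others are at distance at least `1`; if not, none is closer than the
  -- nearest integer.
  by_cases hγ : γ = round γ
  · refine ⟨1, one_pos, fun n hn => ?_⟩
    rw [hγ] at hn ⊢
    have : n - round γ ≠ 0 := fun h => hn (by rw [sub_eq_zero.1 h])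
    exact_mod_cast Int.one_le_abs this
  · refine ⟨|γ - round γ|, abs_pos.2 (sub_ne_zero.2 hγ), fun n _ => ?_⟩
    rw [abs_sub_comm (n : ℝ)]
    exact round_le γ n

/-- For `n ≥ 2|γ|` the distance to `γ` is at least `n/2`; below that the uniform gap wins, `n` being
bounded. The `+ 1` in the denominator covers `γ = 0`. -/
theorem exists_mul_le_abs_sub {γ : ℝ} : ∃ c : ℝ, 0 < c ∧ ∀ n : ℤ, 0 ≤ n → (n : ℝ) ≠ γ →
    c * n ≤ |(n : ℝ) - γ| := by
  obtain ⟨c, hc, h⟩ := exists_le_abs_sub (γ := γ)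
  have hd : 0 < 2 * |γ| + 1 := by positivity
  refine ⟨min (1 / 2) (c / (2 * |γ| + 1)), by positivity, fun n hn hne => ?_⟩
  have hn' : (0 : ℝ) ≤ n := by exact_mod_cast hn
  rcases le_total (2 * |γ|) n with h1 | h1
  · calc _ ≤ 1 / 2 * (n : ℝ) := mul_le_mul_of_nonneg_right (min_le_left _ _) hn'
      _ ≤ (n : ℝ) - γ := by linarith [le_abs_self γ]
      _ ≤ _ := le_abs_self _
  · calc _ ≤ c / (2 * |γ| + 1) * n := mul_le_mul_of_nonneg_right (min_le_right _ _) hn'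
      _ ≤ c := by
          rw [div_mul_eq_mul_div, div_le_iff₀ hd]
          exact mul_le_mul_of_nonneg_left (by linarith) hc.le
      _ ≤ _ := h n hne

/-- The size of the resonance function. -/
def reson (k₁ k₂ : ℤ) : ℝ :=
  |((k₁ + k₂ : ℤ) : ℝ)| * |(k₁ : ℝ)| * |(k₂ : ℝ)| * ((k₁ : ℝ) ^ 2 + (k₂ : ℝ) ^ 2)

theorem reson_pos {k₁ k₂ : ℤ} (h₁ : k₁ ≠ 0) (h₂ : k₂ ≠ 0) (h : k₁ + k₂ ≠ 0) : 0 < reson k₁ k₂ := by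
  have a1 : (k₁ : ℝ) ≠ 0 := Int.cast_ne_zero.2 h₁
  have a2 : (k₂ : ℝ) ≠ 0 := Int.cast_ne_zero.2 h₂
  have a3 : ((k₁ + k₂ : ℤ) : ℝ) ≠ 0 := Int.cast_ne_zero.2 h
  unfold reson
  positivity

/-- One of the three modulations is at least comparable to the resonance function. -/
theorem exists_resonance_le {α β : ℝ} (hα : α ≠ 0) (hnr : NonResonant α β) : ∃ c : ℝ, 0 < c ∧
    ∀ k₁ k₂ : ℤ, k₁ ≠ 0 → k₂ ≠ 0 → ∀ τ σ : ℝ, c * reson k₁ k₂ ≤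
      bracket (modul α β (k₁ + k₂) τ) + bracket (modul α β k₁ σ) +
        bracket (modul α β k₂ (τ - σ)) := by
  obtain ⟨c, hc, h⟩ := exists_mul_le_abs_sub (γ := 3 * β / (5 * α))
  have hα' : 0 < |α| := abs_pos.2 hα
  refine ⟨5 * |α| * (c / 2), by positivity, fun k₁ k₂ h₁ h₂ τ σ => ?_⟩
  set n : ℤ := k₁ ^ 2 + k₂ ^ 2 + k₁ * k₂ with hn
  have hn0 : 0 ≤ n := by nlinarith [sq_nonneg (k₁ + k₂), sq_nonneg k₁, sq_nonneg k₂]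
  have hcast : (n : ℝ) = (k₁ : ℝ) ^ 2 + (k₂ : ℝ) ^ 2 + (k₁ : ℝ) * (k₂ : ℝ) := by
    rw [hn]; push_cast; ring
  -- Non-resonance only excludes equality; because `n` is an integer this already gives a lower
  -- bound proportional to `n`.
  have hne : (n : ℝ) ≠ 3 * β / (5 * α) := by
    rw [hcast]; exact (hnr k₁ k₂ h₁ h₂).symm
  have hmain := h n hn0 hne
  have hlow : ((k₁ : ℝ) ^ 2 + (k₂ : ℝ) ^ 2) / 2 ≤ n := by
    rw [hcast]; nlinarith [sq_nonneg ((k₁ : ℝ) + k₂)]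
  have hid : modul α β (k₁ + k₂) τ - modul α β k₁ σ - modul α β k₂ (τ - σ) =
      5 * α * (((k₁ + k₂ : ℤ) : ℝ) * k₁ * k₂) * ((n : ℝ) - 3 * β / (5 * α)) := by
    rw [hcast]
    unfold modul
    push_cast
    field_simp
    ring
  have habs : 5 * |α| * (|((k₁ + k₂ : ℤ) : ℝ)| * |(k₁ : ℝ)| * |(k₂ : ℝ)|) *
      |(n : ℝ) - 3 * β / (5 * α)| ≤ |modul α β (k₁ + k₂) τ| + |modul α β k₁ σ| +
        |modul α β k₂ (τ - σ)| := by
    have e : 5 * |α| * (|((k₁ + k₂ : ℤ) : ℝ)| * |(k₁ : ℝ)| * |(k₂ : ℝ)|) *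
        |(n : ℝ) - 3 * β / (5 * α)| =
        |modul α β (k₁ + k₂) τ - modul α β k₁ σ - modul α β k₂ (τ - σ)| := by
      rw [hid]
      simp only [abs_mul]
      norm_num
    rw [e]
    exact (abs_sub _ _).trans (add_le_add_left (abs_sub _ _) _)
  calc 5 * |α| * (c / 2) * reson k₁ k₂
      = 5 * |α| * (|((k₁ + k₂ : ℤ) : ℝ)| * |(k₁ : ℝ)| * |(k₂ : ℝ)|) *
          (c * (((k₁ : ℝ) ^ 2 + (k₂ : ℝ) ^ 2) / 2)) := by unfold reson; ring
    _ ≤ 5 * |α| * (|((k₁ + k₂ : ℤ) : ℝ)| * |(k₁ : ℝ)| * |(k₂ : ℝ)|) *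
          |(n : ℝ) - 3 * β / (5 * α)| := by
        refine mul_le_mul_of_nonneg_left ?_ (by positivity)
        exact (mul_le_mul_of_nonneg_left hlow hc.le).trans hmain
    _ ≤ _ := habs.trans (by unfold bracket; linarith)

/-- The pointwise consequence of the resonance bound for the weights of the bilinear estimate. -/
theorem exists_weight_mul_le {α β : ℝ} (hα : α ≠ 0) (hnr : NonResonant α β) : ∃ D : ℝ, 0 < D ∧
    ∀ k₁ k₂ : ℤ, k₁ ≠ 0 → k₂ ≠ 0 → k₁ + k₂ ≠ 0 → ∀ τ σ : ℝ,
      weight (-(2 / 5)) (modul α β (k₁ + k₂) τ) * (weight (-(3 / 10)) (modul α β k₁ σ) *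
        weight (-(3 / 10)) (modul α β k₂ (τ - σ))) ≤
      ENNReal.ofReal (D * reson k₁ k₂ ^ (-(3 / 10) : ℝ)) *
        (weight (-(3 / 10)) (modul α β k₁ σ) * weight (-(3 / 10)) (modul α β k₂ (τ - σ)) +
          weight (-(3 / 10)) (modul α β (k₁ + k₂) τ) *
            weight (-(3 / 10)) (modul α β k₂ (τ - σ)) +
          weight (-(3 / 10)) (modul α β (k₁ + k₂) τ) * weight (-(3 / 10)) (modul α β k₁ σ)) := by
  obtain ⟨c, hc, h⟩ := exists_resonance_le hα hnr
  refine ⟨c ^ (-(3 / 10) : ℝ), by positivity, fun k₁ k₂ h₁ h₂ h₃ τ σ => ?_⟩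
  have hR := reson_pos h₁ h₂ h₃
  have hres := h k₁ k₂ h₁ h₂ τ σ
  set x := modul α β (k₁ + k₂) τ
  set y := modul α β k₁ σ
  set z := modul α β k₂ (τ - σ)
  set p : ℝ := 3 / 10 with hp
  have hx := bracket_pos x
  have hy := bracket_pos y
  have hz := bracket_pos z
  -- Since `t ↦ t^p` is subadditive, the resonance bound inserts a sum of three terms, each of which
  -- cancels one of the three weights.
  have h1 : (1 : ℝ) ≤ (c * reson k₁ k₂) ^ (-p) *
      (bracket x ^ p + bracket y ^ p + bracket z ^ p) := by
    have hcR : 0 < c * reson k₁ k₂ := by positivity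
    rw [Real.rpow_neg hcR.le, ← div_eq_inv_mul, one_le_div (by positivity)]
    calc (c * reson k₁ k₂) ^ p ≤ (bracket x + bracket y + bracket z) ^ p :=
          Real.rpow_le_rpow hcR.le hres (by norm_num [hp])
      _ ≤ (bracket x + bracket y) ^ p + bracket z ^ p :=
          Real.rpow_add_le_add_rpow (by positivity) hz.le (by norm_num [hp]) (by norm_num [hp])
      _ ≤ _ := by
          gcongr
          exact Real.rpow_add_le_add_rpow hx.le hy.le (by norm_num [hp]) (by norm_num [hp])
  have hcancel : ∀ t : ℝ, bracket t ^ (-p) * bracket t ^ p = 1 := fun t => by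
    rw [← Real.rpow_add (bracket_pos t), neg_add_cancel, Real.rpow_zero]
  -- Of the output weight of exponent `-2/5` only `-3/10` is needed.
  have h2 : bracket x ^ (-(2 / 5) : ℝ) ≤ bracket x ^ (-p) :=
    Real.rpow_le_rpow_of_exponent_le (one_le_bracket x) (by norm_num [hp])
  have key : bracket x ^ (-(2 / 5) : ℝ) * (bracket y ^ (-p) * bracket z ^ (-p)) ≤
      (c ^ (-p) * reson k₁ k₂ ^ (-p)) * (bracket y ^ (-p) * bracket z ^ (-p) +
        bracket x ^ (-p) * bracket z ^ (-p) + bracket x ^ (-p) * bracket y ^ (-p)) := by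
    rw [← Real.mul_rpow hc.le hR.le]
    set Q := (c * reson k₁ k₂) ^ (-p)
    calc _ ≤ bracket x ^ (-p) * (bracket y ^ (-p) * bracket z ^ (-p)) * 1 := by
          rw [mul_one]
          exact mul_le_mul_of_nonneg_right h2 (by positivity)
      _ ≤ bracket x ^ (-p) * (bracket y ^ (-p) * bracket z ^ (-p)) *
            (Q * (bracket x ^ p + bracket y ^ p + bracket z ^ p)) :=
          mul_le_mul_of_nonneg_left h1 (by positivity)
      _ = Q * ((bracket x ^ (-p) * bracket x ^ p) * (bracket y ^ (-p) * bracket z ^ (-p)) +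
            (bracket y ^ (-p) * bracket y ^ p) * (bracket x ^ (-p) * bracket z ^ (-p)) +
            (bracket z ^ (-p) * bracket z ^ p) * (bracket x ^ (-p) * bracket y ^ (-p))) := by ring
      _ = _ := by simp only [hcancel, one_mul]
  have := ENNReal.ofReal_le_ofReal key
  simp only [weight]
  rw [← ENNReal.ofReal_mul (by positivity), ← ENNReal.ofReal_mul (by positivity),
    ← ENNReal.ofReal_mul (by positivity), ← ENNReal.ofReal_mul (by positivity),
    ← ENNReal.ofReal_add (by positivity) (by positivity),
    ← ENNReal.ofReal_add (by positivity) (by positivity), ← ENNReal.ofReal_mul (by positivity)]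
  exact this

/-! ### Interaction of two spatial modes -/

theorem lintegral_bilinear_sq_le {K : ℝ × ℝ → ℝ≥0∞} (hK : Measurable K) {S : ℝ≥0∞}
    (hS : ∀ τ, ∫⁻ σ, K (τ, σ) ^ 2 ≤ S) {F G : ℝ → ℝ≥0∞} (hF : Measurable F) (hG : Measurable G) :
    ∫⁻ τ, (∫⁻ σ, K (τ, σ) * (F σ * G (τ - σ))) ^ 2 ≤ S * ((∫⁻ σ, F σ ^ 2) * ∫⁻ σ, G σ ^ 2) := by
  have hm : Measurable fun p : ℝ × ℝ => (F p.2 * G (p.1 - p.2)) ^ 2 :=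
    ((hF.comp measurable_snd).mul (hG.comp (measurable_fst.sub measurable_snd))).pow_const 2
  calc _ ≤ ∫⁻ τ, S * ∫⁻ σ, (F σ * G (τ - σ)) ^ 2 := by
        refine lintegral_mono fun τ => ?_
        refine (lintegral_mul_sq_le (hK.comp measurable_prodMk_left).aemeasurable
          (hF.mul (hG.comp (measurable_const_sub τ))).aemeasurable).trans ?_
        exact mul_le_mul_left (hS τ) _
    _ = S * ∫⁻ σ, ∫⁻ τ, (F σ * G (τ - σ)) ^ 2 := by
        rw [lintegral_const_mul _ hm.lintegral_prod_right', lintegral_lintegral_swap hm.aemeasurable]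
    _ = _ := by
        simp_rw [mul_pow]
        congr 1
        rw [← lintegral_mul_const _ (hF.pow_const 2)]
        refine lintegral_congr fun σ => ?_
        have hGσ : Measurable fun τ => G (τ - σ) ^ 2 :=
          (hG.comp (measurable_sub_const σ)).pow_const 2
        rw [lintegral_const_mul _ hGσ]
        congr 1
        exact lintegral_comp_sub_right (fun τ => G τ ^ 2) σ

/-- The kernel is grouped with `F` before Cauchy–Schwarz, because here its square is integrable in
`τ` at fixed `σ` rather than in `σ` at fixed `τ`. -/
theorem lintegral_bilinear_sq_le' {K : ℝ × ℝ → ℝ≥0∞} (hK : Measurable K) {S : ℝ≥0∞}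
    (hS : ∀ σ, ∫⁻ τ, K (τ, σ) ^ 2 ≤ S) {F G : ℝ → ℝ≥0∞} (hF : Measurable F) (hG : Measurable G) :
    ∫⁻ τ, (∫⁻ σ, K (τ, σ) * (F σ * G (τ - σ))) ^ 2 ≤ S * ((∫⁻ σ, F σ ^ 2) * ∫⁻ σ, G σ ^ 2) := by
  have hm : Measurable fun p : ℝ × ℝ => (K p * F p.2) ^ 2 :=
    (hK.mul (hF.comp measurable_snd)).pow_const 2
  calc _ ≤ ∫⁻ τ, (∫⁻ σ, (K (τ, σ) * F σ) ^ 2) * ∫⁻ σ, G σ ^ 2 := by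
        refine lintegral_mono fun τ => ?_
        simp_rw [← mul_assoc]
        refine (lintegral_mul_sq_le ((hK.comp measurable_prodMk_left).mul hF).aemeasurable
          (hG.comp (measurable_const_sub τ)).aemeasurable).trans (le_of_eq ?_)
        congr 1
        exact lintegral_sub_left_eq_self (fun σ => G σ ^ 2) τ
    _ = (∫⁻ σ, ∫⁻ τ, (K (τ, σ) * F σ) ^ 2) * ∫⁻ σ, G σ ^ 2 := by
        rw [lintegral_mul_const _ hm.lintegral_prod_right', lintegral_lintegral_swap hm.aemeasurable]
    _ ≤ (∫⁻ σ, S * F σ ^ 2) * ∫⁻ σ, G σ ^ 2 := by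
        refine mul_le_mul_left (lintegral_mono fun σ => ?_) _
        simp_rw [mul_pow]
        have hKσ : Measurable fun τ => K (τ, σ) ^ 2 :=
          (hK.comp measurable_prodMk_right).pow_const 2
        rw [lintegral_mul_const _ hKσ]
        exact mul_le_mul_left (hS σ) _
    _ = _ := by rw [lintegral_const_mul _ (hF.pow_const 2), mul_assoc]

/-- A product of squares is at most the sum of the fourth powers. For `p = -3/10` the right side is
finite, since `4p = -6/5 < -1`. -/
theorem lintegral_weight_mul_weight_le (p a b : ℝ) :
    ∫⁻ x, (weight p (x - a) * weight p (x - b)) ^ 2 ≤ 2 * ∫⁻ x, weight (4 * p) x := by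
  have hm : ∀ c : ℝ, Measurable fun x => weight (4 * p) (x - c) := fun c =>
    (measurable_weight _).comp (measurable_sub_const c)
  calc _ ≤ ∫⁻ x, (weight (4 * p) (x - a) + weight (4 * p) (x - b)) := by
        refine lintegral_mono fun x => ?_
        have e : ∀ t, weight (4 * p) t = (weight p t ^ 2) * (weight p t ^ 2) := fun t => by
          rw [weight_sq, weight_mul]; ring_nf
        rw [e, e, mul_pow]
        rcases le_total (weight p (x - a) ^ 2) (weight p (x - b) ^ 2) with h | h
        · exact (mul_le_mul_left h _).trans le_add_self
        · exact (mul_le_mul_right h _).trans le_self_add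
    _ = _ := by
        rw [lintegral_add_left (hm a), lintegral_comp_sub_right, lintegral_comp_sub_right, two_mul]

theorem add_sq_le (a b : ℝ≥0∞) : (a + b) ^ 2 ≤ 4 * (a ^ 2 + b ^ 2) := by
  have h : ∀ x y : ℝ≥0∞, x ≤ y → (x + y) ^ 2 ≤ 4 * (x ^ 2 + y ^ 2) := fun x y hxy => by
    calc (x + y) ^ 2 ≤ (y + y) ^ 2 := by gcongr
      _ = 4 * y ^ 2 := by ring
      _ ≤ _ := by gcongr; exact le_add_self
  rcases le_total a b with hab | hab
  · exact h a b hab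
  · rw [add_comm a b, add_comm (a ^ 2)]; exact h b a hab

/-- Each product lacks one weight, and the surviving pair decides the variable of integration. The
first is square integrable in `σ` at fixed `τ`, the second in `τ` at fixed `σ`. The third becomes of
the second kind after `σ ↦ τ - σ`, which exchanges `F` and `G`. -/
theorem exists_lintegral_three_le : ∃ C : ℝ≥0∞, C ≠ ⊤ ∧ ∀ (a b c : ℝ) (F G : ℝ → ℝ≥0∞),
    Measurable F → Measurable G →
    ∫⁻ τ, (∫⁻ σ, (weight (-(3 / 10)) (σ - a) * weight (-(3 / 10)) (τ - σ - b) +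
      weight (-(3 / 10)) (τ - c) * weight (-(3 / 10)) (τ - σ - b) +
      weight (-(3 / 10)) (τ - c) * weight (-(3 / 10)) (σ - a)) * (F σ * G (τ - σ))) ^ 2 ≤
      C * ((∫⁻ σ, F σ ^ 2) * ∫⁻ σ, G σ ^ 2) := by
  set p : ℝ := -(3 / 10) with hp
  set J := 2 * ∫⁻ x, weight (4 * p) x with hJ
  have hJt : J ≠ ⊤ := by
    have := (lintegral_weight_lt_top (b := 4 * p) (by norm_num [hp])).ne
    finiteness
  refine ⟨4 * (4 * (J + J) + J), by finiteness, fun a b c F G hF hG => ?_⟩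
  set K₁ : ℝ × ℝ → ℝ≥0∞ := fun q => weight p (q.2 - a) * weight p (q.1 - q.2 - b) with hK₁
  set K₂ : ℝ × ℝ → ℝ≥0∞ := fun q => weight p (q.1 - c) * weight p (q.1 - q.2 - b) with hK₂
  set K₃ : ℝ × ℝ → ℝ≥0∞ := fun q => weight p (q.1 - c) * weight p (q.2 - a) with hK₃
  set K₄ : ℝ × ℝ → ℝ≥0∞ := fun q => weight p (q.1 - c) * weight p (q.1 - q.2 - a) with hK₄
  have m₁ : Measurable K₁ := by fun_prop
  have m₂ : Measurable K₂ := by fun_prop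
  have m₃ : Measurable K₃ := by fun_prop
  have m₄ : Measurable K₄ := by fun_prop
  set N := (∫⁻ σ, F σ ^ 2) * ∫⁻ σ, G σ ^ 2 with hN
  have b₁ : ∫⁻ τ, (∫⁻ σ, K₁ (τ, σ) * (F σ * G (τ - σ))) ^ 2 ≤ J * N := by
    refine lintegral_bilinear_sq_le m₁ (fun τ => ?_) hF hG
    refine le_trans (le_of_eq (lintegral_congr fun σ => ?_))
      (lintegral_weight_mul_weight_le p a (τ - b))
    simp only [hK₁]
    rw [← weight_neg p (τ - σ - b)]
    congr 3
    ring
  have b₂ : ∫⁻ τ, (∫⁻ σ, K₂ (τ, σ) * (F σ * G (τ - σ))) ^ 2 ≤ J * N := by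
    refine lintegral_bilinear_sq_le' m₂ (fun σ => ?_) hF hG
    refine le_trans (le_of_eq (lintegral_congr fun τ => ?_))
      (lintegral_weight_mul_weight_le p c (σ + b))
    rw [hK₂]
    simp only
    congr 3
    ring
  have b₃ : ∫⁻ τ, (∫⁻ σ, K₃ (τ, σ) * (F σ * G (τ - σ))) ^ 2 ≤ J * N := by
    have e : ∀ τ, ∫⁻ σ, K₃ (τ, σ) * (F σ * G (τ - σ)) = ∫⁻ σ, K₄ (τ, σ) * (G σ * F (τ - σ)) :=
      fun τ => by
      rw [← lintegral_sub_left_eq_self _ τ]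
      refine lintegral_congr fun σ => ?_
      simp only [hK₃, hK₄, sub_sub_cancel]
      ring
    simp_rw [e]
    rw [hN, mul_comm (∫⁻ σ, F σ ^ 2)]
    refine lintegral_bilinear_sq_le' m₄ (fun σ => ?_) hG hF
    refine le_trans (le_of_eq (lintegral_congr fun τ => ?_))
      (lintegral_weight_mul_weight_le p c (σ + a))
    rw [hK₄]
    simp only
    congr 3
    ring
  have hFG : Measurable fun q : ℝ × ℝ => F q.2 * G (q.1 - q.2) := by fun_prop
  have hs : ∀ {K : ℝ × ℝ → ℝ≥0∞}, Measurable K → ∀ τ,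
      Measurable fun σ => K (τ, σ) * (F σ * G (τ - σ)) := fun hK τ =>
    (hK.mul hFG).comp measurable_prodMk_left
  have hi : ∀ {K : ℝ × ℝ → ℝ≥0∞}, Measurable K →
      Measurable fun τ => (∫⁻ σ, K (τ, σ) * (F σ * G (τ - σ))) ^ 2 := fun hK =>
    (hK.mul hFG).lintegral_prod_right'.pow_const 2
  calc _ = ∫⁻ τ, ((∫⁻ σ, K₁ (τ, σ) * (F σ * G (τ - σ))) + (∫⁻ σ, K₂ (τ, σ) * (F σ * G (τ - σ))) +
        ∫⁻ σ, K₃ (τ, σ) * (F σ * G (τ - σ))) ^ 2 := by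
        refine lintegral_congr fun τ => ?_
        have h₁₂ : Measurable fun σ => K₁ (τ, σ) * (F σ * G (τ - σ)) +
            K₂ (τ, σ) * (F σ * G (τ - σ)) := (hs m₁ τ).add (hs m₂ τ)
        rw [← lintegral_add_left (hs m₁ τ), ← lintegral_add_left h₁₂]
        congr 1
        refine lintegral_congr fun σ => ?_
        simp only [hK₁, hK₂, hK₃]
        ring
    _ ≤ ∫⁻ τ, 4 * (4 * ((∫⁻ σ, K₁ (τ, σ) * (F σ * G (τ - σ))) ^ 2 +
          (∫⁻ σ, K₂ (τ, σ) * (F σ * G (τ - σ))) ^ 2) +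
          (∫⁻ σ, K₃ (τ, σ) * (F σ * G (τ - σ))) ^ 2) := by
        refine lintegral_mono fun τ => (add_sq_le _ _).trans ?_
        exact mul_le_mul_right (add_le_add (add_sq_le _ _) le_rfl) _
    _ = 4 * (4 * ((∫⁻ τ, (∫⁻ σ, K₁ (τ, σ) * (F σ * G (τ - σ))) ^ 2) +
          ∫⁻ τ, (∫⁻ σ, K₂ (τ, σ) * (F σ * G (τ - σ))) ^ 2) +
          ∫⁻ τ, (∫⁻ σ, K₃ (τ, σ) * (F σ * G (τ - σ))) ^ 2) := by
        rw [lintegral_const_mul' _ _ (by finiteness), lintegral_add_right _ (hi m₃),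
          lintegral_const_mul' _ _ (by finiteness), lintegral_add_left (hi m₁)]
    _ ≤ 4 * (4 * (J * N + J * N) + J * N) := by gcongr
    _ = _ := by ring

/-- The interaction of two modes. -/
theorem exists_two_mode_bound {α β : ℝ} (hα : α ≠ 0) (hnr : NonResonant α β) :
    ∃ C : ℝ≥0∞, C ≠ ⊤ ∧ ∀ k₁ k₂ : ℤ, k₁ ≠ 0 → k₂ ≠ 0 → k₁ + k₂ ≠ 0 → ∀ F G : ℝ → ℝ≥0∞,
      Measurable F → Measurable G →
      ∫⁻ τ, (weight (-(2 / 5)) (modul α β (k₁ + k₂) τ) * ∫⁻ σ, F σ * G (τ - σ)) ^ 2 ≤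
        C * ENNReal.ofReal (reson k₁ k₂ ^ (-(3 / 5) : ℝ)) *
          ((∫⁻ σ, (weight (3 / 10) (modul α β k₁ σ) * F σ) ^ 2) *
            ∫⁻ σ, (weight (3 / 10) (modul α β k₂ σ) * G σ) ^ 2) := by
  obtain ⟨D, hD, hDb⟩ := exists_weight_mul_le hα hnr
  obtain ⟨C, hC, hCb⟩ := exists_lintegral_three_le
  refine ⟨ENNReal.ofReal D ^ 2 * C, by finiteness, fun k₁ k₂ h₁ h₂ h₃ F G hF hG => ?_⟩
  have hR := reson_pos h₁ h₂ h₃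
  set f : ℝ → ℝ≥0∞ := fun σ => weight (3 / 10) (modul α β k₁ σ) * F σ with hf
  set g : ℝ → ℝ≥0∞ := fun σ => weight (3 / 10) (modul α β k₂ σ) * G σ with hg
  have hfm : Measurable f := ((measurable_weight _).comp (continuous_modul α β k₁).measurable).mul hF
  have hgm : Measurable g := ((measurable_weight _).comp (continuous_modul α β k₂).measurable).mul hG
  have hFf : ∀ σ, F σ = weight (-(3 / 10)) (modul α β k₁ σ) * f σ := fun σ => by
    rw [hf]; simp only; rw [← mul_assoc, weight_mul, neg_add_cancel, weight_zero, one_mul]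
  have hGg : ∀ σ, G σ = weight (-(3 / 10)) (modul α β k₂ σ) * g σ := fun σ => by
    rw [hg]; simp only; rw [← mul_assoc, weight_mul, neg_add_cancel, weight_zero, one_mul]
  have h := hCb (β * (k₁ : ℝ) ^ 3 - α * (k₁ : ℝ) ^ 5) (β * (k₂ : ℝ) ^ 3 - α * (k₂ : ℝ) ^ 5)
    (β * ((k₁ + k₂ : ℤ) : ℝ) ^ 3 - α * ((k₁ + k₂ : ℤ) : ℝ) ^ 5) f g hfm hgm
  simp_rw [← modul_eq_sub] at h
  set E := ENNReal.ofReal (D * reson k₁ k₂ ^ (-(3 / 10) : ℝ)) with hE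
  have hE2 : E ^ 2 = ENNReal.ofReal D ^ 2 * ENNReal.ofReal (reson k₁ k₂ ^ (-(3 / 5) : ℝ)) := by
    rw [hE, ENNReal.ofReal_mul hD.le, mul_pow,
      ← ENNReal.ofReal_pow (Real.rpow_nonneg hR.le _),
      ← Real.rpow_natCast (reson k₁ k₂ ^ (-(3 / 10) : ℝ)), ← Real.rpow_mul hR.le]
    norm_num
  calc _ ≤ ∫⁻ τ, (E * ∫⁻ σ, (weight (-(3 / 10)) (modul α β k₁ σ) *
          weight (-(3 / 10)) (modul α β k₂ (τ - σ)) +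
          weight (-(3 / 10)) (modul α β (k₁ + k₂) τ) *
            weight (-(3 / 10)) (modul α β k₂ (τ - σ)) +
          weight (-(3 / 10)) (modul α β (k₁ + k₂) τ) * weight (-(3 / 10)) (modul α β k₁ σ)) *
          (f σ * g (τ - σ))) ^ 2 := by
        refine lintegral_mono fun τ => pow_le_pow_left₀ zero_le ?_ 2
        rw [← lintegral_const_mul' _ _ (weight_ne_top _ _),
          ← lintegral_const_mul' _ _ ENNReal.ofReal_ne_top]
        refine lintegral_mono fun σ => ?_
        rw [hFf σ, hGg (τ - σ), mul_mul_mul_comm (weight _ _), ← mul_assoc (weight _ _),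
          ← mul_assoc (ENNReal.ofReal _)]
        exact mul_le_mul_left (hDb k₁ k₂ h₁ h₂ h₃ τ σ) _
    _ ≤ E ^ 2 * (C * ((∫⁻ σ, f σ ^ 2) * ∫⁻ σ, g σ ^ 2)) := by
        simp_rw [mul_pow]
        rw [lintegral_const_mul' _ _ (by finiteness)]
        exact mul_le_mul_right h _
    _ = _ := by rw [hE2]; ring

/-! ### The sum over spatial frequencies -/

/-- The square of the multiplier of the bilinear estimate. -/
def mult (j m : ℤ) : ℝ :=
  if j = 0 ∨ m = 0 ∨ j + m = 0 then 0 else ((j + m : ℤ) : ℝ) ^ 2 * reson j m ^ (-(3 / 5) : ℝ)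

theorem reson_comm (j m : ℤ) : reson j m = reson m j := by
  unfold reson; rw [add_comm j m]; ring

theorem mult_comm (j m : ℤ) : mult j m = mult m j := by
  unfold mult
  rw [reson_comm, add_comm j m]
  congr 1
  rw [eq_iff_iff]
  tauto

/-- The larger frequency gives `reson j m ≥ |j + m| |j| |m|³`. This leaves `|j + m|^(7/5)`, absorbed
by `|j + m| ≤ 2|m|`; the power of `|m|` is then `7/5 - 9/5 = -2/5`. -/
theorem mult_le {j m : ℤ} (hj : j ≠ 0) (hjm : |j| ≤ |m|) :
    mult j m ≤ 4 * |(m : ℝ)| ^ (-(2 / 5) : ℝ) * |(j : ℝ)| ^ (-(3 / 5) : ℝ) := by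
  unfold mult
  split_ifs with h
  · positivity
  push Not at h
  obtain ⟨-, hm, hk⟩ := h
  have hj0 : 0 < |(j : ℝ)| := abs_pos.2 (Int.cast_ne_zero.2 hj)
  have hm0 : 0 < |(m : ℝ)| := abs_pos.2 (Int.cast_ne_zero.2 hm)
  have hk0 : 0 < |((j + m : ℤ) : ℝ)| := abs_pos.2 (Int.cast_ne_zero.2 hk)
  have hle : |(j : ℝ)| ≤ |(m : ℝ)| := by exact_mod_cast hjm
  set x := |((j + m : ℤ) : ℝ)| with hx
  set y := |(j : ℝ)| with hy
  set z := |(m : ℝ)| with hz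
  have hxz : x ≤ 2 * z := by
    have : x ≤ y + z := by rw [hx]; push_cast; exact abs_add_le _ _
    linarith
  have hR : x * y * z ^ 3 ≤ reson j m := by
    have e : reson j m = x * y * z * (y ^ 2 + z ^ 2) := by
      rw [reson, hy, hz, sq_abs, sq_abs]
    rw [e]
    have : x * y * z * z ^ 2 ≤ x * y * z * (y ^ 2 + z ^ 2) := by
      refine mul_le_mul_of_nonneg_left ?_ (by positivity)
      nlinarith
    nlinarith
  calc ((j + m : ℤ) : ℝ) ^ 2 * reson j m ^ (-(3 / 5) : ℝ)
      ≤ x ^ 2 * (x * y * z ^ 3) ^ (-(3 / 5) : ℝ) := by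
        rw [hx, sq_abs]
        refine mul_le_mul_of_nonneg_left ?_ (sq_nonneg _)
        exact Real.rpow_le_rpow_of_nonpos (by positivity) hR (by norm_num)
    _ = x ^ (7 / 5 : ℝ) * (y ^ (-(3 / 5) : ℝ) * z ^ (-(9 / 5) : ℝ)) := by
        rw [Real.mul_rpow (by positivity) (by positivity), Real.mul_rpow hk0.le hj0.le,
          ← Real.rpow_natCast z 3, ← Real.rpow_mul hm0.le, mul_assoc (x ^ (-(3 / 5) : ℝ)),
          ← mul_assoc (x ^ 2), ← Real.rpow_natCast x 2, ← Real.rpow_add hk0]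
        norm_num
    _ ≤ (4 * z ^ (7 / 5 : ℝ)) * (y ^ (-(3 / 5) : ℝ) * z ^ (-(9 / 5) : ℝ)) := by
        refine mul_le_mul_of_nonneg_right ?_ (by positivity)
        calc x ^ (7 / 5 : ℝ) ≤ (2 * z) ^ (7 / 5 : ℝ) :=
              Real.rpow_le_rpow hk0.le hxz (by norm_num)
          _ = 2 ^ (7 / 5 : ℝ) * z ^ (7 / 5 : ℝ) := Real.mul_rpow two_pos.le hm0.le
          _ ≤ 4 * z ^ (7 / 5 : ℝ) := by
              refine mul_le_mul_of_nonneg_right ?_ (by positivity)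
              calc (2 : ℝ) ^ (7 / 5 : ℝ) ≤ 2 ^ (2 : ℝ) :=
                    Real.rpow_le_rpow_of_exponent_le one_le_two (by norm_num)
                _ = 4 := by norm_num
    _ = 4 * (z ^ (7 / 5 : ℝ) * z ^ (-(9 / 5) : ℝ)) * y ^ (-(3 / 5) : ℝ) := by ring
    _ = _ := by rw [← Real.rpow_add hm0]; norm_num

/-- Induction, where Bernoulli's inequality for the concave power `2/5` supplies the increment;
`5/2` is the reciprocal of that exponent. -/
theorem sum_rpow_le (M : ℕ) :
    ∑ n ∈ Finset.range M, ((n : ℝ) + 1) ^ (-(3 / 5) : ℝ) ≤ 5 / 2 * (M : ℝ) ^ (2 / 5 : ℝ) := by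
  induction M with
  | zero => simp
  | succ M ih =>
    rw [Finset.sum_range_succ]
    push_cast
    have hN : (0 : ℝ) < (M : ℝ) + 1 := by positivity
    have hM : (M : ℝ) = ((M : ℝ) + 1) * (1 + -(1 / ((M : ℝ) + 1))) := by field_simp; ring
    have h1 : (-1 : ℝ) ≤ -(1 / ((M : ℝ) + 1)) := by
      have : 1 / ((M : ℝ) + 1) ≤ 1 := by rw [div_le_one hN]; linarith [Nat.cast_nonneg (α := ℝ) M]
      linarith
    have hb := rpow_one_add_le_one_add_mul_self h1 (p := 2 / 5) (by norm_num) (by norm_num)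
    have e1 : (M : ℝ) ^ (2 / 5 : ℝ) = ((M : ℝ) + 1) ^ (2 / 5 : ℝ) *
        (1 + -(1 / ((M : ℝ) + 1))) ^ (2 / 5 : ℝ) := by
      conv_lhs => rw [hM]
      rw [Real.mul_rpow hN.le (by linarith)]
    have e2 : ((M : ℝ) + 1) ^ (-(3 / 5) : ℝ) = ((M : ℝ) + 1) ^ (2 / 5 : ℝ) * (1 / ((M : ℝ) + 1)) := by
      rw [one_div, ← Real.rpow_neg_one, ← Real.rpow_add hN]; norm_num
    have hpos : 0 < ((M : ℝ) + 1) ^ (2 / 5 : ℝ) := by positivity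
    rw [e2]
    rw [e1] at ih
    nlinarith [mul_le_mul_of_nonneg_left hb hpos.le]

/-- The factor `|m|^(-2/5)` exactly offsets the growth of the sum of `|j|^(-3/5)` over `|j| ≤ |m|`.
Each sign of `j` contributes `4 · 5/2 = 10`. -/
theorem tsum_mult_le (m : ℤ) :
    ∑' j : ℤ, (if |j| ≤ |m| then ENNReal.ofReal (mult j m) else 0) ≤ 20 := by
  rcases eq_or_ne m 0 with rfl | hm
  · have : ∀ j : ℤ, mult j 0 = 0 := fun j => by simp [mult]
    simp [this]
  set M := m.natAbs with hM
  have hMm : |m| = (M : ℤ) := Int.abs_eq_natAbs m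
  have hM0 : 0 < (M : ℝ) := by exact_mod_cast Int.natAbs_pos.2 hm
  have hmM : |(m : ℝ)| = M := by rw [← Int.cast_abs, hMm, Int.cast_natCast]
  set c := 4 * (M : ℝ) ^ (-(2 / 5) : ℝ) with hc
  set h : ℕ → ℝ≥0∞ := fun n =>
    if n < M then ENNReal.ofReal (c * ((n : ℝ) + 1) ^ (-(3 / 5) : ℝ)) else 0 with hh
  set f : ℤ → ℝ≥0∞ := fun j => if |j| ≤ |m| then ENNReal.ofReal (mult j m) else 0 with hf
  have hbound : ∀ (j : ℤ) (n : ℕ), |j| = (n : ℤ) + 1 → f j ≤ h n := fun j n hj => by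
    simp only [hf, hh]
    by_cases hn : n < M
    · have hjm : |j| ≤ |m| := by rw [hj, hMm]; exact_mod_cast hn
      rw [if_pos hn, if_pos hjm]
      refine ENNReal.ofReal_le_ofReal ((mult_le (fun h0 => ?_) hjm).trans (le_of_eq ?_))
      · rw [h0, abs_zero] at hj; omega
      · have : |(j : ℝ)| = (n : ℝ) + 1 := by rw [← Int.cast_abs, hj]; push_cast; rfl
        rw [this, hmM]
    · have hjm : ¬ |j| ≤ |m| := by rw [hj, hMm]; push Not at hn ⊢; exact_mod_cast Nat.lt_succ_of_le hn
      rw [if_neg hn, if_neg hjm]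
  have hhs : ∑' n, h n ≤ 10 := by
    rw [tsum_eq_sum (s := Finset.range M) fun n hn => if_neg (by simpa using hn)]
    calc _ = ∑ n ∈ Finset.range M, ENNReal.ofReal (c * ((n : ℝ) + 1) ^ (-(3 / 5) : ℝ)) :=
          Finset.sum_congr rfl fun n hn => if_pos (Finset.mem_range.1 hn)
      _ = ENNReal.ofReal (c * ∑ n ∈ Finset.range M, ((n : ℝ) + 1) ^ (-(3 / 5) : ℝ)) := by
          rw [Finset.mul_sum, ENNReal.ofReal_sum_of_nonneg fun n _ => by positivity]
      _ ≤ ENNReal.ofReal 10 := by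
          refine ENNReal.ofReal_le_ofReal ?_
          calc _ ≤ c * (5 / 2 * (M : ℝ) ^ (2 / 5 : ℝ)) :=
                mul_le_mul_of_nonneg_left (sum_rpow_le M) (by positivity)
            _ = 10 * ((M : ℝ) ^ (-(2 / 5) : ℝ) * (M : ℝ) ^ (2 / 5 : ℝ)) := by rw [hc]; ring
            _ = 10 := by rw [← Real.rpow_add hM0]; norm_num
      _ = 10 := by norm_num
  have hf0 : f 0 = 0 := by simp [hf, mult]
  -- The integers split into `n ≥ 0` and `-(n + 1)`. The term at `0` vanishes, so after a shift both
  -- halves run over `|j| = n + 1`.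
  have hsplit := (HasSum.of_nat_of_neg_add_one (f := f) ENNReal.summable.hasSum
    ENNReal.summable.hasSum).tsum_eq
  rw [hsplit, tsum_eq_zero_add' ENNReal.summable]
  push_cast
  rw [hf0, zero_add]
  calc _ ≤ ∑' n, h n + ∑' n, h n := by
        refine add_le_add (ENNReal.tsum_le_tsum fun n => hbound _ n ?_)
          (ENNReal.tsum_le_tsum fun n => hbound _ n ?_)
        · exact abs_of_nonneg (by positivity)
        · rw [abs_neg]; exact abs_of_nonneg (by positivity)
    _ ≤ 10 + 10 := add_le_add hhs hhs
    _ = 20 := by norm_num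

/-- Cauchy–Schwarz isolates `a`. With `m = k - j` as a free variable, the sum over `j` falls on `ν j
m` alone. -/
theorem tsum_half_sq_le {ν : ℤ → ℤ → ℝ≥0∞} {S : ℝ≥0∞} (hS : ∀ m, ∑' j, ν j m ≤ S)
    (a b : ℤ → ℝ≥0∞) :
    ∑' k, (∑' j, ν j (k - j) ^ (1 / 2 : ℝ) * (a j * b (k - j))) ^ 2 ≤
      S * ((∑' j, a j ^ 2) * ∑' j, b j ^ 2) := by
  calc _ ≤ ∑' k, (∑' j, a j ^ 2) * ∑' j, ν j (k - j) * b (k - j) ^ 2 := by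
        refine ENNReal.tsum_le_tsum fun k => ?_
        have h := tsum_mul_sq_le a fun j => ν j (k - j) ^ (1 / 2 : ℝ) * b (k - j)
        simp_rw [mul_pow, rpow_half_sq] at h
        refine le_trans (le_of_eq ?_) h
        congr 1
        exact tsum_congr fun j => mul_left_comm _ _ _
    _ = (∑' j, a j ^ 2) * ∑' j, ∑' m, ν j m * b m ^ 2 := by
        rw [ENNReal.tsum_mul_left, ENNReal.tsum_comm]
        congr 1
        exact tsum_congr fun j => (Equiv.subRight j).tsum_eq fun m => ν j m * b m ^ 2
    _ ≤ (∑' j, a j ^ 2) * ∑' m, S * b m ^ 2 := by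
        rw [ENNReal.tsum_comm]
        refine mul_le_mul_right (ENNReal.tsum_le_tsum fun m => ?_) _
        rw [ENNReal.tsum_mul_right]
        exact mul_le_mul_left (hS m) _
    _ = _ := by rw [ENNReal.tsum_mul_left]; ring

/-- The discrete bilinear estimate. -/
theorem tsum_mult_sq_le (a b : ℤ → ℝ≥0∞) :
    ∑' k, (∑' j, ENNReal.ofReal (mult j (k - j)) ^ (1 / 2 : ℝ) * (a j * b (k - j))) ^ 2 ≤
      160 * ((∑' j, a j ^ 2) * ∑' j, b j ^ 2) := by
  -- `ν` keeps the pairs with `|j| ≤ |m|`; the others are reduced to these by the reflection `j ↦ k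
  -- - j`, which exchanges `a` and `b`.
  set ν : ℤ → ℤ → ℝ≥0∞ := fun j m => if |j| ≤ |m| then ENNReal.ofReal (mult j m) else 0 with hν
  have hX := tsum_half_sq_le (ν := ν) tsum_mult_le a b
  have hY := tsum_half_sq_le (ν := ν) tsum_mult_le b a
  have hpt : ∀ j m, ENNReal.ofReal (mult j m) ^ (1 / 2 : ℝ) ≤
      ν j m ^ (1 / 2 : ℝ) + ν m j ^ (1 / 2 : ℝ) := fun j m => by
    rcases le_total |j| |m| with h | h
    · simp only [hν, if_pos h]; exact le_self_add
    · simp only [hν, if_pos h]; rw [mult_comm]; exact le_add_self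
  have hrefl : ∀ k, ∑' j, ν (k - j) j ^ (1 / 2 : ℝ) * (a j * b (k - j)) =
      ∑' j, ν j (k - j) ^ (1 / 2 : ℝ) * (b j * a (k - j)) := fun k => by
    rw [← (Equiv.subLeft k).tsum_eq fun j => ν j (k - j) ^ (1 / 2 : ℝ) * (b j * a (k - j))]
    refine tsum_congr fun j => ?_
    simp only [Equiv.subLeft_apply, sub_sub_cancel]
    rw [mul_comm (a j)]
  calc _ ≤ ∑' k, 4 * ((∑' j, ν j (k - j) ^ (1 / 2 : ℝ) * (a j * b (k - j))) ^ 2 +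
        (∑' j, ν j (k - j) ^ (1 / 2 : ℝ) * (b j * a (k - j))) ^ 2) := by
        refine ENNReal.tsum_le_tsum fun k => le_trans ?_ (add_sq_le _ _)
        refine pow_le_pow_left₀ zero_le ?_ 2
        rw [← hrefl k, ← ENNReal.tsum_add]
        refine ENNReal.tsum_le_tsum fun j => ?_
        rw [← add_mul]
        exact mul_le_mul_left (hpt j (k - j)) _
    _ ≤ 4 * (20 * ((∑' j, a j ^ 2) * ∑' j, b j ^ 2) + 20 * ((∑' j, b j ^ 2) * ∑' j, a j ^ 2)) := by
        rw [ENNReal.tsum_mul_left, ENNReal.tsum_add]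
        exact mul_le_mul_right (add_le_add hX hY) _
    _ = _ := by ring

theorem weight_mul_enorm_sq_mult {s : ℝ} (hs : 0 ≤ s) {j m : ℤ} (hj : j ≠ 0) (hm : m ≠ 0)
    (h : j + m ≠ 0) (C x y : ℝ≥0∞) :
    weight s ((j + m : ℤ) : ℝ) ^ 2 * (‖((j + m : ℤ) : ℂ)‖ₑ ^ 2 *
      (C * ENNReal.ofReal (reson j m ^ (-(3 / 5) : ℝ)) * (x * y))) ≤
      C * (ENNReal.ofReal (mult j m) * ((weight s j ^ 2 * x) * (weight s m ^ 2 * y))) := by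
  have e : ENNReal.ofReal (mult j m) =
      ‖((j + m : ℤ) : ℂ)‖ₑ ^ 2 * ENNReal.ofReal (reson j m ^ (-(3 / 5) : ℝ)) := by
    rw [mult, if_neg (by tauto), ENNReal.ofReal_mul (sq_nonneg _), ← sq_abs,
      ENNReal.ofReal_pow (abs_nonneg _), ← ofReal_norm, Complex.norm_intCast]
  rw [e]
  have hw : weight s ((j + m : ℤ) : ℝ) ≤ weight s j * weight s m := by
    push_cast; exact weight_add_le hs _ _
  calc _ ≤ (weight s j * weight s m) ^ 2 * (‖((j + m : ℤ) : ℂ)‖ₑ ^ 2 *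
      (C * ENNReal.ofReal (reson j m ^ (-(3 / 5) : ℝ)) * (x * y))) := by gcongr
    _ = _ := by ring

/-! ### The bilinear estimate for Fourier transforms -/

/-- The bilinear estimate on the Fourier side. -/
theorem exists_wL2_conv_le {α β : ℝ} (hα : α ≠ 0) (hnr : NonResonant α β) {s : ℝ} (hs : 0 ≤ s) :
    ∃ C : ℝ, 0 < C ∧ ∀ V₁ V₂ : ℤ → ℝ → ℂ, (∀ k, StronglyMeasurable (V₁ k)) →
      (∀ k, StronglyMeasurable (V₂ k)) → V₁ 0 = 0 → V₂ 0 = 0 →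
      wL2 α β s (-(2 / 5)) (fun k τ => Complex.I * k * conv V₁ V₂ k τ) ≤
        ENNReal.ofReal C * (wL2 α β s (3 / 10) V₁ * wL2 α β s (3 / 10) V₂) := by
  obtain ⟨C, hC, hb⟩ := exists_two_mode_bound hα hnr
  have hD : C * 160 + 1 ≠ ⊤ := by finiteness
  refine ⟨(((C * 160 + 1) ^ (1 / 2 : ℝ))).toReal, ENNReal.toReal_pos ?_ (by finiteness),
    fun V₁ V₂ m₁ m₂ z₁ z₂ => ?_⟩
  · rw [Ne, ENNReal.rpow_eq_zero_iff]
    simp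
  rw [ENNReal.ofReal_toReal (by finiteness)]
  refine le_of_sq_le_sq ?_
  rw [mul_pow, mul_pow, rpow_half_sq]
  set Q₁ : ℤ → ℝ≥0∞ := fun j => ∫⁻ σ, (weight (3 / 10) (modul α β j σ) * ‖V₁ j σ‖ₑ) ^ 2 with hQ₁
  set Q₂ : ℤ → ℝ≥0∞ := fun j => ∫⁻ σ, (weight (3 / 10) (modul α β j σ) * ‖V₂ j σ‖ₑ) ^ 2 with hQ₂
  set a : ℤ → ℝ≥0∞ := fun j => weight s j * Q₁ j ^ (1 / 2 : ℝ) with ha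
  set b : ℤ → ℝ≥0∞ := fun j => weight s j * Q₂ j ^ (1 / 2 : ℝ) with hbd
  have ha2 : ∀ j, a j ^ 2 = weight s j ^ 2 * Q₁ j := fun j => by
    simp only [ha]; rw [mul_pow, rpow_half_sq]
  have hb2 : ∀ j, b j ^ 2 = weight s j ^ 2 * Q₂ j := fun j => by
    simp only [hbd]; rw [mul_pow, rpow_half_sq]
  have eA : wL2 α β s (3 / 10) V₁ ^ 2 = ∑' j, a j ^ 2 := by simp_rw [wL2_sq, ha2, hQ₁]
  have eB : wL2 α β s (3 / 10) V₂ ^ 2 = ∑' j, b j ^ 2 := by simp_rw [wL2_sq, hb2, hQ₂]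
  rw [eA, eB, wL2_sq]
  set f : ℤ → ℤ → ℝ → ℝ≥0∞ := fun k j τ =>
    weight s k * (‖(k : ℂ)‖ₑ * (weight (-(2 / 5)) (modul α β k τ) *
      ∫⁻ σ, ‖V₁ j σ‖ₑ * ‖V₂ (k - j) (τ - σ)‖ₑ)) with hf
  set A : ℤ → ℤ → ℝ≥0∞ := fun k j =>
    C ^ (1 / 2 : ℝ) * (ENNReal.ofReal (mult j (k - j)) ^ (1 / 2 : ℝ) * (a j * b (k - j))) with hA
  have hfm : ∀ k j, Measurable (f k j) := fun k j =>
    (((measurable_weight _).comp (continuous_modul α β k).measurable).mul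
      (measurable_lintegral_convolution (m₁ j) (m₂ (k - j)))).const_mul _ |>.const_mul _
  have hfA : ∀ k j, ∫⁻ τ, f k j τ ^ 2 ≤ A k j ^ 2 := fun k j => by
    have e : ∫⁻ τ, f k j τ ^ 2 = weight s k ^ 2 * (‖(k : ℂ)‖ₑ ^ 2 *
        ∫⁻ τ, (weight (-(2 / 5)) (modul α β k τ) *
          ∫⁻ σ, ‖V₁ j σ‖ₑ * ‖V₂ (k - j) (τ - σ)‖ₑ) ^ 2) := by
      rw [← lintegral_const_mul' _ _ (by finiteness),
        ← lintegral_const_mul' _ _ (ENNReal.pow_ne_top (weight_ne_top _ _))]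
      simp only [hf, mul_pow]
    rw [e]
    -- Pairs with a zero input frequency vanish because the zero modes do, and the output `k = 0` is
    -- killed by the derivative; these are the cases where `mult` is zero.
    rcases eq_or_ne j 0 with rfl | hj
    · simp [z₁]
    rcases eq_or_ne (k - j) 0 with hm | hm
    · simp [hm, z₂]
    rcases eq_or_ne k 0 with rfl | hk
    · simp
    obtain ⟨m, rfl⟩ : ∃ m, k = j + m := ⟨k - j, by ring⟩
    rw [add_sub_cancel_left] at hm
    simp only [hA, add_sub_cancel_left, mul_pow, rpow_half_sq, ha2, hb2]
    refine le_trans ?_ (weight_mul_enorm_sq_mult hs hj hm hk C (Q₁ j) (Q₂ m))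
    have := hb j m hj hm hk _ _ (m₁ j).measurable.enorm (m₂ m).measurable.enorm
    simp only [mul_pow] at this ⊢
    simp only [hQ₁, hQ₂, mul_pow]
    gcongr
  calc _ ≤ ∑' k : ℤ, ∫⁻ τ, (∑' j, f k j τ) ^ 2 := by
        refine ENNReal.tsum_le_tsum fun k => ?_
        rw [← lintegral_const_mul' _ _ (ENNReal.pow_ne_top (weight_ne_top _ _))]
        refine lintegral_mono fun τ => ?_
        rw [← mul_pow]
        refine pow_le_pow_left₀ zero_le ?_ 2
        simp only [hf, ENNReal.tsum_mul_left]
        rw [enorm_mul, enorm_mul, mul_left_comm (weight (-(2 / 5)) _)]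
        have : ‖Complex.I‖ₑ = 1 := by rw [← ofReal_norm]; simp
        rw [this, one_mul]
        gcongr
        exact enorm_conv_le V₁ V₂ k τ
    -- Minkowski's inequality in `τ` leaves a purely discrete estimate.
    _ ≤ ∑' k : ℤ, (∑' j, A k j) ^ 2 := ENNReal.tsum_le_tsum fun k =>
        lintegral_tsum_sq_le (fun j => (hfm k j).aemeasurable) (hfA k)
    _ = C * ∑' k : ℤ, (∑' j, ENNReal.ofReal (mult j (k - j)) ^ (1 / 2 : ℝ) *
          (a j * b (k - j))) ^ 2 := by
        simp only [hA, ENNReal.tsum_mul_left, mul_pow, rpow_half_sq]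
    _ ≤ C * (160 * ((∑' j, a j ^ 2) * ∑' j, b j ^ 2)) :=
        mul_le_mul_right (tsum_mult_sq_le a b) _
    _ ≤ _ := by
        rw [← mul_assoc]
        exact mul_le_mul_left le_self_add _

/-! ### Mean zero extensions and the bilinear estimate in restricted norms -/

theorem ofFun_zero_mode {δ : ℝ} {u : Torus × ℝ → ℂ} (h : Integrable u (slab δ))
    (hu : MeanZero δ u) (φ : 𝓢(ℝ, ℂ)) : ofFun h 0 φ = 0 := by
  rw [ofFun_apply]
  refine integral_eq_zero_of_ae ?_
  filter_upwards [hu] with t ht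
  have : ∫ x : Torus, u (x, t) ∂AddCircle.haarAddCircle = 0 := by
    rw [AddCircle.integral_haarAddCircle, ht, smul_zero]
  simp [fourierCoeff, this]

/-- The zero mode of `u` vanishes on `(0, δ)`, so that of any extension may be erased: agreement
persists and the norm does not grow. -/
theorem exists_mean_zero_extension {α β s b δ : ℝ} {u : Torus × ℝ → ℂ}
    (h : Integrable u (slab δ)) (hu : MeanZero δ u) {x : ℝ≥0∞}
    (hx : normXδ α β s b δ (ofFun h) < x) : ∃ (v : PDist) (V : ℤ → ℝ → ℂ),
      EqOnTime δ v (ofFun h) ∧ IsFourier v V ∧ (∀ k, StronglyMeasurable (V k)) ∧ V 0 = 0 ∧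
        wL2 α β s b V < x := by
  obtain ⟨v, V, hv, hV, hm, hlt⟩ := exists_of_normXδ_lt hx
  refine ⟨Function.update v 0 0, Function.update V 0 0, fun k φ hφ => ?_, fun k => ?_, fun k => ?_,
    Function.update_self _ _ _, lt_of_le_of_lt ?_ hlt⟩
  · rcases eq_or_ne k 0 with rfl | hk
    · rw [Function.update_self, ofFun_zero_mode h hu]; rfl
    · rw [Function.update_of_ne hk]; exact hv k φ hφ
  · rcases eq_or_ne k 0 with rfl | hk
    · simp only [Function.update_self]
      exact ⟨aestronglyMeasurable_zero, fun φ => by simp⟩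
    · simp only [Function.update_of_ne hk]; exact hV k
  · rcases eq_or_ne k 0 with rfl | hk
    · rw [Function.update_self]; exact stronglyMeasurable_zero
    · rw [Function.update_of_ne hk]; exact hm k
  · refine le_of_sq_le_sq ?_
    rw [wL2_sq, wL2_sq]
    refine ENNReal.tsum_le_tsum fun k => ?_
    rcases eq_or_ne k 0 with rfl | hk
    · simp
    · simp only [Function.update_of_ne hk]; exact le_rfl

theorem energy_le_wL2_sq {α β s b : ℝ} (hs : 0 ≤ s) (hb : 0 ≤ b) (V : ℤ → ℝ → ℂ) :
    energy V ≤ wL2 α β s b V ^ 2 := by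
  have hw : ∀ {c : ℝ}, 0 ≤ c → ∀ x, 1 ≤ weight c x := fun hc x => by
    rw [← weight_zero x]; exact weight_mono hc x
  rw [wL2_sq, energy]
  refine ENNReal.tsum_le_tsum fun k => ?_
  calc _ ≤ ∫⁻ τ, (weight b (modul α β k τ) * ‖V k τ‖ₑ) ^ 2 :=
        lintegral_mono fun τ => pow_le_pow_left₀ zero_le (le_mul_of_one_le_left' (hw hb _)) 2
    _ ≤ _ := le_mul_of_one_le_left' (one_le_pow₀ (hw hs _))

theorem exists_isFourier_derivative_conv {V₁ V₂ : ℤ → ℝ → ℂ}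
    (m₁ : ∀ k, StronglyMeasurable (V₁ k)) (m₂ : ∀ k, StronglyMeasurable (V₂ k))
    (f₁ : energy V₁ < ⊤) (f₂ : energy V₂ < ⊤) :
    ∃ z : PDist, IsFourier z (fun k τ => Complex.I * k * conv V₁ V₂ k τ) ∧
      ∀ (k : ℤ) (φ : 𝓢(ℝ, ℂ)), z k φ = Complex.I * k * ∫ τ, conv V₁ V₂ k τ * chk φ τ := by
  choose T hT using fun k => exists_distribution (memLp_top_conv m₁ m₂ f₁ f₂ k)
  have hz : ∀ (k : ℤ) (φ : 𝓢(ℝ, ℂ)), (dx T) k φ =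
      Complex.I * k * ∫ τ, conv V₁ V₂ k τ * chk φ τ := fun k φ => by
    rw [← hT]; rfl
  refine ⟨dx T, isFourier_iff.2 fun k => ⟨?_, fun φ => ⟨?_, ?_⟩⟩, hz⟩
  · exact ((measurable_conv m₁ m₂ k).const_mul _).aestronglyMeasurable
  · simp_rw [mul_assoc]
    refine Integrable.const_mul (Integrable.const_mul ?_ _) _
    exact (memLp_top_conv m₁ m₂ f₁ f₂ k).integrable_mul
      (memLp_one_iff_integrable.2 (integrable_chk φ))
  · rw [hz, ← integral_const_mul]
    simp_rw [mul_assoc]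

/-- The bilinear estimate. -/
theorem exists_bilinear {α β s : ℝ} (hα : α ≠ 0) (hnr : NonResonant α β) (hs : 0 ≤ s) :
    ∃ C : ℝ, 0 < C ∧ ∀ (δ : ℝ) (u₁ u₂ : Torus × ℝ → ℂ) (h₁ : Integrable u₁ (slab δ))
      (h₂ : Integrable u₂ (slab δ)), MeanZero δ u₁ → MeanZero δ u₂ →
      normXδ α β s (3 / 10) δ (ofFun h₁) < ⊤ → normXδ α β s (3 / 10) δ (ofFun h₂) < ⊤ →
      ∃ h : Integrable (fun p => u₁ p * u₂ p) (slab δ),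
        normZδ α β s δ (dx (ofFun h)) ≤ ENNReal.ofReal C *
          normXδ α β s (3 / 10) δ (ofFun h₁) * normXδ α β s (3 / 10) δ (ofFun h₂) := by
  obtain ⟨C, hC, hb⟩ := exists_wL2_conv_le hα hnr hs
  -- The exponent must exceed `-1/2` for the `Z` norm and be at most `-3/10` for the trade against
  -- the resonance; `-2/5` is one choice.
  obtain ⟨K, hK, hz⟩ := exists_normZδ_le (a := -(2 / 5)) (by norm_num)
  refine ⟨K * C, by positivity, fun δ u₁ u₂ h₁ h₂ z₁ z₂ f₁ f₂ => ?_⟩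
  have key : ∀ x > normXδ α β s (3 / 10) δ (ofFun h₁), ∀ y > normXδ α β s (3 / 10) δ (ofFun h₂),
      ∃ h : Integrable (fun p => u₁ p * u₂ p) (slab δ),
        normXδ α β s (-(2 / 5)) δ (dx (ofFun h)) ≤ ENNReal.ofReal C * (x * y) := by
    intro x hx y hy
    obtain ⟨v₁, V₁, e₁, hV₁, m₁, n₁, l₁⟩ := exists_mean_zero_extension h₁ z₁ hx
    obtain ⟨v₂, V₂, e₂, hV₂, m₂, n₂, l₂⟩ := exists_mean_zero_extension h₂ z₂ hy
    have E₁ : energy V₁ < ⊤ :=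
      (energy_le_wL2_sq hs (by norm_num) V₁).trans_lt (ENNReal.pow_lt_top (l₁.trans_le le_top))
    have E₂ : energy V₂ < ⊤ :=
      (energy_le_wL2_sq hs (by norm_num) V₂).trans_lt (ENNReal.pow_lt_top (l₂.trans_le le_top))
    obtain ⟨h, hp⟩ := product_eq h₁ h₂ e₁ e₂ hV₁ hV₂ m₁ m₂ E₁ E₂
    obtain ⟨z, hzF, hzv⟩ := exists_isFourier_derivative_conv m₁ m₂ E₁ E₂
    have heq : EqOnTime δ z (dx (ofFun h)) := fun k φ hφ => by
      rw [hzv, ← hp k φ hφ]; rfl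
    exact ⟨h, (normXδ_le heq hzF).trans ((hb V₁ V₂ m₁ m₂ n₁ n₂).trans (by gcongr))⟩
  -- Finiteness of the norms lets `⊤` play the part of both bounds, which already yields
  -- integrability of the product.
  obtain ⟨h, -⟩ := key ⊤ f₁ ⊤ f₂
  refine ⟨h, (hz α β s δ _).trans ?_⟩
  have hC0 : ENNReal.ofReal C ≠ 0 := by simpa using hC
  have hfin : normXδ α β s (-(2 / 5)) δ (dx (ofFun h)) / ENNReal.ofReal C ≤
      normXδ α β s (3 / 10) δ (ofFun h₁) * normXδ α β s (3 / 10) δ (ofFun h₂) := by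
    -- Letting `x` and `y` decrease to the two norms; their finiteness excludes the product `0 · ∞`.
    refine ENNReal.le_mul_of_forall_lt (Or.inr f₂.ne) (Or.inl f₁.ne) fun x hx y hy => ?_
    obtain ⟨h', hxy⟩ := key x hx y hy
    rw [ENNReal.div_le_iff' hC0 ENNReal.ofReal_ne_top]
    exact hxy
  rw [ENNReal.div_le_iff' hC0 ENNReal.ofReal_ne_top] at hfin
  rw [ENNReal.ofReal_mul hK.le, mul_assoc, mul_assoc]
  exact mul_le_mul_right hfin _

end Kawahara

end

theorem lemma2p3 :
    -- time localisation, with a constant depending only on `b` and `b'`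
    (∀ b b' : ℝ, -1 / 2 < b → b < b' → b' < 1 / 2 →
      ∃ C : ℝ, 0 < C ∧ ∀ α β : ℝ, α ≠ 0 → Kawahara.NonResonant α β →
        ∀ s δ : ℝ, 0 ≤ s → 0 < δ → δ < 1 → ∀ u : Kawahara.PDist,
          Kawahara.normXδ α β s b δ u ≤
            ENNReal.ofReal (C * δ ^ (b' - b)) * Kawahara.normXδ α β s b' δ u) ∧
    -- from `Y` to `Z` with a gain of `δ ^ (1 - ε)`, for every `ε > 0`
    (∀ ε : ℝ, 0 < ε →
      ∃ C : ℝ, 0 < C ∧ ∀ α β : ℝ, α ≠ 0 → Kawahara.NonResonant α β →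
        ∀ s δ : ℝ, 0 ≤ s → 0 < δ → δ < 1 → ∀ u : Kawahara.PDist,
          Kawahara.normZδ α β s δ u ≤
            ENNReal.ofReal (C * δ ^ (1 - ε)) * Kawahara.normYδ α β s δ u) ∧
    -- the bilinear estimate, with a constant depending only on `α`, `β` and `s`
    (∀ α β s : ℝ, α ≠ 0 → Kawahara.NonResonant α β → 0 ≤ s →
      ∃ C : ℝ, 0 < C ∧ ∀ δ : ℝ, 0 < δ → δ < 1 →
        ∀ (u₁ u₂ : Kawahara.Torus × ℝ → ℂ)
          (h₁ : MeasureTheory.Integrable u₁ (Kawahara.slab δ))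
          (h₂ : MeasureTheory.Integrable u₂ (Kawahara.slab δ)),
          Kawahara.MeanZero δ u₁ → Kawahara.MeanZero δ u₂ →
          Kawahara.normXδ α β s (3 / 10) δ (Kawahara.ofFun h₁) < ⊤ →
          Kawahara.normXδ α β s (3 / 10) δ (Kawahara.ofFun h₂) < ⊤ →
          ∃ h : MeasureTheory.Integrable (fun p => u₁ p * u₂ p) (Kawahara.slab δ),
            Kawahara.normZδ α β s δ (Kawahara.dx (Kawahara.ofFun h)) ≤
              ENNReal.ofReal C * Kawahara.normXδ α β s (3 / 10) δ (Kawahara.ofFun h₁) *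
                Kawahara.normXδ α β s (3 / 10) δ (Kawahara.ofFun h₂)) := by
  refine ⟨fun b b' hb hbb hb' => ?_, fun ε hε => ?_, fun α β s hα hnr hs => ?_⟩
  · obtain ⟨C, hC, h⟩ := Kawahara.exists_time_localisation (b := b) (b' := b')
      (by linarith) hbb.le hb'
    exact ⟨C, hC, fun α β _ _ s δ _ hδ hδ1 u => h α β s δ hδ hδ1.le u⟩
  · obtain ⟨C, hC, h⟩ := Kawahara.exists_normZδ_le_normYδ hε
    exact ⟨C, hC, fun α β _ _ s δ _ hδ hδ1 u => h α β s δ hδ hδ1 u⟩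
  · obtain ⟨C, hC, h⟩ := Kawahara.exists_bilinear hα hnr hs
    exact ⟨C, hC, fun δ _ _ u₁ u₂ h₁ h₂ => h δ u₁ u₂ h₁ h₂⟩
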